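/- Let $G$ be a finite connected graph embedded in the oriented plane; every edge consists of two oppositely directed darts, with capacities $c[d]\ge 0$ on the darts. Let $s_1,t_1,s_2,t_2,\ldots,s_m,t_m$ be distinct vertices (sources $s_i$, sinks $t_i$), occurring in this clockwise order on the boundary of the infinite face. A flow is an antisymmetric real function on darts that is at most $c$ and balanced at all non-terminals; residual capacities are $c_f=c-f$; a path or cycle is residual if all its darts have positive residual capacity. The leftmost $s$-to-$t$ flow in a graph is the maximum $s$-to-$t$ flow with respect to which no clockwise simple cycle is residual. {\sc AbstractFlow}: (1) Choose a flow $f_0$ with respect to which no $s_j$-to-$t_i$ path with $i<j$ and no clockwise cycle is residual; the current capacities become $c_0=c-f_0$. (2) For $j=1,\ldots,m$ and, for each $j$, for $i=j,j-1,\ldots,1$: find the leftmost $s_i$-to-$t_j$ flow $f_{ij}$ with respect to the current capacities and subtract it from them. Return $c$ minus the final residual capacities. {\sc AbstractRecursiveFlow}: perform (1), then call Helper$(G;\ ;(s_1,t_1),\ldots,(s_m,t_m);c_0)$. The call Helper$(H;\text{earlier sources};\text{list of source-sink pairs};c)$ stops if there are no pairs. Otherwise let $(s,t)$ be the first pair.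 - Find the leftmost $s$-to-$t$ flow $f$ in $H$ with respect to $c$ and let $c'=c-f$. - Let $P$ be the rightmost path in the decomposition of $f$ into non-crossing simple $s$-to-$t$ paths ordered from left to right, and $C$ the leftmost minimum $s$-$t$ cut of $H$ (among the minimum cuts with both sides connected, the one with the largest $s$-side). - Delete from $H$ the edges strictly left of $P$ (none if $f=0$) and the edges of $C$. Let $G_1$ be the resulting component that contains the first source of the call (the first earlier source, or $s$ if there is none). - If $t\notin G_1$, let $G_2$ be the component of $t$. Call Helper on $G_2$ with no earlier sources, the remaining pairs up to the last one whose sink is in $G_2$, and $c'$; then call Helper on $G_1$ with $s$ appended to the earlier sources, the remaining pairs from the first one whose sink is in $G_1$, and $c'$. - If $t\in G_1$, let $s_k$ be the last earlier source in $G_1$. Call Helper on $G_1$ with the earlier sources preceding $s_k$, the pair $(s_k,t)$ followed by the remaining pairs, and $c'$. Lemma. Step (1) can be performed, and for every choice of $f_0$ in it all further steps of both algorithms can be performed and both algorithms terminate. If both use the same $f_0$, then {\sc AbstractRecursiveFlow} finds the same non-zero flows $f_{ij}$, in the same order, as {\sc AbstractFlow}. Consequently $f_0$ plus the sum of the flows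 found by {\sc AbstractRecursiveFlow} equals the flow returned by {\sc AbstractFlow}, and this is a maximum flow from $\{s_1,\ldots,s_m\}$ to $\{t_1,\ldots,t_m\}$ (of maximum net flow into the sinks). -/

import Mathlib

noncomputable section PlanarFlow

/-- A finite connected graph embedded in the oriented plane, as a combinatorial map.
Every edge consists of two darts `d` and `rev d`; `tail d` is the vertex that `d` leaves, and
`rot d` is the next dart after `d` in clockwise order around `tail d`. The orbits of
`d ↦ rot (rev d)` are the faces: such an orbit consists of the darts that have the face on their
left. Planarity is Euler's formula `|V| - |E| + |F| = 2`, multiplied by two. -/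
structure PlaneGraph (V D : Type*) [Fintype V] [Fintype D] where
  rev : Equiv.Perm D
  rev_rev : ∀ d, rev (rev d) = d
  rev_ne : ∀ d, rev d ≠ d
  rot : Equiv.Perm D
  tail : D → V
  tail_eq_iff : ∀ d e, tail d = tail e ↔ rot.SameCycle d e
  connected : ∀ u v : V,
    Relation.ReflTransGen (fun x y => ∃ d, tail d = x ∧ tail (rev d) = y) u v
  euler : 2 * (Nat.card V +
    Nat.card (Quotient (Equiv.Perm.SameCycle.setoid (rot * rev)))) = Nat.card D + 4

/-- The next dart along the boundary of the face to the left of a dart. -/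
def PlaneGraph.next {V D : Type*} [Fintype V] [Fintype D] (G : PlaneGraph V D) :
    Equiv.Perm D :=
  G.rot * G.rev

/-- A plane graph together with `m` sources and `m` sinks that alternate along the clockwise
boundary `base, next base, next (next base), …` of the infinite face, the face to the left of
`base`. The terminals are the tails of the boundary darts at the given positions, so their
clockwise order is `s 0, t 0, s 1, t 1, …, s (m-1), t (m-1)`; they are distinct vertices. -/
structure BoundaryNetwork (V D : Type*) [Fintype V] [Fintype D] (m : ℕ)
    extends PlaneGraph V D where
  base : D
  srcPos : Fin m → ℕ
  sinkPos : Fin m → ℕ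
  src_lt_sink : ∀ i, srcPos i < sinkPos i
  sink_lt_src : ∀ i j, i < j → sinkPos i < srcPos j
  sink_lt_period : ∀ i, sinkPos i < Function.minimalPeriod toPlaneGraph.next base
  src_injective : Function.Injective
    (fun i => toPlaneGraph.tail ((toPlaneGraph.next ^ srcPos i) base))
  sink_injective : Function.Injective
    (fun i => toPlaneGraph.tail ((toPlaneGraph.next ^ sinkPos i) base))
  src_ne_sink : ∀ i j, toPlaneGraph.tail ((toPlaneGraph.next ^ srcPos i) base) ≠
    toPlaneGraph.tail ((toPlaneGraph.next ^ sinkPos j) base)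

/-- A subgraph, given by its vertices and its darts; it inherits the embedding. -/
structure Piece (V D : Type*) where
  verts : Set V
  darts : Set D

namespace BoundaryNetwork

open scoped Classical

variable {V D : Type*} [Fintype V] [Fintype D] {m : ℕ} (N : BoundaryNetwork V D m)

/-! ### Faces, walks, clockwise cycles -/

def head (d : D) : V := N.tail (N.rev d)

abbrev Face : Type _ := Quotient (Equiv.Perm.SameCycle.setoid (N.rot * N.rev))

def leftFace (d : D) : N.Face := Quotient.mk _ d

def rightFace (d : D) : N.Face := N.leftFace (N.rev d)

/-- The infinite face. -/
def outer : N.Face := N.leftFace N.base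

/-- The `i`-th source. -/
def s (i : Fin m) : V := N.tail ((N.next ^ N.srcPos i) N.base)

/-- The `i`-th sink. -/
def t (i : Fin m) : V := N.tail ((N.next ^ N.sinkPos i) N.base)

/-- The clockwise boundary path from `s i` to `t j` (used for `i ≤ j`). -/
def arc (i j : Fin m) : List D :=
  (List.Ico (N.srcPos i) (N.sinkPos j)).map (fun k => (N.next ^ k) N.base)

/-- The dart sequence `p` is a walk from `u` to `v`. -/
def IsWalk : V → List D → V → Prop
  | u, [], v => u = v
  | u, d :: p, v => N.tail d = u ∧ IsWalk (N.head d) p v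

def IsSimplePath (u : V) (p : List D) (v : V) : Prop :=
  N.IsWalk u p v ∧ (u :: p.map N.head).Nodup

def IsSimpleCycle (p : List D) : Prop :=
  p ≠ [] ∧ (∃ v, N.IsWalk v p v) ∧ (p.map N.head).Nodup

/-- There is a path from `u` to `v` all of whose darts belong to `A`. -/
def Reaches (A : Set D) (u v : V) : Prop :=
  Relation.ReflTransGen (fun x y => ∃ d ∈ A, N.tail d = x ∧ N.head d = y) u v

/-- The antisymmetric chain of a dart sequence: uses of `d` minus uses of its reverse. -/
def chain (p : List D) (d : D) : ℤ := (p.count d : ℤ) - (p.count (N.rev d) : ℤ)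

/-- The closed chain `z` runs once, clockwise, around the set `I` of finite faces: the faces in
`I` are to the right of its darts and those outside `I` to the left. -/
def Encloses (z : D → ℤ) (I : Set N.Face) : Prop :=
  N.outer ∉ I ∧
    ∀ d, z d = (if N.rightFace d ∈ I then 1 else 0) - (if N.leftFace d ∈ I then 1 else 0)

def Clockwise (z : D → ℤ) : Prop := ∃ I : Set N.Face, I.Nonempty ∧ N.Encloses z I

/-- For paths `p`, `q` with the same ends: `p` is left of `q`, i.e. `p` followed by the
reverse of `q` is clockwise. -/
def LeftOf (p q : List D) : Prop := N.Clockwise (fun d => N.chain p d - N.chain q d)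

/-- The dart `d` is strictly left of the `s i`-to-`t j` path `p`: it is on or inside the clockwise
cycle formed by the boundary from `s i` to `t j` and the reverse of `p`, but not on `p`
(in either direction). -/
def StrictlyLeft (i j : Fin m) (p : List D) (d : D) : Prop :=
  d ∉ p ∧ N.rev d ∉ p ∧
    (d ∈ N.arc i j ∨ N.rev d ∈ N.arc i j ∨
      ∃ I : Set N.Face, N.Encloses (fun e => N.chain (N.arc i j) e - N.chain p e) I ∧
        (N.leftFace d ∈ I ∨ N.rightFace d ∈ I))

/-! ### Flows -/

/-- Net flow entering the vertex `v`. -/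
def netIn (f : D → ℝ) (v : V) : ℝ := ∑ d with N.head d = v, f d

/-- `f` is a flow in the subgraph with darts `A`, for capacities `c` and terminals `T`. -/
def IsFlow (A : Set D) (T : Set V) (c f : D → ℝ) : Prop :=
  (∀ d, f (N.rev d) = - f d) ∧ (∀ d, f d ≤ c d) ∧ (∀ v, v ∉ T → N.netIn f v = 0) ∧
    (∀ d, d ∉ A → f d = 0)

/-- `f` is a flow from the sources `S` to the sinks `T` of maximum value, the value being
the net flow that enters the sinks. -/
def IsMaxFlow (A : Set D) (S T : Finset V) (c f : D → ℝ) : Prop :=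
  N.IsFlow A (↑S ∪ ↑T) c f ∧
    ∀ g, N.IsFlow A (↑S ∪ ↑T) c g → ∑ v ∈ T, N.netIn g v ≤ ∑ v ∈ T, N.netIn f v

/-- No clockwise simple cycle with darts in `A` is residual for the capacities `c`. -/
def NoResidualClockwise (A : Set D) (c : D → ℝ) : Prop :=
  ∀ p, N.IsSimpleCycle p → (∀ d ∈ p, d ∈ A) → N.Clockwise (N.chain p) → ∃ d ∈ p, ¬ 0 < c d

/-- `f` is a leftmost maximum `u`-to-`v` flow in the subgraph with darts `A`. -/
def IsLeftmostMaxFlow (A : Set D) (c : D → ℝ) (u v : V) (f : D → ℝ) : Prop :=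
  N.IsMaxFlow A {u} {v} c f ∧ N.NoResidualClockwise A (c - f)

/-- `L` is the decomposition of `f` into simple `u`-to-`v` paths, listed from left to right, with
the positive amounts of flow that they carry. -/
def IsPathDecomposition (f : D → ℝ) (u v : V) (L : List (List D × ℝ)) : Prop :=
  (∀ q ∈ L, N.IsSimplePath u q.1 v ∧ 0 < q.2) ∧
    L.Pairwise (fun q r => N.LeftOf q.1 r.1) ∧
    ∀ d, f d = (L.map (fun q => q.2 * (N.chain q.1 d : ℝ))).sum

/-! ### Cuts -/

/-- The darts of `H` that leave the vertex set `X`. -/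
def cutDarts (H : Piece V D) (X : Set V) : Set D :=
  {d | d ∈ H.darts ∧ N.tail d ∈ X ∧ N.head d ∉ X}

def cutValue (H : Piece V D) (c : D → ℝ) (X : Set V) : ℝ := ∑ d with d ∈ N.cutDarts H X, c d

/-- The cut `N.cutDarts H X` is a simple `u`-`v`-cut of `H`: both of its sides are connected.
(These are the cuts whose dual is a simple path from the boundary `u`-to-`v` to the boundary
`v`-to-`u`.) -/
def IsSimpleCut (H : Piece V D) (u v : V) (X : Set V) : Prop :=
  u ∈ X ∧ v ∉ X ∧ X ⊆ insert u H.verts ∧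
    (∀ x ∈ X, N.Reaches {d | d ∈ H.darts ∧ N.tail d ∈ X ∧ N.head d ∈ X} u x) ∧
    (∀ x ∈ H.verts, x ∉ X → N.Reaches {d | d ∈ H.darts ∧ N.tail d ∉ X ∧ N.head d ∉ X} v x)

def IsSimpleMinCut (H : Piece V D) (c : D → ℝ) (u v : V) (X : Set V) : Prop :=
  N.IsSimpleCut H u v X ∧
    ∀ Y : Set V, u ∈ Y → v ∉ Y → N.cutValue H c X ≤ N.cutValue H c Y

/-- `X` is the source side of the leftmost minimum `u`-`v`-cut. The dual path of a cut, taken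
from the boundary `u`-to-`v` to the boundary `v`-to-`u`, has the `v`-side on its left, so one
cut is left of another one iff its `u`-side is the larger one; the vertices in between are those
enclosed clockwise by the two dual paths. -/
def IsLeftmostCut (H : Piece V D) (c : D → ℝ) (u v : V) (X : Set V) : Prop :=
  N.IsSimpleMinCut H c u v X ∧ ∀ Y, N.IsSimpleMinCut H c u v Y → Y ⊆ X

/-! ### The algorithms -/

/-- The whole graph. -/
def whole (_ : BoundaryNetwork V D m) : Piece V D := ⟨Set.univ, Set.univ⟩

/-- The component of the vertex `v` in the graph with darts `A`. -/
def component (A : Set D) (v : V) : Piece V D :=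
  ⟨{u | N.Reaches A v u}, {d | d ∈ A ∧ N.Reaches A v (N.tail d)}⟩

def sources : Finset V := Finset.univ.image N.s

def sinks : Finset V := Finset.univ.image N.t

/-- The common first step: `f₀` is a flow after which no `s j`-to-`t i` path with `i < j` and
no clockwise cycle is residual. -/
def IsInitialSaturation (c f₀ : D → ℝ) : Prop :=
  N.IsFlow Set.univ (↑N.sources ∪ ↑N.sinks) c f₀ ∧
    (∀ i j, i < j → ¬ N.Reaches {d | 0 < (c - f₀) d} (N.s j) (N.t i)) ∧
    N.NoResidualClockwise Set.univ (c - f₀)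

/-- A flow found by one of the algorithms, with the indices of its source and its sink. -/
structure Augmentation (D : Type*) (m : ℕ) where
  source : Fin m
  sink : Fin m
  flow : D → ℝ

/-- Leftmost augmentation for the pairs `(i, j)` of a list in turn, from capacities `c`; the last
argument is the final residual capacity function. -/
inductive LoopRun :
    List (Fin m × Fin m) → (D → ℝ) → List (Augmentation D m) → (D → ℝ) → Prop
  | nil (c : D → ℝ) : LoopRun [] c [] c
  | cons (i j : Fin m) (rest : List (Fin m × Fin m)) (c f c' : D → ℝ)
      (tr : List (Augmentation D m)) :
      N.IsLeftmostMaxFlow Set.univ c (N.s i) (N.t j) f →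
      LoopRun rest (c - f) tr c' →
      LoopRun ((i, j) :: rest) c (⟨i, j, f⟩ :: tr) c'

/-- For `j` increasing, for `i = j, j - 1, …` down to the first index. -/
def doubleLoop (m : ℕ) : List (Fin m × Fin m) :=
  (List.finRange m).flatMap
    (fun j => ((List.finRange m).filter (fun i => i ≤ j)).reverse.map (fun i => (i, j)))

/-- AbstractFlow on capacities `c`, with initial flow `f₀`: it finds the flows `tr` in this order
and ends with residual capacities `cEnd`. -/
def AbstractFlow (c f₀ : D → ℝ) (tr : List (Augmentation D m)) (cEnd : D → ℝ) : Prop :=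
  N.IsInitialSaturation c f₀ ∧ N.LoopRun (doubleLoop m) (c - f₀) tr cEnd

/-- The darts of `H` that remain when those strictly left of the rightmost (last) path of the
decomposition `L` of an `s i`-to-`t j` flow, and those of the cut with source side `X`, are
deleted (edges are deleted, that is, darts together with their reverses). If the flow is zero,
then `L` is empty and there is nothing left of a path to delete. -/
def remaining (H : Piece V D) (i j : Fin m) (L : List (List D × ℝ)) (X : Set V) : Set D :=
  {d | d ∈ H.darts ∧ (∀ q ∈ L.getLast?, ¬ N.StrictlyLeft i j q.1 d) ∧
    d ∉ N.cutDarts H X ∧ N.rev d ∉ N.cutDarts H X}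

/-- `HelperRun H early pairs c tr`: AbstractRecursiveFlowHelper on the graph `H`, the earlier
sources `early` (in clockwise order), the source-sink pairs `pairs` (in clockwise order) and the
capacities `c` terminates, having found the flows `tr` in this order.

With `(i, j)` the first pair, `G₁` is the component that contains the first source and, if `t j` is
not in `G₁`, `G₂` is the component that contains `t j`. -/
inductive HelperRun : Piece V D → List (Fin m) → List (Fin m × Fin m) → (D → ℝ) →
    List (Augmentation D m) → Prop
  | done (H : Piece V D) (early : List (Fin m)) (c : D → ℝ) : HelperRun H early [] c []
  /-- `t j` is in `G₂`: recurse on `G₂` with the pairs up to the last one with sink in `G₂`, then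
  on `G₁` with the pairs from the first one with sink in `G₁`. -/
  | split (H : Piece V D) (early : List (Fin m)) (i j : Fin m) (rest : List (Fin m × Fin m))
      (c f : D → ℝ) (L : List (List D × ℝ)) (X : Set V) (G₁ G₂ : Piece V D)
      (tr₁ tr₂ : List (Augmentation D m)) :
      N.IsLeftmostMaxFlow H.darts c (N.s i) (N.t j) f →
      N.IsPathDecomposition f (N.s i) (N.t j) L →
      N.IsLeftmostCut H c (N.s i) (N.t j) X →
      G₁ = N.component (N.remaining H i j L X) (N.s (early.headD i)) →
      N.t j ∉ G₁.verts →
      G₂ = N.component (N.remaining H i j L X) (N.t j) →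
      HelperRun G₂ []
        (rest.filter (fun p => ∃ q ∈ rest, p.2 ≤ q.2 ∧ N.t q.2 ∈ G₂.verts)) (c - f) tr₂ →
      HelperRun G₁ (early ++ [i])
        (rest.filter (fun p => ∃ q ∈ rest, q.2 ≤ p.2 ∧ N.t q.2 ∈ G₁.verts)) (c - f) tr₁ →
      HelperRun H early ((i, j) :: rest) c (⟨i, j, f⟩ :: (tr₂ ++ tr₁))
  /-- `t j` is in `G₁`: go on with `t j` and the last earlier source `k` that is in `G₁`. -/
  | back (H : Piece V D) (early₁ early₂ : List (Fin m)) (k i j : Fin m)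
      (rest : List (Fin m × Fin m)) (c f : D → ℝ) (L : List (List D × ℝ)) (X : Set V)
      (G₁ : Piece V D) (tr : List (Augmentation D m)) :
      N.IsLeftmostMaxFlow H.darts c (N.s i) (N.t j) f →
      N.IsPathDecomposition f (N.s i) (N.t j) L →
      N.IsLeftmostCut H c (N.s i) (N.t j) X →
      G₁ = N.component (N.remaining H i j L X)
        (N.s ((early₁ ++ k :: early₂).headD i)) →
      N.t j ∈ G₁.verts →
      N.s k ∈ G₁.verts →
      (∀ l ∈ early₂, N.s l ∉ G₁.verts) →
      HelperRun G₁ early₁ ((k, j) :: rest) (c - f) tr →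
      HelperRun H (early₁ ++ k :: early₂) ((i, j) :: rest) c (⟨i, j, f⟩ :: tr)

/-- AbstractRecursiveFlow on capacities `c`, with initial flow `f₀`: it finds the flows `tr` in
this order. -/
def AbstractRecursiveFlow (c f₀ : D → ℝ) (tr : List (Augmentation D m)) : Prop :=
  N.IsInitialSaturation c f₀ ∧
    N.HelperRun N.whole [] ((List.finRange m).map (fun i => (i, i))) (c - f₀) tr

/-- The sub-sequence of the non-zero flows. -/
def nonzero (tr : List (Augmentation D m)) : List (Augmentation D m) :=
  tr.filter (fun a => a.flow ≠ 0)

/-- The initial flow plus all the flows found. -/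
def total (f₀ : D → ℝ) (tr : List (Augmentation D m)) : D → ℝ :=
  f₀ + (tr.map (fun a => a.flow)).sum

end BoundaryNetwork

end PlanarFlow

/-! Planarity enters through one consequence of Euler's formula (`exists_face_potential`): a
circulation is the boundary of a function on faces. A flow between two vertices of the infinite face
also has a potential once that face is split at these vertices (`exists_potential`). The absence of
residual clockwise cycles then acts as a maximum principle: every nonempty union of finite faces has
a non-residual dart on its clockwise boundary (`NoResidualClockwise.exists_boundary`). Applied to
extreme level sets, it shows that leftmost flows are unique and that their potentials lie between
zero and the value of the flow. The upper level sets of such a potential are bounded by simple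
paths, and these are the non-crossing decomposition.

The double loop is correct because augmenting from one pair creates no residual path for a pair
treated before, nor from a source to a sink of smaller index (`LoopInv.step`). At the end no source
has a residual path to a sink, so the total flow is maximum.

A recursive call stands for the stretch `block pairs` of the double loop. The claim proved by
induction on the run (`HelperRun.nonzero_eq`) assumes that all flows of this stretch live in H and
that the capacities agree there. By uniqueness the first flow f is then the same in H and in the
whole graph. It remains to see that later flows avoid the deleted edges and that the skipped pairs
carry nothing (`CallStep.mem_remaining_of_flow`, `eq_zero_of_support`).

Nothing left of a path P of f is used later (`LoopInv.eq_zero_of_strictlyLeft`): the reverse darts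
of P stay residual, so a region left of P where the potential of a later flow deviates from its
value on the boundary would contradict the maximum principle. The cut is not crossed because it is
saturated. Connected sets cannot interleave on the boundary (`not_interleaved`); hence either all
earlier sources are on the source side, or all later sinks are on the sink side, and in both cases
no later flow has a residual way across. The same lemma determines which terminals fall into which
component. A skipped pair has a source that sends nothing inside H or is separated from its sink by
the deletions. -/

noncomputable section PlanarFlowTheory

namespace BoundaryNetwork

open scoped Classical

variable {V D : Type*} [Fintype V] [Fintype D] {m : ℕ} (N : BoundaryNetwork V D m)

/-! ### Antisymmetric functions and reachability -/

@[simp] theorem rev_rev' (d : D) : N.rev (N.rev d) = d := N.rev_rev d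

@[simp] theorem head_rev (d : D) : N.head (N.rev d) = N.tail d := by simp [head]

theorem tail_rev (d : D) : N.tail (N.rev d) = N.head d := rfl

def Anti (z : D → ℝ) : Prop := ∀ d, z (N.rev d) = - z d

/-- The darts on which `z` is positive. -/
def pos (z : D → ℝ) : Set D := {d | 0 < z d}

variable {N}

theorem Anti.add {y z : D → ℝ} (hy : N.Anti y) (hz : N.Anti z) : N.Anti (y + z) := by
  intro d; simp [hy d, hz d]; ring

theorem Anti.sub {y z : D → ℝ} (hy : N.Anti y) (hz : N.Anti z) : N.Anti (y - z) := by
  intro d; simp [hy d, hz d]; ring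

theorem Anti.neg {y : D → ℝ} (hy : N.Anti y) : N.Anti (-y) := by
  intro d; simp [hy d]

theorem Anti.smul {y : D → ℝ} (r : ℝ) (hy : N.Anti y) : N.Anti (r • y) := by
  intro d; simp [hy d]

theorem Anti.zero : N.Anti (0 : D → ℝ) := by
  intro d; simp

variable (N)

theorem netIn_add (y z : D → ℝ) (v : V) : N.netIn (y + z) v = N.netIn y v + N.netIn z v := by
  simp [netIn, Finset.sum_add_distrib]

theorem netIn_sub (y z : D → ℝ) (v : V) : N.netIn (y - z) v = N.netIn y v - N.netIn z v := by
  simp [netIn, Finset.sum_sub_distrib]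

theorem netIn_smul (r : ℝ) (z : D → ℝ) (v : V) : N.netIn (r • z) v = r * N.netIn z v := by
  simp [netIn, Finset.mul_sum]

theorem netIn_neg (z : D → ℝ) (v : V) : N.netIn (-z) v = - N.netIn z v := by
  simp [netIn]

theorem netIn_zero (v : V) : N.netIn (0 : D → ℝ) v = 0 := by
  simp [netIn]

/-- The net flow into a vertex set crosses its boundary. -/
theorem sum_netIn {z : D → ℝ} (hz : N.Anti z) (W : Set V) :
    ∑ v with v ∈ W, N.netIn z v = ∑ d with N.head d ∈ W ∧ N.tail d ∉ W, z d := by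
  have h1 : ∑ v with v ∈ W, N.netIn z v = ∑ d with N.head d ∈ W, z d := by
    simp only [netIn, Finset.sum_filter]
    rw [show (∑ a : V, if a ∈ W then ∑ d : D, (if N.head d = a then z d else 0) else 0)
      = ∑ a : V, ∑ d : D, (if a ∈ W ∧ N.head d = a then z d else 0) from
        Finset.sum_congr rfl fun a _ => by split_ifs with h <;> simp [h]]
    rw [Finset.sum_comm]
    refine Finset.sum_congr rfl fun d _ => ?_
    rw [Finset.sum_eq_single (N.head d)]
    · simp
    · intro b _ hb
      rw [if_neg]
      rintro ⟨_, h⟩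
      exact hb h.symm
    · simp
  have h2 : ∑ d with N.head d ∈ W ∧ N.tail d ∈ W, z d = 0 := by
    have : ∑ d with N.head d ∈ W ∧ N.tail d ∈ W, z d
        = ∑ d with N.head d ∈ W ∧ N.tail d ∈ W, - z d := by
      refine Finset.sum_bij (fun d _ => N.rev d) ?_ ?_ ?_ ?_
      · intro d hd
        simp only [Finset.mem_filter, Finset.mem_univ, true_and, head_rev, tail_rev] at hd ⊢
        exact ⟨hd.2, hd.1⟩
      · intro a _ b _ h
        exact N.rev.injective h
      · intro d hd
        refine ⟨N.rev d, ?_, by simp⟩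
        simp only [Finset.mem_filter, Finset.mem_univ, true_and, head_rev, tail_rev] at hd ⊢
        exact ⟨hd.2, hd.1⟩
      · intro d _
        rw [hz d, neg_neg]
    rw [Finset.sum_neg_distrib] at this
    linarith
  rw [h1, ← Finset.sum_filter_add_sum_filter_not (Finset.univ.filter fun d => N.head d ∈ W)
    (fun d => N.tail d ∈ W), Finset.filter_filter, Finset.filter_filter, h2, zero_add]

variable {N}

theorem Reaches.mono {A B : Set D} (h : A ⊆ B) {u v : V} (hr : N.Reaches A u v) :
    N.Reaches B u v :=
  Relation.ReflTransGen.mono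
    (show ∀ _ _, _ → _ from fun _ _ ⟨d, hd, h1, h2⟩ => ⟨d, h hd, h1, h2⟩) _ _ hr

theorem Reaches.refl {A : Set D} (u : V) : N.Reaches A u u := Relation.ReflTransGen.refl

theorem Reaches.trans {A : Set D} {u v w : V} (h : N.Reaches A u v) (h' : N.Reaches A v w) :
    N.Reaches A u w := Relation.ReflTransGen.trans h h'

theorem Reaches.dart {A : Set D} {d : D} (hd : d ∈ A) : N.Reaches A (N.tail d) (N.head d) :=
  Relation.ReflTransGen.single ⟨d, hd, rfl, rfl⟩

theorem Reaches.reverse {A B : Set D} (hAB : ∀ d ∈ A, N.rev d ∈ B) {u v : V}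
    (hr : N.Reaches A u v) : N.Reaches B v u := by
  induction hr with
  | refl => exact Reaches.refl _
  | tail _ h ih =>
    obtain ⟨d, hd, rfl, rfl⟩ := h
    have := Reaches.dart (N := N) (hAB d hd)
    rw [head_rev, tail_rev] at this
    exact this.trans ih

/-- A set that is closed under the darts of `A` contains everything reachable from it. -/
theorem Reaches.mem_of_closed {A : Set D} {W : Set V} {u v : V} (hr : N.Reaches A u v)
    (hu : u ∈ W) (hW : ∀ d ∈ A, N.tail d ∈ W → N.head d ∈ W) : v ∈ W := by
  induction hr with
  | refl => exact hu
  | tail _ h ih => obtain ⟨d, hd, rfl, rfl⟩ := h; exact hW d hd ih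

/-- A walk from inside to outside of a set leaves it. -/
theorem Reaches.exists_exit {A : Set D} {W : Set V} {u v : V} (hr : N.Reaches A u v)
    (hu : u ∈ W) (hv : v ∉ W) : ∃ d ∈ A, N.tail d ∈ W ∧ N.head d ∉ W ∧
      N.Reaches A u (N.tail d) ∧ N.Reaches A (N.head d) v := by
  induction hr using Relation.ReflTransGen.head_induction_on with
  | refl => exact absurd hu hv
  | head h hr ih =>
    obtain ⟨d, hd, rfl, rfl⟩ := h
    by_cases hh : N.head d ∈ W
    · obtain ⟨e, he, h1, h2, h3, h4⟩ := ih hh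
      exact ⟨e, he, h1, h2, (Reaches.dart hd).trans h3, h4⟩
    · exact ⟨d, hd, hu, hh, Reaches.refl _, hr⟩

/-- A reachable vertex is reached through reachable vertices. -/
theorem Reaches.through {A : Set D} {u v : V} (hr : N.Reaches A u v) :
    N.Reaches {d | d ∈ A ∧ N.Reaches A u (N.tail d)} u v := by
  induction hr with
  | refl => exact Reaches.refl _
  | tail h1 h ih =>
    obtain ⟨d, hd, rfl, rfl⟩ := h
    exact ih.trans (Reaches.dart ⟨hd, h1⟩)

/-- A walk towards `v` uses only darts whose head reaches `v`. -/
theorem Reaches.through' {A : Set D} {u v : V} (hr : N.Reaches A u v) :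
    N.Reaches {d | d ∈ A ∧ N.Reaches A (N.head d) v} u v := by
  induction hr using Relation.ReflTransGen.head_induction_on with
  | refl => exact Reaches.refl _
  | head h hr ih =>
    obtain ⟨d, hd, rfl, rfl⟩ := h
    exact (Reaches.dart (A := {d | d ∈ A ∧ N.Reaches A (N.head d) v}) ⟨hd, hr⟩).trans ih

/-- No positive flow enters `W`, yet its net inflow is non-negative, so every entering dart carries
exactly zero. Applied to sets defined by residual reachability, this shows that a flow does not
cross their boundary in either direction. -/
theorem enter_eq_zero {z : D → ℝ} (hz : N.Anti z) {W : Set V}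
    (hW : ∀ d, 0 < z d → N.head d ∈ W → N.tail d ∈ W)
    (hs : 0 ≤ ∑ v with v ∈ W, N.netIn z v) {d : D} (h1 : N.head d ∈ W) (h2 : N.tail d ∉ W) :
    z d = 0 := by
  rw [N.sum_netIn hz W] at hs
  have hle : ∀ d ∈ Finset.univ.filter (fun d => N.head d ∈ W ∧ N.tail d ∉ W), z d ≤ 0 := by
    intro e he
    simp only [Finset.mem_filter, Finset.mem_univ, true_and] at he
    by_contra hc
    exact he.2 (hW e (not_le.1 hc) he.1)
  have h0 := (Finset.sum_eq_zero_iff_of_nonpos hle).1 (le_antisymm (Finset.sum_nonpos hle) hs)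
  exact h0 d (by simp [h1, h2])

/-- If neither a cycle through `d` nor a deficit vertex fed the tail of `d`, the set of vertices
from which that tail is reached would have non-negative net inflow, so by `enter_eq_zero` nothing
could leave it through `d`. -/
theorem flow_back {z : D → ℝ} (hz : N.Anti z) {d : D} (hd : 0 < z d) :
    N.Reaches (pos z) (N.head d) (N.tail d) ∨
      ∃ w, N.netIn z w < 0 ∧ N.Reaches (pos z) w (N.tail d) := by
  by_contra hc
  push Not at hc
  obtain ⟨h1, h2⟩ := hc
  have := enter_eq_zero hz (W := {w | N.Reaches (pos z) w (N.tail d)}) (d := N.rev d)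
    (fun e he hh => (Reaches.dart (A := pos z) he).trans hh)
    (Finset.sum_nonneg fun w hw => by
      by_contra hc
      exact h2 w (not_le.1 hc) (by simpa using hw))
    (by simpa using Reaches.refl _) (by simpa [tail_rev] using h1)
  rw [hz d] at this
  linarith

theorem flow_forward {z : D → ℝ} (hz : N.Anti z) {d : D} (hd : 0 < z d) :
    N.Reaches (pos z) (N.head d) (N.tail d) ∨
      ∃ w, 0 < N.netIn z w ∧ N.Reaches (pos z) (N.head d) w := by
  have key : ∀ e ∈ pos (-z), N.rev e ∈ pos z := by
    intro e he
    simp only [pos, Set.mem_ofPred_eq, Pi.neg_apply] at he ⊢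
    rwa [hz e]
  rcases flow_back hz.neg (d := N.rev d) (by simpa [hz d] using hd) with h | ⟨w, hw, h⟩
  · left
    have := h.reverse key
    simpa [tail_rev] using this
  · right
    refine ⟨w, ?_, ?_⟩
    · rw [netIn_neg] at hw; linarith
    · have := h.reverse key
      simpa [tail_rev] using this

theorem exists_reaches_of_netIn_neg {z : D → ℝ} (hz : N.Anti z) {u : V}
    (hu : N.netIn z u < 0) : ∃ w, 0 < N.netIn z w ∧ N.Reaches (pos z) u w := by
  by_contra hc
  push Not at hc
  set W : Set V := {w | N.Reaches (pos z) u w}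
  have h1 := N.sum_netIn hz W
  have h2 : ∑ v with v ∈ W, N.netIn z v < 0 := by
    refine Finset.sum_neg' (fun w hw => ?_) ⟨u, by simp [W, Reaches.refl], hu⟩
    by_contra hh
    exact hc w (not_le.1 hh) (by simpa [W] using hw)
  have h3 : 0 ≤ ∑ d with N.head d ∈ W ∧ N.tail d ∉ W, z d := by
    refine Finset.sum_nonneg fun d hd => ?_
    simp only [Finset.mem_filter, Finset.mem_univ, true_and] at hd
    by_contra hh
    refine hd.2 (Reaches.trans (v := N.head d) hd.1 ?_)
    have := Reaches.dart (N := N) (A := pos z) (d := N.rev d)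
      (by simp only [pos, Set.mem_ofPred_eq, hz d]; linarith [not_le.1 hh])
    simpa [tail_rev] using this
  linarith

/-! ### Walks and simple paths -/

theorem IsWalk.append {u v w : V} {p q : List D} (hp : N.IsWalk u p v) (hq : N.IsWalk v q w) :
    N.IsWalk u (p ++ q) w := by
  induction p generalizing u with
  | nil => simp only [IsWalk] at hp; subst hp; simpa using hq
  | cons d p ih => exact ⟨hp.1, ih hp.2⟩

theorem IsWalk.reaches {A : Set D} {u v : V} {p : List D} (hp : N.IsWalk u p v)
    (hA : ∀ d ∈ p, d ∈ A) : N.Reaches A u v := by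
  induction p generalizing u with
  | nil => simp only [IsWalk] at hp; subst hp; exact Reaches.refl _
  | cons d p ih =>
    obtain ⟨rfl, h⟩ := hp
    exact (Reaches.dart (hA d (by simp))).trans (ih h fun e he => hA e (by simp [he]))

theorem IsWalk.tail_mem {u v : V} {p : List D} (hp : N.IsWalk u p v) {d : D} (hd : d ∈ p) :
    N.tail d ∈ u :: p.map N.head := by
  induction p generalizing u with
  | nil => simp at hd
  | cons e p ih =>
    obtain ⟨rfl, h⟩ := hp
    rcases List.mem_cons.1 hd with rfl | hd
    · simp
    · have := ih h hd
      simp only [List.map_cons, List.mem_cons] at this ⊢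
      tauto

theorem IsWalk.end_mem {u v : V} {p : List D} (hp : N.IsWalk u p v) :
    v ∈ u :: p.map N.head := by
  induction p generalizing u with
  | nil => simp only [IsWalk] at hp; simp [hp]
  | cons e p ih =>
    have := ih hp.2
    simp only [List.map_cons, List.mem_cons] at this ⊢
    tauto

/-- Every vertex of a walk is reached from its start and reaches its end. -/
theorem IsWalk.reaches_mem {A : Set D} {u v : V} {p : List D} (hp : N.IsWalk u p v)
    (hA : ∀ d ∈ p, d ∈ A) {x : V} (hx : x ∈ u :: p.map N.head) :
    N.Reaches A u x ∧ N.Reaches A x v := by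
  induction p generalizing u with
  | nil =>
    simp only [IsWalk] at hp; subst hp
    simp at hx; subst hx; exact ⟨Reaches.refl _, Reaches.refl _⟩
  | cons e p ih =>
    have hp' := hp
    obtain ⟨rfl, h⟩ := hp
    rcases List.mem_cons.1 hx with rfl | hx
    · exact ⟨Reaches.refl _, hp'.reaches hA⟩
    · obtain ⟨h1, h2⟩ := ih h (fun e he => hA e (by simp [he])) (by simpa using hx)
      exact ⟨(Reaches.dart (hA e (by simp))).trans h1, h2⟩

/-- A walk that never enters `X` from outside has all its visits to `X` in an initial segment. This
is applied to flow paths, which cross the cut only outwards. -/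
theorem IsWalk.prefix_reaches {X : Set V} {u v : V} {p : List D} (hp : N.IsWalk u p v)
    (hX : ∀ d ∈ p, N.head d ∈ X → N.tail d ∈ X) {x : V} (hx : x ∈ u :: p.map N.head)
    (hxX : x ∈ X) :
    u ∈ X ∧ N.Reaches {d | d ∈ p ∧ N.tail d ∈ X ∧ N.head d ∈ X} u x := by
  induction p generalizing u with
  | nil => simp at hx; subst hx; exact ⟨hxX, Reaches.refl _⟩
  | cons e p ih =>
    obtain ⟨rfl, h⟩ := hp
    rcases List.mem_cons.1 hx with rfl | hx
    · exact ⟨hxX, Reaches.refl _⟩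
    · obtain ⟨h1, h2⟩ := ih h (fun e he => hX e (by simp [he])) (by simpa using hx)
      have h3 := hX e (by simp) h1
      refine ⟨h3, (Reaches.dart (d := e) (A := {d | d ∈ e :: p ∧ N.tail d ∈ X ∧ N.head d ∈ X})
        ⟨by simp, h3, h1⟩).trans (h2.mono ?_)⟩
      exact fun d hd => ⟨by simp [hd.1], hd.2⟩

theorem IsWalk.suffix_reaches {X : Set V} {u v : V} {p : List D} (hp : N.IsWalk u p v)
    (hX : ∀ d ∈ p, N.tail d ∈ X → N.head d ∈ X) {x : V} (hx : x ∈ u :: p.map N.head)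
    (hxX : x ∈ X) : N.Reaches {d | d ∈ p ∧ N.tail d ∈ X ∧ N.head d ∈ X} x v := by
  induction p generalizing u x with
  | nil =>
    simp only [IsWalk] at hp; subst hp
    simp at hx; subst hx; exact Reaches.refl _
  | cons e p ih =>
    obtain ⟨rfl, h⟩ := hp
    have ih' := fun {x : V} => ih (x := x) h (fun e he => hX e (by simp [he]))
    have mono : {d | d ∈ p ∧ N.tail d ∈ X ∧ N.head d ∈ X} ⊆
      {d | d ∈ e :: p ∧ N.tail d ∈ X ∧ N.head d ∈ X} := fun d hd => ⟨by simp [hd.1], hd.2⟩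
    rcases List.mem_cons.1 hx with rfl | hx
    · have h3 := hX e (by simp) hxX
      exact (Reaches.dart (d := e) (A := {d | d ∈ e :: p ∧ N.tail d ∈ X ∧ N.head d ∈ X})
        ⟨by simp, hxX, h3⟩).trans ((ih' (by simp) h3).mono mono)
    · exact (ih' (by simpa using hx) hxX).mono mono

theorem IsSimplePath.suffix {u v x : V} {p : List D} (hp : N.IsSimplePath u p v)
    (hx : x ∈ u :: p.map N.head) : ∃ q, N.IsSimplePath x q v ∧ ∀ d ∈ q, d ∈ p := by
  induction p generalizing u with
  | nil => simp at hx; subst hx; exact ⟨[], hp, by simp⟩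
  | cons e p ih =>
    rcases List.mem_cons.1 hx with rfl | hx
    · exact ⟨_, hp, fun _ h => h⟩
    · have : N.IsSimplePath (N.head e) p v := ⟨hp.1.2, by
        have := hp.2
        simp only [List.map_cons, List.nodup_cons] at this ⊢
        exact this.2⟩
      obtain ⟨q, h1, h2⟩ := ih this (by simpa using hx)
      exact ⟨q, h1, fun d hd => by simp [h2 d hd]⟩

theorem Reaches.exists_simplePath {A : Set D} {u v : V} (hr : N.Reaches A u v) :
    ∃ p, N.IsSimplePath u p v ∧ ∀ d ∈ p, d ∈ A := by
  induction hr using Relation.ReflTransGen.head_induction_on with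
  | refl => exact ⟨[], ⟨rfl, by simp⟩, by simp⟩
  | head h hr ih =>
    obtain ⟨d, hd, rfl, rfl⟩ := h
    obtain ⟨p, hp, hpA⟩ := ih
    by_cases hh : N.tail d ∈ N.head d :: p.map N.head
    · obtain ⟨q, hq, hqp⟩ := hp.suffix hh
      exact ⟨q, hq, fun e he => hpA e (hqp e he)⟩
    · refine ⟨d :: p, ⟨⟨rfl, hp.1⟩, ?_⟩, ?_⟩
      · simpa using ⟨by simpa using hh, by simpa using hp.2⟩
      · intro e he
        rcases List.mem_cons.1 he with rfl | he
        exacts [hd, hpA e he]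

theorem exists_simpleCycle {A : Set D} {d : D} (hd : d ∈ A)
    (hr : N.Reaches A (N.head d) (N.tail d)) :
    ∃ p, N.IsSimplePath (N.head d) p (N.tail d) ∧ N.IsSimpleCycle (d :: p) ∧
      ∀ e ∈ d :: p, e ∈ A := by
  obtain ⟨p, hp, hpA⟩ := hr.exists_simplePath
  refine ⟨p, hp, ⟨by simp, ⟨N.tail d, rfl, hp.1⟩, by simpa using hp.2⟩, ?_⟩
  intro e he
  rcases List.mem_cons.1 he with rfl | he
  exacts [hd, hpA e he]

/-- The darts of a simple path increase a height function. -/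
theorem IsSimplePath.exists_height {u v : V} {p : List D} (hp : N.IsSimplePath u p v) :
    ∃ h : V → ℕ, ∀ d ∈ p, h (N.tail d) < h (N.head d) := by
  induction p generalizing u with
  | nil => exact ⟨fun _ => 0, by simp⟩
  | cons e p ih =>
    have hn := hp.2
    simp only [List.map_cons] at hn
    rw [List.nodup_cons] at hn
    have hp' : N.IsSimplePath (N.head e) p v := ⟨hp.1.2, hn.2⟩
    obtain ⟨h, hh⟩ := ih hp'
    have hu : u ∉ N.head e :: p.map N.head := hn.1
    refine ⟨fun x => if x = u then 0 else h x + 1, ?_⟩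
    intro d hd
    rcases List.mem_cons.1 hd with rfl | hd
    · have h1 : N.tail d = u := hp.1.1
      have h2 : N.head d ≠ u := fun h => hu (by simp [h])
      simp [h1, h2]
    · have h1 : N.tail d ≠ u := fun h => hu (h ▸ hp'.1.tail_mem hd)
      have h2 : N.head d ≠ u := fun h => hu (by
        rw [← h]; exact List.mem_cons_of_mem _ (List.mem_map_of_mem hd))
      simp only [h1, h2, if_false]
      have := hh d hd
      omega

theorem IsSimplePath.not_reaches {u v : V} {p : List D} (hp : N.IsSimplePath u p v) {d : D}
    (hd : d ∈ p) : ¬ N.Reaches {e | e ∈ p} (N.head d) (N.tail d) := by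
  obtain ⟨h, hh⟩ := hp.exists_height
  intro hr
  have := hr.mem_of_closed (W := {x | h (N.head d) ≤ h x}) (by simp)
    (fun e he h1 => by
      have h2 := hh e he
      simp only [Set.mem_ofPred_eq] at h1 ⊢
      omega)
  have h3 := hh d hd
  simp only [Set.mem_ofPred_eq] at this
  omega

theorem IsSimplePath.rev_notMem {u v : V} {p : List D} (hp : N.IsSimplePath u p v) {d : D}
    (hd : d ∈ p) : N.rev d ∉ p := by
  intro hr
  have := Reaches.dart (N := N) (A := {e | e ∈ p}) hr
  rw [head_rev, tail_rev] at this
  exact hp.not_reaches hd this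

theorem IsSimplePath.nodup {u v : V} {p : List D} (hp : N.IsSimplePath u p v) : p.Nodup :=
  ((List.nodup_cons.1 hp.2).2).of_map _

/-- A circulation whose positive part lies on a simple path vanishes. -/
theorem circulation_eq_zero_of_subset_path {z : D → ℝ} (hz : N.Anti z)
    (hc : ∀ v, N.netIn z v = 0) {u v : V} {p : List D} (hp : N.IsSimplePath u p v)
    (hzp : ∀ d, 0 < z d → d ∈ p) : z = 0 := by
  have key : ∀ d, z d ≤ 0 := by
    intro d
    by_contra hd
    rw [not_le] at hd
    rcases flow_back hz hd with h | ⟨w, hw, _⟩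
    · exact hp.not_reaches (hzp d hd) (h.mono fun e he => hzp e he)
    · rw [hc] at hw; exact lt_irrefl _ hw
  funext d
  have h1 := key d
  have h2 := key (N.rev d)
  rw [hz] at h2
  simp only [Pi.zero_apply]
  linarith

/-! ### Chains -/

variable (N) in
/-- The chain of a dart sequence with real values. -/
def rchain (p : List D) (d : D) : ℝ := (N.chain p d : ℝ)

theorem rchain_anti (p : List D) : N.Anti (N.rchain p) := by
  intro d; simp [rchain, chain]

theorem rchain_nil : N.rchain [] = 0 := by
  funext d; simp [rchain, chain]

theorem rchain_cons (e : D) (p : List D) : N.rchain (e :: p) = N.rchain [e] + N.rchain p := by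
  funext d
  simp only [rchain, chain, List.count_cons, Pi.add_apply, List.count_nil]
  push_cast
  ring

theorem netIn_rchain_single (e : D) (x : V) :
    N.netIn (N.rchain [e]) x = (if x = N.head e then 1 else 0) - (if x = N.tail e then 1 else 0) := by
  have h : ∀ d, N.rchain [e] d = (if d = e then 1 else 0) - (if d = N.rev e then 1 else 0) := by
    intro d
    simp only [rchain, chain, List.count_singleton]
    have : (e == N.rev d) = (d == N.rev e) := by
      rw [Bool.eq_iff_iff]
      simp only [beq_iff_eq]
      constructor
      · rintro rfl; simp
      · rintro rfl; simp
    rw [this]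
    simp only [beq_iff_eq, eq_comm (a := e) (b := d)]
    push_cast
    rfl
  simp only [netIn, h, Finset.sum_sub_distrib]
  congr 1
  · rw [Finset.sum_filter, Finset.sum_eq_single e]
    · simp [eq_comm]
    · intro b _ hb; simp [hb]
    · simp
  · rw [Finset.sum_filter, Finset.sum_eq_single (N.rev e)]
    · simp [eq_comm]
    · intro b _ hb; simp [hb]
    · simp

theorem IsWalk.netIn_rchain {u v : V} {p : List D} (hp : N.IsWalk u p v) (x : V) :
    N.netIn (N.rchain p) x = (if x = v then 1 else 0) - (if x = u then 1 else 0) := by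
  induction p generalizing u with
  | nil =>
    simp only [IsWalk] at hp; subst hp
    rw [rchain_nil, netIn_zero]; simp
  | cons e p ih =>
    obtain ⟨rfl, h⟩ := hp
    rw [rchain_cons, netIn_add, ih h, netIn_rchain_single]
    ring

theorem rchain_of_nodup {p : List D} (hn : p.Nodup) (d : D) :
    N.rchain p d = (if d ∈ p then 1 else 0) - (if N.rev d ∈ p then 1 else 0) := by
  simp only [rchain, chain, hn.count]
  push_cast
  rfl

theorem rchain_eq_one {p : List D} (hn : p.Nodup) {d : D} (hd : d ∈ p) (hr : N.rev d ∉ p) :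
    N.rchain p d = 1 := by
  simp [rchain_of_nodup hn, hd, hr]

theorem mem_of_rchain_pos {p : List D} {d : D} (hd : 0 < N.rchain p d) : d ∈ p := by
  have h : 0 < N.chain p d := by simpa [rchain] using hd
  simp only [chain] at h
  rw [← List.count_pos_iff]
  omega

/-- The reverse of a dart sequence. -/
def revPath (N : BoundaryNetwork V D m) (p : List D) : List D := (p.map N.rev).reverse

theorem mem_revPath {p : List D} {d : D} : d ∈ N.revPath p ↔ N.rev d ∈ p := by
  simp only [revPath, List.mem_reverse, List.mem_map]
  constructor
  · rintro ⟨e, he, rfl⟩; simpa using he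
  · intro h; exact ⟨_, h, by simp⟩

theorem IsWalk.revPath {u v : V} {p : List D} (hp : N.IsWalk u p v) :
    N.IsWalk v (N.revPath p) u := by
  induction p generalizing u with
  | nil => simp only [IsWalk] at hp; subst hp; rfl
  | cons e p ih =>
    obtain ⟨rfl, h⟩ := hp
    have := (ih h).append (w := N.tail e) (q := [N.rev e]) ⟨rfl, by simp [IsWalk]⟩
    simpa [BoundaryNetwork.revPath] using this

theorem chain_revPath (p : List D) (d : D) : N.chain (N.revPath p) d = - N.chain p d := by
  have h : ∀ d, (N.revPath p).count d = p.count (N.rev d) := by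
    intro d
    rw [revPath, List.count_reverse]
    conv_lhs => rw [← N.rev_rev d]
    exact List.count_map_of_injective p N.rev N.rev.injective (N.rev d)
  simp only [chain, h, rev_rev']
  ring

theorem IsSimpleCycle.revPath {p : List D} (hp : N.IsSimpleCycle p) :
    N.IsSimpleCycle (N.revPath p) := by
  obtain ⟨h1, ⟨v, hv⟩, h2⟩ := hp
  refine ⟨by simpa [BoundaryNetwork.revPath] using h1, ⟨v, hv.revPath⟩, ?_⟩
  have h3 : (N.revPath p).map N.head = (p.map N.tail).reverse := by
    simp only [BoundaryNetwork.revPath, List.map_reverse, List.map_map]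
    congr 1
    exact List.map_congr_left fun d _ => by simp
  rw [h3, List.nodup_reverse]
  have h4 : ∀ {p : List D} {u v : V}, N.IsWalk u p v →
      p.map N.tail ++ [v] = u :: p.map N.head := by
    intro p
    induction p with
    | nil => intro u v h; simp only [IsWalk] at h; simp [h]
    | cons e p ih =>
      intro u v h
      simp only [List.map_cons, List.cons_append, ih h.2, h.1]
  have h5 := h4 hv
  have h6 : (p.map N.tail).Perm (p.map N.head) := by
    have : ([v] ++ p.map N.tail).Perm ([v] ++ p.map N.head) :=
      (List.perm_append_comm).trans (by rw [h5]; exact List.Perm.refl _)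
    exact (List.perm_append_left_iff _).1 this
  exact h6.nodup_iff.2 h2

/-! ### Faces and potentials -/

variable (N) in
theorem rot_eq (d : D) : N.rot d = N.next (N.rev d) := by simp [PlaneGraph.next]

variable (N) in
theorem tail_next (d : D) : N.tail (N.next d) = N.head d := by
  have : N.tail (N.rot (N.rev d)) = N.tail (N.rev d) :=
    (N.tail_eq_iff _ _).2 ((Equiv.Perm.SameCycle.refl _ _).apply_left)
  simpa [PlaneGraph.next, head] using this

variable (N) in
theorem leftFace_next (d : D) : N.leftFace (N.next d) = N.leftFace d :=
  Quotient.sound ((Equiv.Perm.SameCycle.refl _ _).apply_left)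

variable (N) in
theorem leftFace_eq_iff {d e : D} : N.leftFace d = N.leftFace e ↔ ∃ n : ℕ, (N.next ^ n) d = e := by
  constructor
  · intro h
    obtain ⟨n, -, hn⟩ := Equiv.Perm.SameCycle.exists_pow_eq' (Quotient.exact h)
    exact ⟨n, hn⟩
  · rintro ⟨n, rfl⟩
    induction n with
    | zero => rfl
    | succ n ih => rw [pow_succ', Equiv.Perm.mul_apply, leftFace_next, ← ih]

theorem mem_of_leftFace_eq {J : Set D} (hJ : ∀ d ∈ J, N.next d ∈ J) {d e : D}
    (h : N.leftFace d = N.leftFace e) (hd : d ∈ J) : e ∈ J := by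
  obtain ⟨n, rfl⟩ := N.leftFace_eq_iff.1 h
  induction n with
  | zero => exact hd
  | succ n ih =>
    rw [pow_succ', Equiv.Perm.mul_apply]
    exact hJ _ (ih (N.leftFace_eq_iff.2 ⟨n, rfl⟩))

/-- A function on darts that is invariant around the vertices of `W` and across the darts of `A`
is constant along walks. -/
theorem Reaches.eq_of_invariant {α : Type*} {A : Set D} {W : Set V} {h : D → α}
    (hrot : ∀ d, N.tail d ∈ W → h (N.rot d) = h d) (hA : ∀ d ∈ A, N.tail d ∈ W ∧ N.head d ∈ W ∧
      h (N.rev d) = h d) {u v : V} (hr : N.Reaches A u v) (hu : u ∈ W) {d e : D}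
    (hd : N.tail d = u) (he : N.tail e = v) : h d = h e := by
  have same : ∀ d e, N.tail d ∈ W → N.tail d = N.tail e → h d = h e := by
    intro d e hd hde
    obtain ⟨n, -, rfl⟩ := ((N.tail_eq_iff _ _).1 hde).exists_pow_eq'
    clear hde
    induction n with
    | zero => rfl
    | succ n ih =>
      rw [ih, pow_succ', Equiv.Perm.mul_apply, hrot]
      have : N.tail ((N.rot ^ n) d) = N.tail d :=
        (N.tail_eq_iff _ _).2 ⟨-(n : ℤ), by simp⟩
      rw [this]; exact hd
  induction hr generalizing e with
  | refl => exact same _ _ (hd ▸ hu) (hd.trans he.symm)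
  | tail _ hh ih =>
    obtain ⟨f, hf, rfl, rfl⟩ := hh
    obtain ⟨h1, h2, h3⟩ := hA f hf
    rw [ih rfl, ← h3]
    exact same _ _ (by rw [tail_rev]; exact h2) (by rw [tail_rev, he])

variable (N) in
theorem reaches_univ (u v : V) : N.Reaches Set.univ u v := by
  refine Relation.ReflTransGen.mono ?_ _ _ (N.connected u v)
  rintro x y ⟨d, h1, h2⟩
  exact ⟨d, trivial, h1, h2⟩

/-- Since `rot` is `next` after `rev`, invariance under `next` and `rev` gives invariance around
vertices and across edges. It is the connectedness of the dual graph, deduced from that of the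
graph. -/
theorem eq_of_invariant {α : Type*} {h : D → α} (hnext : ∀ d, h (N.next d) = h d)
    (hrev : ∀ d, h (N.rev d) = h d) (d e : D) : h d = h e :=
  Reaches.eq_of_invariant (N := N) (W := Set.univ) (A := Set.univ) (h := h)
    (fun d _ => by rw [rot_eq, hnext, hrev]) (fun d _ => ⟨trivial, trivial, hrev d⟩)
    (N.reaches_univ (N.tail d) (N.tail e)) trivial rfl rfl

/-- Face-closed sets of darts that are not left through an edge are trivial. -/
theorem eq_empty_of_closed {J : Set D} (hJ : ∀ d ∈ J, N.next d ∈ J) (hb : N.base ∉ J)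
    (hrev : ∀ d ∈ J, N.rev d ∈ J) : J = ∅ := by
  have h1 : ∀ d, N.next d ∈ J ↔ d ∈ J := fun d =>
    ⟨fun h => mem_of_leftFace_eq hJ (N.leftFace_next d) h, hJ d⟩
  have h2 : ∀ d, N.rev d ∈ J ↔ d ∈ J := fun d =>
    ⟨fun h => by simpa using hrev _ h, hrev d⟩
  by_contra hne
  obtain ⟨d, hd⟩ := Set.nonempty_iff_ne_empty.2 hne
  have := eq_of_invariant (N := N) (h := fun d => d ∈ J) (fun d => propext (h1 d))
    (fun d => propext (h2 d)) d N.base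
  exact hb (this ▸ hd)

variable (N) in
-- The darts out of `v` are both the reverses and the `next` images of the darts into `v`. After
-- reindexing, only the changes of `Ψ` along face boundaries at `v` contribute.
theorem netIn_potential (Ψ : D → ℝ) (v : V) :
    N.netIn (fun d => Ψ d - Ψ (N.rev d)) v = ∑ d with N.head d = v, (Ψ d - Ψ (N.next d)) := by
  simp only [netIn, Finset.sum_sub_distrib]
  congr 1
  trans ∑ e with N.tail e = v, Ψ e
  · refine Finset.sum_bij (fun d _ => N.rev d) ?_ ?_ ?_ ?_
    · intro d hd; simpa [tail_rev] using hd
    · intro a _ b _ h; exact N.rev.injective h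
    · intro d hd; exact ⟨N.rev d, by simpa using hd, by simp⟩
    · intro d _; rfl
  · symm
    refine Finset.sum_bij (fun d _ => N.next d) ?_ ?_ ?_ ?_
    · intro d hd; simpa [tail_next] using hd
    · intro a _ b _ h; exact N.next.injective h
    · intro d hd
      refine ⟨N.next.symm d, ?_, by simp⟩
      have := N.tail_next (N.next.symm d)
      simp only [Equiv.apply_symm_apply] at this
      simpa [← this] using hd
    · intro d _; rfl

variable (N) in
/-- The boundary chain of a face function: the faces are to the right of its darts. -/
def bdry : (N.Face → ℝ) →ₗ[ℝ] (D → ℝ) where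
  toFun Φ d := Φ (N.rightFace d) - Φ (N.leftFace d)
  map_add' _ _ := by funext d; simp; ring
  map_smul' _ _ := by funext d; simp; ring

variable (N) in
theorem bdry_apply (Φ : N.Face → ℝ) (d : D) :
    N.bdry Φ d = Φ (N.rightFace d) - Φ (N.leftFace d) := rfl

variable (N) in
theorem bdry_anti (Φ : N.Face → ℝ) : N.Anti (N.bdry Φ) := by
  intro d; simp [bdry_apply, rightFace]

variable (N) in
theorem netIn_bdry (Φ : N.Face → ℝ) (v : V) : N.netIn (N.bdry Φ) v = 0 := by
  have h : N.bdry Φ = -(fun d => (fun e => Φ (N.leftFace e)) d -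
      (fun e => Φ (N.leftFace e)) (N.rev d)) := by
    funext d; simp [bdry_apply, rightFace]
  rw [h, netIn_neg, netIn_potential]
  simp [leftFace_next]

variable (N) in
def grad : (V → ℝ) →ₗ[ℝ] (D → ℝ) where
  toFun φ d := φ (N.head d) - φ (N.tail d)
  map_add' _ _ := by funext d; simp; ring
  map_smul' _ _ := by funext d; simp; ring

variable (N) in
theorem grad_apply (φ : V → ℝ) (d : D) : N.grad φ d = φ (N.head d) - φ (N.tail d) := rfl

variable (N) in
def antiSubmodule : Submodule ℝ (D → ℝ) where
  carrier := {z | N.Anti z}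
  add_mem' h h' := h.add h'
  zero_mem' := Anti.zero
  smul_mem' r _ h := h.smul r

theorem sum_head_mul (φ : V → ℝ) (z : D → ℝ) :
    ∑ d, φ (N.head d) * z d = ∑ v, φ v * N.netIn z v := by
  simp only [netIn, Finset.mul_sum, Finset.sum_filter]
  simp only [mul_ite, mul_zero]
  rw [Finset.sum_comm]
  refine Finset.sum_congr rfl fun d _ => ?_
  simp

theorem grad_orthogonal {z : D → ℝ} (hz : N.Anti z) (hc : ∀ v, N.netIn z v = 0) (φ : V → ℝ) :
    ∑ d, N.grad φ d * z d = 0 := by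
  have h1 : ∑ d, φ (N.head d) * z d = 0 := by
    rw [sum_head_mul]; simp [hc]
  have h2 : ∑ d, φ (N.tail d) * z d = - ∑ d, φ (N.head d) * z d := by
    rw [← Finset.sum_neg_distrib, ← Equiv.sum_comp N.rev]
    refine Finset.sum_congr rfl fun d _ => ?_
    rw [hz d, tail_rev]; ring
  simp only [grad_apply, sub_mul, Finset.sum_sub_distrib, h1, h2]
  simp

variable (N) in
-- Numbering the darts picks one from each edge, and an antisymmetric function is determined by its
-- values on these.
theorem finrank_antiSubmodule_le : 2 * Module.finrank ℝ N.antiSubmodule ≤ Fintype.card D := by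
  let o : D → ℕ := fun d => (Fintype.equivFin D d : ℕ)
  have ho : Function.Injective o := fun a b h =>
    (Fintype.equivFin D).injective (Fin.ext h)
  let O : Finset D := Finset.univ.filter fun d => o d < o (N.rev d)
  have h1 : O.card + O.card = Fintype.card D := by
    have h2 : (Finset.univ.filter fun d => ¬ o d < o (N.rev d)).card = O.card := by
      refine Finset.card_bij (fun d _ => N.rev d) ?_ ?_ ?_
      · intro d hd
        simp only [Finset.mem_filter, Finset.mem_univ, true_and, not_lt, O, rev_rev'] at hd ⊢
        exact lt_of_le_of_ne hd fun h => N.rev_ne d (ho h)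
      · intro a _ b _ h; exact N.rev.injective h
      · intro d hd
        refine ⟨N.rev d, ?_, by simp⟩
        simp only [Finset.mem_filter, Finset.mem_univ, true_and, not_lt, O, rev_rev'] at hd ⊢
        exact le_of_lt hd
    rw [← Finset.card_univ, ← Finset.card_filter_add_card_filter_not (s := (Finset.univ : Finset D))
      (fun d => o d < o (N.rev d)), h2]
  let f : N.antiSubmodule →ₗ[ℝ] (O → ℝ) :=
    { toFun := fun z e => z.1 e.1
      map_add' := fun _ _ => rfl
      map_smul' := fun _ _ => rfl }
  have hf : Function.Injective f := by
    refine (injective_iff_map_eq_zero f).2 ?_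
    intro z hz
    have hz' : ∀ d, o d < o (N.rev d) → z.1 d = 0 := fun d hd =>
      congrFun hz ⟨d, by simp [O, hd]⟩
    ext d
    rcases lt_trichotomy (o d) (o (N.rev d)) with h | h | h
    · exact hz' d h
    · exact absurd (ho h).symm (N.rev_ne d)
    · have h3 := hz' (N.rev d) (by simpa using h)
      have h4 : z.1 (N.rev d) = - z.1 d := z.2 d
      simp only [ZeroMemClass.coe_zero, Pi.zero_apply]
      linarith
  have := LinearMap.finrank_le_finrank_of_injective hf
  simp only [Module.finrank_fintype_fun_eq_card, Fintype.card_coe] at this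
  omega

theorem finrank_range_ge {ι E : Type*} [Fintype ι] (f : (ι → ℝ) →ₗ[ℝ] (E → ℝ))
    (h : ∀ φ, f φ = 0 → ∃ r, φ = fun _ => r) :
    Fintype.card ι ≤ Module.finrank ℝ (LinearMap.range f) + 1 := by
  have h1 := LinearMap.finrank_range_add_finrank_ker f
  rw [Module.finrank_fintype_fun_eq_card] at h1
  have h2 : Module.finrank ℝ (LinearMap.ker f) ≤ 1 := by
    have : LinearMap.ker f ≤ Submodule.span ℝ {(fun _ => 1 : ι → ℝ)} := by
      intro φ hφ
      obtain ⟨r, rfl⟩ := h φ hφ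
      rw [Submodule.mem_span_singleton]
      exact ⟨r, by funext; simp⟩
    refine (Submodule.finrank_mono this).trans ?_
    exact (finrank_span_le_card _).trans (by simp)
  omega

theorem eq_const_of_bdry_eq_zero {Φ : N.Face → ℝ} (h : N.bdry Φ = 0) (x y : N.Face) :
    Φ x = Φ y := by
  induction x using Quotient.inductionOn with | _ d
  induction y using Quotient.inductionOn with | _ e
  refine eq_of_invariant (N := N) (h := fun d => Φ (N.leftFace d)) ?_ ?_ d e
  · intro d; simp only [leftFace_next]
  · intro d
    have := congrFun h d
    simp only [bdry_apply, rightFace, Pi.zero_apply] at this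
    linarith

/-- Circulations of a plane graph are boundaries of face functions. -/
theorem exists_face_potential {z : D → ℝ} (hz : N.Anti z) (hc : ∀ v, N.netIn z v = 0) :
    ∃ Φ : N.Face → ℝ, Φ N.outer = 0 ∧ N.bdry Φ = z := by
  have hG : LinearMap.range N.grad ≤ N.antiSubmodule := by
    rintro _ ⟨φ, rfl⟩ d
    simp [grad_apply, tail_rev]
  have hB : LinearMap.range N.bdry ≤ N.antiSubmodule := by
    rintro _ ⟨φ, rfl⟩
    exact N.bdry_anti φ
  have self_orth : ∀ g : D → ℝ, ∑ d, g d * g d = 0 → g = 0 := by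
    intro g hg
    funext d
    have := (Finset.sum_eq_zero_iff_of_nonneg fun d _ => mul_self_nonneg (g d)).1 hg d
      (Finset.mem_univ d)
    simpa using this
  have hinf : LinearMap.range N.grad ⊓ LinearMap.range N.bdry = ⊥ := by
    rw [eq_bot_iff]
    rintro g ⟨⟨φ, rfl⟩, ⟨Φ, hΦ⟩⟩
    have := grad_orthogonal (N.bdry_anti Φ) (N.netIn_bdry Φ) φ
    rw [hΦ] at this
    exact self_orth _ this
  have hV := finrank_range_ge N.grad (by
    intro φ hφ
    refine ⟨φ (N.tail N.base), funext fun v => ?_⟩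
    have := (N.reaches_univ (N.tail N.base) v).mem_of_closed
      (W := {x | φ x = φ (N.tail N.base)}) (by simp) (by
        intro d _ hd
        have := congrFun hφ d
        simp only [grad_apply, Pi.zero_apply] at this
        simp only [Set.mem_ofPred_eq] at hd ⊢
        linarith)
    exact this)
  have hF := finrank_range_ge N.bdry (by
    intro Φ hΦ
    exact ⟨Φ N.outer, funext fun x => eq_const_of_bdry_eq_zero hΦ x _⟩)
  have he := N.euler
  rw [← Nat.card_eq_fintype_card] at hV hF
  rw [show Nat.card D = Fintype.card D from Nat.card_eq_fintype_card] at he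
  have hF' : Nat.card (Quotient (Equiv.Perm.SameCycle.setoid (N.rot * N.rev))) ≤
    Module.finrank ℝ (LinearMap.range N.bdry) + 1 := hF
  have hA := N.finrank_antiSubmodule_le
  have hsum := Submodule.finrank_sup_add_finrank_inf_eq (LinearMap.range N.grad)
    (LinearMap.range N.bdry)
  rw [hinf, finrank_bot] at hsum
  -- Gradients and boundaries are orthogonal, with ranks at least |V| - 1 and |F| - 1. By Euler's
  -- formula these add up to |E|, so together they fill the antisymmetric functions. A circulation
  -- is orthogonal to gradients, hence its gradient part vanishes.
  have htop : LinearMap.range N.grad ⊔ LinearMap.range N.bdry = N.antiSubmodule := by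
    refine Submodule.eq_of_le_of_finrank_le (sup_le hG hB) ?_
    omega
  have hz' : z ∈ LinearMap.range N.grad ⊔ LinearMap.range N.bdry := htop ▸ hz
  obtain ⟨_, ⟨φ, rfl⟩, _, ⟨Φ, rfl⟩, rfl⟩ := Submodule.mem_sup.1 hz'
  have h1 := grad_orthogonal hz hc φ
  have h2 := grad_orthogonal (N.bdry_anti Φ) (N.netIn_bdry Φ) φ
  have h3 : N.grad φ = 0 := by
    refine self_orth _ ?_
    simp only [Pi.add_apply, mul_add, Finset.sum_add_distrib] at h1
    linarith
  refine ⟨fun x => Φ x - Φ N.outer, by simp, ?_⟩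
  rw [h3, zero_add]
  funext d
  simp [bdry_apply]

/-! ### Clockwise cycles -/

variable (N) in
/-- The boundary of a set of faces. -/
def setBdry (I : Set N.Face) : D → ℝ := N.bdry (fun x => if x ∈ I then 1 else 0)

variable (N) in
theorem setBdry_apply (I : Set N.Face) (d : D) :
    N.setBdry I d = (if N.rightFace d ∈ I then 1 else 0) - (if N.leftFace d ∈ I then 1 else 0) :=
  rfl

variable (N) in
theorem setBdry_pos {I : Set N.Face} {d : D} :
    0 < N.setBdry I d ↔ N.rightFace d ∈ I ∧ N.leftFace d ∉ I := by
  rw [setBdry_apply]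
  split_ifs <;> simp_all

variable (N) in
theorem setBdry_eq_one {I : Set N.Face} {d : D} (h : 0 < N.setBdry I d) : N.setBdry I d = 1 := by
  obtain ⟨h1, h2⟩ := N.setBdry_pos.1 h
  simp [setBdry_apply, h1, h2]

theorem exists_setBdry_pos {I : Set N.Face} (hI : I.Nonempty) (ho : N.outer ∉ I) :
    ∃ d, 0 < N.setBdry I d := by
  by_contra hc
  push Not at hc
  have h0 : N.bdry (fun x => if x ∈ I then (1 : ℝ) else 0) = 0 := by
    funext d
    have h1 := hc d
    have h2 := hc (N.rev d)
    have h3 : N.setBdry I (N.rev d) = - N.setBdry I d := N.bdry_anti _ d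
    have h4 : N.setBdry I d = 0 := by linarith
    exact h4
  obtain ⟨x, hx⟩ := hI
  have := eq_const_of_bdry_eq_zero h0 x N.outer
  simp [hx, ho] at this

theorem encloses_iff {p : List D} {I : Set N.Face} :
    N.Encloses (N.chain p) I ↔ N.outer ∉ I ∧ N.rchain p = N.setBdry I := by
  unfold Encloses
  refine and_congr_right fun _ => ?_
  rw [funext_iff]
  refine forall_congr' fun d => ?_
  rw [setBdry_apply, rchain, ← @Int.cast_inj ℝ]
  push_cast
  rfl

/-- A circulation with values at most one and its positive part on a simple cycle is zero or runs
once around the cycle. -/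
theorem IsSimpleCycle.tight {q : List D} (hq : N.IsSimpleCycle q)
    (hrev : ∀ e ∈ q, N.rev e ∉ q) {I : Set N.Face} (hI : ∀ d, 0 < N.setBdry I d → d ∈ q)
    (hne : I.Nonempty) (ho : N.outer ∉ I) : N.rchain q = N.setBdry I := by
  obtain ⟨h1, ⟨v, hv⟩, h2⟩ := hq
  cases q with
  | nil => exact absurd rfl h1
  | cons d p =>
    obtain ⟨rfl, hw⟩ := hv
    have hp : N.IsSimplePath (N.head d) p (N.tail d) := ⟨hw, by simpa using h2⟩
    have hnd : (d :: p).Nodup := h2.of_map _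
    have hchain : ∀ e, N.rchain (d :: p) e = 1 ∨ e ∉ d :: p ∧
        (N.rchain (d :: p) e = -1 ∨ N.rchain (d :: p) e = 0 ∧ N.rev e ∉ d :: p) := by
      intro e
      rw [rchain_of_nodup hnd]
      by_cases he : e ∈ d :: p
      · simp [he, hrev e he]
      · by_cases he' : N.rev e ∈ d :: p
        · simp [he, he']
        · simp [he, he']
    have hya : N.Anti (N.setBdry I) := N.bdry_anti _
    have hy : ∀ v, N.netIn (N.setBdry I) v = 0 := N.netIn_bdry _
    set r := N.rchain (d :: p) - N.setBdry I
    have hra : N.Anti r := (rchain_anti _).sub hya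
    have hr : ∀ v, N.netIn r v = 0 := by
      intro v
      rw [netIn_sub, hy, IsWalk.netIn_rchain (show N.IsWalk (N.tail d) (d :: p) (N.tail d) from ⟨rfl, hw⟩)]
      simp
    have hrp : ∀ e, 0 < r e → e ∈ d :: p ∧ ¬ 0 < N.setBdry I e := by
      intro e he
      simp only [r, Pi.sub_apply] at he
      rcases hchain e with h | ⟨h3, h | ⟨h, h4⟩⟩
      · refine ⟨mem_of_rchain_pos (N := N) (by rw [h]; norm_num), fun hp => ?_⟩
        rw [N.setBdry_eq_one hp, h] at he
        norm_num at he
      · exfalso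
        have : N.setBdry I (N.rev e) = - N.setBdry I e := hya e
        have h5 : 0 < N.setBdry I (N.rev e) := by linarith
        have := N.setBdry_eq_one h5
        linarith
      · exfalso
        have : N.setBdry I (N.rev e) = - N.setBdry I e := hya e
        exact h4 (hI _ (by linarith))
    have hy0 : N.setBdry I ≠ 0 := by
      obtain ⟨e, he⟩ := exists_setBdry_pos hne ho
      intro h
      rw [h] at he
      exact lt_irrefl _ he
    -- If the boundary of `I` uses `d`, then `r` has its positive part on the simple path `p` and
    -- vanishes. Otherwise the boundary of `I` itself would have its positive part on `p` and
    -- vanish, which it does not.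
    have hr0 : r = 0 := by
      by_cases hd : 0 < N.setBdry I d
      · refine circulation_eq_zero_of_subset_path hra hr hp fun e he => ?_
        obtain ⟨h3, h4⟩ := hrp e he
        rcases List.mem_cons.1 h3 with rfl | h3
        · exact absurd hd h4
        · exact h3
      · refine absurd (circulation_eq_zero_of_subset_path hya hy hp fun e he => ?_) hy0
        rcases List.mem_cons.1 (hI e he) with rfl | h3
        · exact absurd he hd
        · exact h3
    exact sub_eq_zero.1 hr0

/-- The faces of maximal potential are finite, and the potential drops across their whole boundary,
so this boundary lies on `q`; by `tight` it is all of `q`. -/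
theorem clockwise_of_potential_pos {q : List D} (hq : N.IsSimpleCycle q)
    (hrev : ∀ e ∈ q, N.rev e ∉ q) {Φ : N.Face → ℝ} (h0 : Φ N.outer = 0)
    (hΦ : N.bdry Φ = N.rchain q) {x : N.Face} (hx : 0 < Φ x) : N.Clockwise (N.chain q) := by
  obtain ⟨y, -, hy⟩ := Finset.exists_max_image (Finset.univ : Finset N.Face) Φ ⟨x, by simp⟩
  have hI : ({z | Φ z = Φ y} : Set N.Face).Nonempty := ⟨y, rfl⟩
  have ho : N.outer ∉ ({z | Φ z = Φ y} : Set N.Face) := by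
    simp only [Set.mem_ofPred_eq, h0]
    exact (hx.trans_le (hy x (by simp))).ne
  refine ⟨_, hI, encloses_iff.2 ⟨ho, hq.tight hrev ?_ hI ho⟩⟩
  intro d hd
  obtain ⟨h1, h2⟩ := N.setBdry_pos.1 hd
  refine mem_of_rchain_pos (N := N) ?_
  rw [← hΦ, bdry_apply]
  simp only [Set.mem_ofPred_eq] at h1 h2
  have := lt_of_le_of_ne (hy (N.leftFace d) (by simp)) h2
  linarith

/-- A combinatorial Jordan curve theorem: the potential of the cycle has a non-zero value, and its
sign decides the orientation. -/
theorem IsSimpleCycle.clockwise_or {q : List D} (hq : N.IsSimpleCycle q)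
    (hrev : ∀ e ∈ q, N.rev e ∉ q) :
    N.Clockwise (N.chain q) ∨ N.Clockwise (N.chain (N.revPath q)) := by
  have hc : ∀ v, N.netIn (N.rchain q) v = 0 := by
    obtain ⟨v, hv⟩ := hq.2.1
    intro x
    rw [hv.netIn_rchain]; simp
  obtain ⟨Φ, h0, hΦ⟩ := exists_face_potential (rchain_anti q) hc
  have hr : N.rchain (N.revPath q) = - N.rchain q := by
    funext d; simp [rchain, chain_revPath]
  by_cases hx : ∃ x, 0 < Φ x
  · obtain ⟨x, hx⟩ := hx
    exact Or.inl (clockwise_of_potential_pos hq hrev h0 hΦ hx)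
  by_cases hx' : ∃ x, Φ x < 0
  · obtain ⟨x, hx⟩ := hx'
    right
    refine clockwise_of_potential_pos hq.revPath (Φ := -Φ) ?_ (by simp [h0]) ?_ (x := x)
      (by simpa using hx)
    · intro e he he'
      rw [mem_revPath] at he he'
      exact hrev _ he he'
    · rw [map_neg, hΦ, hr]
  · exfalso
    push Not at hx hx'
    have : Φ = 0 := funext fun x => le_antisymm (hx x) (hx' x)
    rw [this, map_zero] at hΦ
    obtain ⟨d, hd⟩ := List.exists_mem_of_ne_nil q hq.1
    have := congrFun hΦ d
    rw [rchain_eq_one (hq.2.2.of_map _) hd (hrev d hd)] at this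
    simp at this

/-- If no clockwise cycle is residual, then every set of finite faces can be entered across a
dart that is not residual. -/
theorem NoResidualClockwise.exists_boundary {A : Set D} {c : D → ℝ}
    (h : N.NoResidualClockwise A c) {J : Set D} (hJ : ∀ d ∈ J, N.next d ∈ J) (hb : N.base ∉ J)
    (hne : J.Nonempty) : ∃ d, N.rev d ∈ J ∧ d ∉ J ∧ ¬ (d ∈ A ∧ 0 < c d) := by
  by_contra hc
  push Not at hc
  set I : Set N.Face := {x | ∃ d ∈ J, N.leftFace d = x}
  have hmem : ∀ d, N.leftFace d ∈ I ↔ d ∈ J := fun d =>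
    ⟨fun ⟨e, he, h⟩ => mem_of_leftFace_eq hJ h he, fun h => ⟨d, h, rfl⟩⟩
  -- The faces that are reached from the infinite face without entering `I`. Passing to the
  -- complement fills the holes of the region, and every dart on the clockwise boundary of `Oᶜ`
  -- still has a face of `I` on its right.
  set O : Set N.Face := {x | Relation.ReflTransGen
    (fun x y => ∃ d, N.leftFace d = x ∧ N.rightFace d = y ∧ y ∉ I) N.outer x}
  have hOI : ∀ x ∈ O, x ∉ I := by
    intro x hx
    rcases Relation.ReflTransGen.cases_tail hx with h | ⟨_, _, _, _, _, h⟩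
    · rw [h]; exact fun h => hb ((hmem _).1 h)
    · exact h
  have hcross : ∀ d, 0 < N.setBdry Oᶜ d → N.leftFace d ∈ O ∧ N.rightFace d ∉ O ∧ d ∈ A ∧ 0 < c d := by
    intro d hd
    obtain ⟨h1, h2⟩ := N.setBdry_pos.1 hd
    have h2' : N.leftFace d ∈ O := by simpa using h2
    have h3 : N.rightFace d ∈ I := by
      by_contra h3
      exact h1 (Relation.ReflTransGen.tail h2' ⟨d, rfl, rfl, h3⟩)
    exact ⟨h2', h1, hc d ((hmem _).1 h3) fun h4 => hOI _ h2' ((hmem _).2 h4)⟩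
  obtain ⟨d0, hd0⟩ := hne
  obtain ⟨d, hd⟩ := exists_setBdry_pos (I := Oᶜ)
    ⟨N.leftFace d0, fun h => hOI _ h ((hmem _).2 hd0)⟩
    (fun h => h Relation.ReflTransGen.refl)
  have hr := (flow_back (N.bdry_anti _) hd).resolve_right (by
    rintro ⟨w, hw, _⟩
    exact hw.ne (N.netIn_bdry _ w))
  obtain ⟨p, -, hp, hpA⟩ := exists_simpleCycle (A := pos (N.setBdry Oᶜ)) hd hr
  have hrev : ∀ e ∈ d :: p, N.rev e ∉ d :: p := by
    intro e he he'
    have h1 := hcross e (hpA e he)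
    have h2 := hcross _ (hpA _ he')
    exact h1.2.1 h2.1
  rcases hp.clockwise_or hrev with hcw | ⟨K, -, hK⟩
  · obtain ⟨e, he, he'⟩ := h _ hp (fun e he => (hcross e (hpA e he)).2.2.1) hcw
    exact he' (hcross e (hpA e he)).2.2.2
  · obtain ⟨hK0, hK1⟩ := encloses_iff.1 hK
    have hr : N.setBdry K = - N.rchain (d :: p) := by
      rw [← hK1]; funext d; simp [rchain, chain_revPath]
    -- The cycle cannot run counterclockwise around `K`: no step between faces of `O` crosses it, so
    -- `K` misses `O`, whereas the left face of each of its darts is in `O` and would have to be in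
    -- `K`.
    have hKO : ∀ x ∈ O, x ∉ K := by
      intro x hx
      have hx' : Relation.ReflTransGen
        (fun x y => ∃ d, N.leftFace d = x ∧ N.rightFace d = y ∧ y ∉ I) N.outer x := hx
      induction hx' with
      | refl => exact hK0
      | tail hxy hstep ih =>
        obtain ⟨e, rfl, rfl, hI⟩ := hstep
        have hx'' : N.leftFace e ∈ O := hxy
        intro hin
        have h1 : 0 < N.setBdry K e := N.setBdry_pos.2 ⟨hin, ih hx''⟩
        rw [hr, Pi.neg_apply, ← rchain_anti (N := N)] at h1
        have h2 := hcross _ (hpA _ (mem_of_rchain_pos (N := N) h1))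
        exact h2.2.1 (by simpa only [rightFace, rev_rev'] using hx'')
    have h1 : N.setBdry K d = -1 := by
      rw [hr, Pi.neg_apply, rchain_eq_one (hp.2.2.of_map _) (by simp) (hrev d (by simp))]
    have h2 : N.leftFace d ∈ K := by
      by_contra h3
      rw [setBdry_apply, if_neg h3] at h1
      split_ifs at h1 <;> norm_num at h1
    exact hKO _ (hcross d hd).1 h2

/-! ### The boundary of the infinite face -/

variable (N) in
/-- The `k`-th dart of the clockwise boundary. -/
def outerDart (k : ℕ) : D := (N.next ^ k) N.base

variable (N) in
/-- The length of the clockwise boundary. -/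
def period : ℕ := Function.minimalPeriod N.next N.base

theorem outerDart_eq_iterate (k : ℕ) : N.outerDart k = N.next^[k] N.base := by
  rw [outerDart, Equiv.Perm.iterate_eq_pow]

theorem next_outerDart (k : ℕ) : N.next (N.outerDart k) = N.outerDart (k + 1) := by
  simp [outerDart, pow_succ']

theorem outerDart_period : N.outerDart N.period = N.outerDart 0 := by
  rw [outerDart_eq_iterate, period, Function.iterate_minimalPeriod]; rfl

theorem outerDart_inj {k l : ℕ} (hk : k < N.period) (hl : l < N.period)
    (h : N.outerDart k = N.outerDart l) : k = l := by
  rw [outerDart_eq_iterate, outerDart_eq_iterate] at h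
  exact Function.iterate_injOn_Iio_minimalPeriod hk hl h

theorem period_pos : 0 < N.period := by
  rw [period, Function.minimalPeriod_pos_iff_mem_periodicPts]
  exact Function.Injective.mem_periodicPts N.next.injective _

theorem leftFace_outerDart (k : ℕ) : N.leftFace (N.outerDart k) = N.outer :=
  (N.leftFace_eq_iff.2 ⟨k, rfl⟩).symm

theorem exists_outerDart {d : D} (h : N.leftFace d = N.outer) :
    ∃ k < N.period, N.outerDart k = d := by
  obtain ⟨n, hn⟩ := N.leftFace_eq_iff.1 h.symm
  refine ⟨n % N.period, Nat.mod_lt _ period_pos, ?_⟩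
  rw [outerDart_eq_iterate, period, Function.iterate_mod_minimalPeriod_eq, ← outerDart_eq_iterate]
  exact hn

variable (N) in
/-- The clockwise boundary walk from position `p` to position `q`. -/
def arcList (p q : ℕ) : List D := (List.Ico p q).map N.outerDart

theorem mem_arcList {p q k : ℕ} (hq : q ≤ N.period) (hk : k < N.period) :
    N.outerDart k ∈ N.arcList p q ↔ p ≤ k ∧ k < q := by
  simp only [arcList, List.mem_map, List.Ico.mem]
  constructor
  · rintro ⟨l, ⟨h1, h2⟩, h⟩
    have := outerDart_inj (h2.trans_le hq) hk h
    omega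
  · intro h; exact ⟨k, h, rfl⟩

theorem leftFace_of_mem_arcList {p q : ℕ} {d : D} (h : d ∈ N.arcList p q) :
    N.leftFace d = N.outer := by
  simp only [arcList, List.mem_map] at h
  obtain ⟨k, -, rfl⟩ := h
  exact leftFace_outerDart k

theorem nodup_arcList {p q : ℕ} (hq : q ≤ N.period) : (N.arcList p q).Nodup := by
  refine List.Nodup.map_on ?_ (List.Ico.nodup p q)
  intro k hk l hl h
  rw [List.Ico.mem] at hk hl
  exact outerDart_inj (hk.2.trans_le hq) (hl.2.trans_le hq) h

theorem isWalk_arcList {p q : ℕ} (h : p ≤ q) :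
    N.IsWalk (N.tail (N.outerDart p)) (N.arcList p q) (N.tail (N.outerDart q)) := by
  induction q, h using Nat.le_induction with
  | base => simp [arcList, IsWalk]
  | succ q h ih =>
    rw [arcList, List.Ico.succ_top h, List.map_append]
    refine IsWalk.append ih ⟨rfl, ?_⟩
    rw [← next_outerDart, tail_next]
    rfl

/-- `Ψ` is a potential of `g`, a flow of value `r` from the vertex at position `p` to that at
position `q` of the boundary: it is constant on the faces, but on the infinite face it is `r`
between the two positions and zero elsewhere. -/
structure IsPotential (N : BoundaryNetwork V D m) (g : D → ℝ) (p q : ℕ) (r : ℝ) (Ψ : D → ℝ) :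
    Prop where
  eq : ∀ d, g d = Ψ d - Ψ (N.rev d)
  outer : ∀ k < N.period, Ψ (N.outerDart k) = if p ≤ k ∧ k < q then r else 0
  inner : ∀ d, N.leftFace d ≠ N.outer → Ψ (N.next d) = Ψ d

/-- Subtracting `r` times the boundary walk from `p` to `q` leaves a circulation, which has a face
potential. The walk itself accounts for the value `r` on one part of the infinite face; this is why
the potential must be a function of darts and not of faces. -/
theorem exists_potential {g : D → ℝ} (hg : N.Anti g) {p q : ℕ} (hpq : p ≤ q) (hq : q < N.period)
    {r : ℝ} (hr : ∀ x, N.netIn g x = r * ((if x = N.tail (N.outerDart q) then 1 else 0) -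
      (if x = N.tail (N.outerDart p) then 1 else 0))) : ∃ Ψ, N.IsPotential g p q r Ψ := by
  obtain ⟨Φ, h0, hΦ⟩ := exists_face_potential (z := g - r • N.rchain (N.arcList p q))
    (hg.sub ((rchain_anti _).smul r)) (by
      intro v
      rw [netIn_sub, netIn_smul, (isWalk_arcList hpq).netIn_rchain, hr, sub_self])
  refine ⟨fun d => r * (if d ∈ N.arcList p q then 1 else 0) - Φ (N.leftFace d), ?_, ?_, ?_⟩
  · intro d
    have := congrFun hΦ d
    simp only [bdry_apply, Pi.sub_apply, Pi.smul_apply, smul_eq_mul,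
      rchain_of_nodup (nodup_arcList hq.le), rightFace] at this
    linarith
  · intro k hk
    simp only [leftFace_outerDart, h0, mem_arcList hq.le hk]
    split_ifs <;> simp
  · intro d hd
    have h1 : d ∉ N.arcList p q := fun h => hd (leftFace_of_mem_arcList h)
    have h2 : N.next d ∉ N.arcList p q := fun h =>
      hd ((N.leftFace_next d).symm.trans (leftFace_of_mem_arcList h))
    simp [h1, h2, leftFace_next]

/-- Only along the infinite face can the potential change: up on arriving at position `p`, down on
arriving at `q`. The case `k + 1 = period` is the wrap to position zero. -/
theorem IsPotential.jump {g : D → ℝ} {p q : ℕ} {r : ℝ} {Ψ : D → ℝ}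
    (h : N.IsPotential g p q r Ψ) (hq : q < N.period) (hr : 0 ≤ r) (d : D) :
    (Ψ d < Ψ (N.next d) → N.next d = N.outerDart p) ∧
      (Ψ (N.next d) < Ψ d → N.next d = N.outerDart q) := by
  by_cases hd : N.leftFace d = N.outer
  · obtain ⟨k, hk, rfl⟩ := exists_outerDart hd
    rw [next_outerDart, h.outer k hk]
    by_cases hk' : k + 1 < N.period
    · rw [h.outer (k + 1) hk']
      constructor
      · intro hlt
        rw [show k + 1 = p from ?_]
        split_ifs at hlt <;> first | omega | linarith
      · intro hlt
        rw [show k + 1 = q from ?_]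
        split_ifs at hlt <;> first | omega | linarith
    · rw [show k + 1 = N.period by omega, outerDart_period, h.outer 0 period_pos]
      constructor
      · intro hlt
        rw [show 0 = p from ?_]
        split_ifs at hlt <;> first | omega | linarith
      · intro hlt
        rw [show 0 = q from ?_]
        split_ifs at hlt <;> first | omega | linarith
  · rw [h.inner d hd]
    simp

theorem IsPotential.next_eq {g : D → ℝ} {p q : ℕ} {r : ℝ} {Ψ : D → ℝ}
    (h : N.IsPotential g p q r Ψ) (hq : q < N.period) (hr : 0 ≤ r) {d : D}
    (h1 : N.head d ≠ N.tail (N.outerDart p)) (h2 : N.head d ≠ N.tail (N.outerDart q)) :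
    Ψ (N.next d) = Ψ d := by
  have := h.jump hq hr d
  rw [← tail_next] at h1 h2
  refine le_antisymm ?_ ?_
  · by_contra hc
    exact h1 (congrArg N.tail (this.1 (not_le.1 hc)))
  · by_contra hc
    exact h2 (congrArg N.tail (this.2 (not_le.1 hc)))

/-- Around a vertex that `g` does not touch, its potential is constant. -/
theorem IsPotential.rot_eq {g : D → ℝ} {p q : ℕ} {r : ℝ} {Ψ : D → ℝ}
    (h : N.IsPotential g p q r Ψ) (hq : q < N.period) (hr : 0 ≤ r) {d : D}
    (h1 : N.tail d ≠ N.tail (N.outerDart p)) (h2 : N.tail d ≠ N.tail (N.outerDart q))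
    (h0 : g d = 0) : Ψ (N.rot d) = Ψ d := by
  rw [BoundaryNetwork.rot_eq, h.next_eq hq hr (by simpa using h1) (by simpa using h2)]
  have := h.eq d
  linarith

/-- Disjoint connected vertex sets do not interleave on the boundary. -/
theorem not_interleaved {U W : Set V} (hUW : Disjoint U W) {A B : Set D}
    (hA : ∀ d ∈ A, N.tail d ∈ U ∧ N.head d ∈ U) (hB : ∀ d ∈ B, N.tail d ∈ W ∧ N.head d ∈ W)
    {k₁ k₂ k₃ k₄ : ℕ} (h12 : k₁ < k₂) (h23 : k₂ < k₃) (h34 : k₃ < k₄) (h4 : k₄ < N.period)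
    (hU : N.tail (N.outerDart k₁) ∈ U) (hW : N.tail (N.outerDart k₂) ∈ W)
    (h13 : N.Reaches A (N.tail (N.outerDart k₁)) (N.tail (N.outerDart k₃)))
    (h24 : N.Reaches B (N.tail (N.outerDart k₂)) (N.tail (N.outerDart k₄))) : False := by
  obtain ⟨P, hP, hPA⟩ := h13.exists_simplePath
  -- The potential of a path inside `U` is constant along connections inside `W`, but it is one at
  -- position `k₂` and zero at `k₄`.
  obtain ⟨Ψ, hΨ⟩ := exists_potential (N := N) (rchain_anti P) (p := k₁) (q := k₃) (by omega) (by omega)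
    (r := 1) (fun x => by rw [hP.1.netIn_rchain, one_mul])
  have hU3 := h13.mem_of_closed hU (fun d hd _ => (hA d hd).2)
  have hz : ∀ d, N.tail d ∈ W → N.rchain P d = 0 := by
    intro d hd
    have h1 : d ∉ P := fun h => hUW.le_bot ⟨(hA d (hPA d h)).1, hd⟩
    have h2 : N.rev d ∉ P := fun h => hUW.le_bot ⟨(hA _ (hPA _ h)).2, by simpa using hd⟩
    simp [rchain_of_nodup hP.nodup, h1, h2]
  have := Reaches.eq_of_invariant (N := N) (h := Ψ) (W := W) (A := B) (fun d hd =>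
    hΨ.rot_eq (by omega) zero_le_one (fun h => hUW.le_bot ⟨hU, h ▸ hd⟩)
      (fun h => hUW.le_bot ⟨hU3, h ▸ hd⟩) (hz d hd))
    (fun d hd => ⟨(hB d hd).1, (hB d hd).2, by
      have h1 := hΨ.eq d
      rw [hz d (hB d hd).1] at h1
      linarith⟩) h24 hW rfl rfl
  rw [hΨ.outer _ (by omega), hΨ.outer _ h4, if_pos ⟨h12.le, h23⟩, if_neg (by omega)] at this
  exact one_ne_zero this

/-! ### The left side of a path -/

theorem netIn_indicator {J : Set D} (hJ : ∀ d ∈ J, N.next d ∈ J) (v : V) :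
    N.netIn (fun d => (if d ∈ J then (1 : ℝ) else 0) - (if N.rev d ∈ J then 1 else 0)) v = 0 := by
  rw [N.netIn_potential (fun d => if d ∈ J then (1 : ℝ) else 0)]
  refine Finset.sum_eq_zero fun d _ => ?_
  have : N.next d ∈ J ↔ d ∈ J :=
    ⟨fun h => mem_of_leftFace_eq hJ (N.leftFace_next d) h, hJ d⟩
  simp [this]

theorem indicator_anti (J : Set D) :
    N.Anti (fun d => (if d ∈ J then (1 : ℝ) else 0) - (if N.rev d ∈ J then 1 else 0)) := by
  intro d; simp

theorem indicator_pos {J : Set D} {d : D} :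
    0 < (if d ∈ J then (1 : ℝ) else 0) - (if N.rev d ∈ J then 1 else 0) ↔ d ∈ J ∧ N.rev d ∉ J := by
  split_ifs <;> simp_all

/-- The boundary of a union of faces is a circulation, and a simple path carries none. So no edge
leads out of `J`, and `J` avoids the infinite face. -/
theorem eq_empty_of_subset_path {J : Set D} (hJ : ∀ d ∈ J, N.next d ∈ J) (hb : N.base ∉ J)
    {u v : V} {P : List D} (hP : N.IsSimplePath u P v)
    (h : (∀ d, d ∈ J → N.rev d ∉ J → d ∈ P) ∨ ∀ d, d ∉ J → N.rev d ∈ J → d ∈ P) : J = ∅ := by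
  have hz : (fun d => (if d ∈ J then (1 : ℝ) else 0) - (if N.rev d ∈ J then 1 else 0)) = 0 := by
    rcases h with h | h
    · refine circulation_eq_zero_of_subset_path (indicator_anti J) (netIn_indicator hJ) hP ?_
      intro d hd
      rw [indicator_pos] at hd
      exact h d hd.1 hd.2
    · rw [← neg_eq_zero]
      refine circulation_eq_zero_of_subset_path (indicator_anti J).neg
        (fun v => by rw [netIn_neg, netIn_indicator hJ, neg_zero]) hP ?_
      intro d hd
      rw [Pi.neg_apply, ← indicator_anti (N := N) J d, indicator_pos, rev_rev'] at hd
      exact h d hd.2 hd.1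
  refine eq_empty_of_closed hJ hb fun d hd => ?_
  have := congrFun hz d
  by_contra hc
  simp [hd, hc] at this

/-- The potential of a simple path between boundary vertices tells its left side from its right
side. -/
theorem IsSimplePath.exists_side {p q : ℕ} (hpq : p ≤ q) (hq : q < N.period) {P : List D}
    (hP : N.IsSimplePath (N.tail (N.outerDart p)) P (N.tail (N.outerDart q))) :
    ∃ Ψ, N.IsPotential (N.rchain P) p q 1 Ψ ∧ ∀ d, Ψ d = 0 ∨ Ψ d = 1 := by
  obtain ⟨Ψ, hΨ⟩ := exists_potential (rchain_anti P) hpq hq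
    (r := 1) (by intro x; rw [hP.1.netIn_rchain, one_mul])
  refine ⟨Ψ, hΨ, ?_⟩
  have hout : ∀ d, Ψ d ≠ 0 → Ψ d ≠ 1 → N.leftFace d ≠ N.outer := by
    intro d h0 h1 ho
    obtain ⟨k, hk, rfl⟩ := exists_outerDart ho
    rw [hΨ.outer k hk] at h0 h1
    split_ifs at h0 h1 <;> simp_all
  have hpos : ∀ d, Ψ (N.rev d) < Ψ d → d ∈ P := fun d hd =>
    mem_of_rchain_pos (N := N) (by rw [hΨ.eq]; linarith)
  have hbase : Ψ N.base = 0 ∨ Ψ N.base = 1 := by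
    by_contra hc
    push Not at hc
    exact hout _ hc.1 hc.2 rfl
  -- A maximum above one would be attained on finite faces only, and the boundary of this level set
  -- would consist of darts of `P` in one direction. The minimum is treated in the same way.
  have hle : ∀ d, Ψ d ≤ 1 := by
    obtain ⟨y, -, hy⟩ := Finset.exists_max_image (Finset.univ : Finset D) Ψ ⟨N.base, by simp⟩
    by_contra hc
    push Not at hc
    obtain ⟨x, hx⟩ := hc
    have hM : 1 < Ψ y := hx.trans_le (hy x (by simp))
    have : {d | Ψ d = Ψ y} = ∅ := eq_empty_of_subset_path (N := N) (P := P) (fun d hd => by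
        simp only [Set.mem_ofPred_eq] at hd ⊢
        rw [hΨ.inner d (hout d (by linarith) (by linarith)), hd])
      (by simp only [Set.mem_ofPred_eq]; rcases hbase with h | h <;> linarith) hP (Or.inl fun d hd hd' => hpos d (by
        simp only [Set.mem_ofPred_eq] at hd hd'
        rw [hd]
        exact lt_of_le_of_ne (hy _ (by simp)) hd'))
    exact (this ▸ (rfl : y ∈ {d | Ψ d = Ψ y}) : y ∈ (∅ : Set D))
  have hge : ∀ d, 0 ≤ Ψ d := by
    obtain ⟨y, -, hy⟩ := Finset.exists_min_image (Finset.univ : Finset D) Ψ ⟨N.base, by simp⟩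
    by_contra hc
    push Not at hc
    obtain ⟨x, hx⟩ := hc
    have hM : Ψ y < 0 := (hy x (by simp)).trans_lt hx
    have : {d | Ψ d = Ψ y} = ∅ := eq_empty_of_subset_path (N := N) (P := P) (fun d hd => by
        simp only [Set.mem_ofPred_eq] at hd ⊢
        rw [hΨ.inner d (hout d (by linarith) (by linarith)), hd])
      (by simp only [Set.mem_ofPred_eq]; rcases hbase with h | h <;> linarith) hP (Or.inr fun d hd hd' => hpos d (by
        simp only [Set.mem_ofPred_eq] at hd hd'
        rw [hd']
        exact lt_of_le_of_ne (hy _ (by simp)) (Ne.symm hd)))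
    exact (this ▸ (rfl : y ∈ {d | Ψ d = Ψ y}) : y ∈ (∅ : Set D))
  -- An edge off `P` does not change the potential; an edge of `P` changes it by one, which between
  -- the bounds forces the values zero and one. So intermediate values would spread over the whole
  -- plane.
  have : {d | Ψ d ≠ 0 ∧ Ψ d ≠ 1} = ∅ := by
    refine eq_empty_of_closed (N := N) (fun d hd => ?_) (fun h => ?_) (fun d hd => ?_)
    · simp only [Set.mem_ofPred_eq] at hd ⊢
      rwa [hΨ.inner d (hout d hd.1 hd.2)]
    · rcases hbase with h' | h'
      exacts [h.1 h', h.2 h']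
    · simp only [Set.mem_ofPred_eq] at hd ⊢
      have h1 : d ∉ P := by
        intro h
        have h2 := rchain_eq_one hP.nodup h (hP.rev_notMem h)
        rw [hΨ.eq] at h2
        exact hd.2 (le_antisymm (hle d) (by linarith [hge (N.rev d)]))
      have h3 : N.rev d ∉ P := by
        intro h
        have h2 := rchain_eq_one hP.nodup h (hP.rev_notMem h)
        rw [hΨ.eq, rev_rev'] at h2
        exact hd.1 (le_antisymm (by linarith [hle (N.rev d)]) (hge d))
      have h4 := hΨ.eq d
      rw [rchain_of_nodup hP.nodup, if_neg h1, if_neg h3] at h4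
      rwa [show Ψ (N.rev d) = Ψ d by linarith]
  intro d
  by_contra hc
  push Not at hc
  exact (this ▸ (hc : d ∈ {d | Ψ d ≠ 0 ∧ Ψ d ≠ 1}) : d ∈ (∅ : Set D))

theorem sinkPos_lt (i : Fin m) : N.sinkPos i < N.period := N.sink_lt_period i

theorem srcPos_lt (i : Fin m) : N.srcPos i < N.period :=
  (N.src_lt_sink i).trans (N.sink_lt_period i)

theorem src_lt_sink_of_le {i j : Fin m} (h : i ≤ j) : N.srcPos i < N.sinkPos j := by
  rcases h.lt_or_eq with h | rfl
  · exact (N.src_lt_sink i).trans ((N.sink_lt_src i j h).trans (N.src_lt_sink j))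
  · exact N.src_lt_sink i

theorem srcPos_lt_srcPos {i j : Fin m} (h : i < j) : N.srcPos i < N.srcPos j :=
  (N.src_lt_sink i).trans (N.sink_lt_src i j h)

theorem sinkPos_lt_sinkPos {i j : Fin m} (h : i < j) : N.sinkPos i < N.sinkPos j :=
  (N.sink_lt_src i j h).trans (N.src_lt_sink j)

theorem arc_eq (i j : Fin m) : N.arc i j = N.arcList (N.srcPos i) (N.sinkPos j) := rfl

theorem tail_srcPos (i : Fin m) : N.tail (N.outerDart (N.srcPos i)) = N.s i := rfl

theorem tail_sinkPos (i : Fin m) : N.tail (N.outerDart (N.sinkPos i)) = N.t i := rfl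

theorem s_ne_t (i j : Fin m) : N.s i ≠ N.t j := N.src_ne_sink i j

theorem s_inj {i j : Fin m} (h : N.s i = N.s j) : i = j := N.src_injective h


/-- The enclosed faces in the definition are the finite faces of potential one, and the boundary
darts of the arc are the part of the infinite face with that value. -/
theorem strictlyLeft_iff {i j : Fin m} {P : List D}
    (hP : N.IsSimplePath (N.s i) P (N.t j)) {Ψ : D → ℝ}
    (hΨ : N.IsPotential (N.rchain P) (N.srcPos i) (N.sinkPos j) 1 Ψ)
    (h01 : ∀ d, Ψ d = 0 ∨ Ψ d = 1) (d : D) :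
    N.StrictlyLeft i j P d ↔ d ∉ P ∧ N.rev d ∉ P ∧ Ψ d = 1 := by
  have hq := N.sinkPos_lt j
  obtain ⟨I, hI⟩ : ∃ I : Set N.Face, ∀ x, x ∈ I ↔
    ∃ e, N.leftFace e = x ∧ x ≠ N.outer ∧ Ψ e = 1 := ⟨{x | _}, fun _ => Iff.rfl⟩
  have hmem : ∀ e, N.leftFace e ≠ N.outer → (N.leftFace e ∈ I ↔ Ψ e = 1) := by
    intro e he
    rw [hI]
    refine ⟨?_, fun h => ⟨e, rfl, he, h⟩⟩
    rintro ⟨f, hf, -, h⟩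
    have := mem_of_leftFace_eq (N := N) (J := {e | N.leftFace e ≠ N.outer ∧ Ψ e = 1})
      (fun e he => ⟨by rw [leftFace_next]; exact he.1, by rw [hΨ.inner e he.1]; exact he.2⟩)
      hf ⟨hf ▸ he, h⟩
    exact this.2
  have hΨI : ∀ e, Ψ e = (if e ∈ N.arc i j then 1 else 0) +
      (if N.leftFace e ∈ I then 1 else 0) := by
    intro e
    by_cases he : N.leftFace e = N.outer
    · have h1 : N.leftFace e ∉ I := by rw [hI]; rintro ⟨f, -, h, -⟩; exact h he
      obtain ⟨k, hk, rfl⟩ := exists_outerDart he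
      rw [hΨ.outer k hk, if_neg h1, arc_eq]
      simp only [mem_arcList hq.le hk, add_zero]
    · have h1 : e ∉ N.arc i j := fun h => he (leftFace_of_mem_arcList h)
      rw [if_neg h1, zero_add]
      rcases h01 e with h | h <;> simp [hmem e he, h]
  have hz : (fun e => (N.chain (N.arc i j) e : ℝ) - N.chain P e) = N.setBdry I := by
    funext e
    have h1 := hΨ.eq e
    have h2 := rchain_of_nodup (N := N) (nodup_arcList (p := N.srcPos i) hq.le) e
    rw [← arc_eq] at h2
    simp only [rchain] at h1 h2
    rw [h1, h2, hΨI e, hΨI (N.rev e), setBdry_apply, rightFace]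
    ring
  have henc : N.Encloses (fun e => N.chain (N.arc i j) e - N.chain P e) I := by
    refine ⟨by rw [hI]; rintro ⟨f, -, h, -⟩; exact h rfl, fun e => ?_⟩
    have := congrFun hz e
    rw [setBdry_apply] at this
    rw [← @Int.cast_inj ℝ]
    push_cast
    exact this
  -- A closed chain determines what it encloses: the difference of the two indicators has zero
  -- boundary, so it is constant, and it vanishes at the infinite face.
  have huniq : ∀ I', N.Encloses (fun e => N.chain (N.arc i j) e - N.chain P e) I' → I' = I := by
    rintro I' ⟨h0, h⟩
    have h1 : N.bdry ((fun x => if x ∈ I' then 1 else 0) - (fun x => if x ∈ I then 1 else 0)) = 0 := by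
      rw [map_sub, sub_eq_zero]
      refine Eq.trans ?_ hz
      funext e
      have := h e
      rw [← @Int.cast_inj ℝ] at this
      push_cast at this
      exact this.symm
    ext x
    have h2 := eq_const_of_bdry_eq_zero h1 x N.outer
    simp only [Pi.sub_apply, if_neg h0, if_neg henc.1] at h2
    by_cases hx : x ∈ I' <;> by_cases hx' : x ∈ I <;> simp [hx, hx'] at h2 ⊢
  have hrev : d ∉ P → N.rev d ∉ P → Ψ (N.rev d) = Ψ d := by
    intro h1 h2
    have h4 := hΨ.eq d
    rw [rchain_of_nodup hP.nodup, if_neg h1, if_neg h2] at h4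
    linarith
  have hone : ∀ e, (e ∈ N.arc i j ∨ N.leftFace e ∈ I) ↔ Ψ e = 1 := by
    intro e
    have h1 := hΨI e
    have h2 := h01 e
    split_ifs at h1 with h3 h4 h4 <;> simp only [h3, h4, true_or, or_true, or_self, true_iff,
      false_iff] <;> rcases h2 with h2 | h2 <;> rw [h1] at h2 ⊢ <;> norm_num at h2
    all_goals norm_num
  unfold StrictlyLeft
  refine and_congr_right fun h1 => and_congr_right fun h2 => ?_
  have h3 := hrev h1 h2
  constructor
  · rintro (h | h | ⟨I', hI', h⟩)
    · exact (hone d).1 (Or.inl h)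
    · rw [← h3]; exact (hone _).1 (Or.inl h)
    · rw [huniq I' hI'] at h
      rcases h with h | h
      · exact (hone d).1 (Or.inr h)
      · rw [← h3]; exact (hone _).1 (Or.inr h)
  · intro h
    rcases (hone d).2 h with h | h
    · exact Or.inl h
    · exact Or.inr (Or.inr ⟨I, henc, Or.inl h⟩)

/-! ### Maximum flows -/

/-- The residual darts of `A`. -/
def res {E : Type*} (A : Set E) (c : E → ℝ) : Set E := {d | d ∈ A ∧ 0 < c d}

theorem exists_pos_le {E : Type*} (c : E → ℝ) (p : List E) (h : ∀ d ∈ p, 0 < c d) :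
    ∃ ε : ℝ, 0 < ε ∧ ∀ d ∈ p, ε ≤ c d := by
  induction p with
  | nil => exact ⟨1, one_pos, by simp⟩
  | cons e p ih =>
    obtain ⟨ε, h0, h1⟩ := ih fun d hd => h d (by simp [hd])
    refine ⟨min ε (c e), lt_min h0 (h e (by simp)), ?_⟩
    intro d hd
    rcases List.mem_cons.1 hd with rfl | hd
    · exact min_le_right _ _
    · exact (min_le_left _ _).trans (h1 d hd)

theorem IsFlow.anti {A : Set D} {T : Set V} {c f : D → ℝ} (hf : N.IsFlow A T c f) : N.Anti f :=
  hf.1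

theorem IsFlow.mem {A : Set D} {T : Set V} {c f : D → ℝ} (hf : N.IsFlow A T c f) {d : D}
    (hd : f d ≠ 0) : d ∈ A := by
  by_contra h; exact hd (hf.2.2.2 d h)

theorem IsFlow.mem_res {A : Set D} {T : Set V} {c f : D → ℝ} (hf : N.IsFlow A T c f) {d : D}
    (hd : 0 < f d) : d ∈ res A c :=
  ⟨hf.mem hd.ne', hd.trans_le (hf.2.1 d)⟩

theorem isFlow_zero {A : Set D} {T : Set V} {c : D → ℝ} (hc : ∀ d, 0 ≤ c d) :
    N.IsFlow A T c 0 :=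
  ⟨Anti.zero, hc, fun v _ => N.netIn_zero v, fun _ _ => rfl⟩

theorem IsFlow.push {A : Set D} (hA : ∀ d ∈ A, N.rev d ∈ A) {T : Set V} {c f : D → ℝ}
    (hf : N.IsFlow A T c f) {p : List D} (hp : p.Nodup) (hpA : ∀ d ∈ p, d ∈ res A (c - f))
    (hT : ∀ v, v ∉ T → N.netIn (N.rchain p) v = 0) :
    ∃ ε : ℝ, 0 < ε ∧ N.IsFlow A T c (f + ε • N.rchain p) := by
  obtain ⟨ε, h0, h1⟩ := exists_pos_le (c - f) p fun d hd => (hpA d hd).2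
  refine ⟨ε, h0, hf.anti.add ((rchain_anti p).smul ε), ?_, ?_, ?_⟩
  · intro d
    simp only [Pi.add_apply, Pi.smul_apply, smul_eq_mul, rchain_of_nodup hp]
    have := hf.2.1 d
    by_cases hd : d ∈ p
    · have h2 := h1 d hd
      simp only [Pi.sub_apply] at h2
      split_ifs <;> linarith
    · split_ifs <;> linarith
  · intro v hv
    rw [netIn_add, netIn_smul, hf.2.2.1 v hv, hT v hv]; simp
  · intro d hd
    have h2 : d ∉ p := fun h => hd (hpA d h).1
    have h3 : N.rev d ∉ p := fun h => hd (by simpa using hA _ (hpA _ h).1)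
    simp [hf.2.2.2 d hd, rchain_of_nodup hp, h2, h3]

theorem sum_netIn_add (f g : D → ℝ) (T : Finset V) :
    ∑ v ∈ T, N.netIn (f + g) v = ∑ v ∈ T, N.netIn f v + ∑ v ∈ T, N.netIn g v := by
  simp [netIn_add, Finset.sum_add_distrib]

theorem IsMaxFlow.not_reaches {A : Set D} (hA : ∀ d ∈ A, N.rev d ∈ A) {S T : Finset V}
    {c f : D → ℝ} (hf : N.IsMaxFlow A S T c f) {u v : V} (hu : u ∈ S) (huT : u ∉ T)
    (hv : v ∈ T) : ¬ N.Reaches (res A (c - f)) u v := by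
  intro hr
  obtain ⟨p, hp, hpA⟩ := hr.exists_simplePath
  obtain ⟨ε, h0, h1⟩ := hf.1.push hA hp.nodup hpA (by
    intro x hx
    rw [hp.1.netIn_rchain, if_neg, if_neg, sub_zero]
    · rintro rfl; exact hx (Or.inl hu)
    · rintro rfl; exact hx (Or.inr hv))
  have h2 := hf.2 _ h1
  rw [sum_netIn_add] at h2
  have h3 : ∑ x ∈ T, N.netIn (ε • N.rchain p) x = ε := by
    simp only [netIn_smul, hp.1.netIn_rchain, ← Finset.mul_sum, Finset.sum_sub_distrib]
    rw [Finset.sum_ite_eq' T v, Finset.sum_ite_eq' T u]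
    simp [hv, huT]
  linarith

theorem sum_netIn_univ {f : D → ℝ} (hf : N.Anti f) : ∑ v, N.netIn f v = 0 := by
  have := N.sum_netIn hf Set.univ
  simpa using this

theorem netIn_source {f : D → ℝ} (hf : N.Anti f) {u v : V} (huv : u ≠ v)
    (h0 : ∀ x, x ∉ ({u, v} : Set V) → N.netIn f x = 0) : N.netIn f u = - N.netIn f v := by
  have h1 := sum_netIn_univ hf
  rw [← Finset.sum_subset (Finset.subset_univ {u, v}), Finset.sum_pair huv] at h1
  · linarith
  · intro x _ hx
    exact h0 x (by simpa using hx)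

theorem IsMaxFlow.single {A : Set D} {u v : V} {c f : D → ℝ} (hf : N.IsMaxFlow A {u} {v} c f) :
    N.IsFlow A {u, v} c f ∧ ∀ g, N.IsFlow A {u, v} c g → N.netIn g v ≤ N.netIn f v := by
  have h : ((({u} : Finset V) : Set V) ∪ (({v} : Finset V) : Set V)) = {u, v} := by
    rw [Finset.coe_singleton, Finset.coe_singleton, Set.singleton_union]
  unfold IsMaxFlow at hf
  rw [h] at hf
  simpa using hf

theorem isMaxFlow_single {A : Set D} {u v : V} {c f : D → ℝ} :
    N.IsMaxFlow A {u} {v} c f ↔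
      N.IsFlow A {u, v} c f ∧ ∀ g, N.IsFlow A {u, v} c g → N.netIn g v ≤ N.netIn f v := by
  refine ⟨IsMaxFlow.single, ?_⟩
  have h : ((({u} : Finset V) : Set V) ∪ (({v} : Finset V) : Set V)) = {u, v} := by
    rw [Finset.coe_singleton, Finset.coe_singleton, Set.singleton_union]
  unfold IsMaxFlow
  rw [h]
  simp

theorem IsMaxFlow.value_nonneg {A : Set D} {u v : V} {c f : D → ℝ} (hc : ∀ d, 0 ≤ c d)
    (hf : N.IsMaxFlow A {u} {v} c f) : 0 ≤ N.netIn f v := by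
  have := hf.single.2 0 (isFlow_zero hc)
  rwa [netIn_zero] at this

/-- Between the residual graphs without clockwise cycles before and after augmentation, the flow
has no cycles. -/
theorem acyclic_of_noResidualClockwise {A : Set D} {c f : D → ℝ} (hc : ∀ d, 0 ≤ c d)
    (h1 : N.NoResidualClockwise A c) (h2 : N.NoResidualClockwise A (c - f)) (hf : N.Anti f)
    (hle : ∀ d, f d ≤ c d) (hA : ∀ d, f d ≠ 0 → d ∈ A) {d : D} (hd : 0 < f d) :
    ¬ N.Reaches (pos f) (N.head d) (N.tail d) := by
  intro hr
  obtain ⟨p, -, hp, hpf⟩ := exists_simpleCycle (A := pos f) hd hr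
  have hrev : ∀ e ∈ d :: p, N.rev e ∉ d :: p := by
    intro e he he'
    have h3 : 0 < f e := hpf e he
    have h4 : 0 < f (N.rev e) := hpf _ he'
    rw [hf e] at h4
    linarith
  -- A clockwise cycle of flow darts was residual before the augmentation; the reverse of a
  -- counterclockwise one is residual after it.
  rcases hp.clockwise_or hrev with h | h
  · obtain ⟨e, he, he'⟩ := h1 _ hp (fun e he => hA e (hpf e he).ne') h
    have h3 : 0 < f e := hpf e he
    exact he' (h3.trans_le (hle e))
  · obtain ⟨e, he, he'⟩ := h2 _ hp.revPath (fun e he => by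
      rw [mem_revPath] at he
      have h3 : 0 < f (N.rev e) := hpf _ he
      refine hA e fun h => ?_
      rw [hf e, h] at h3
      simp at h3) h
    rw [mem_revPath] at he
    have h3 : 0 < f (N.rev e) := hpf _ he
    rw [hf e] at h3
    have h4 := hc e
    apply he'
    simp only [Pi.sub_apply]
    linarith

/-- The positive darts of an acyclic flow lie on flow paths. -/
theorem support_reaches {f : D → ℝ} (hf : N.Anti f) {u v : V} (huv : u ≠ v)
    (h0 : ∀ x, x ∉ ({u, v} : Set V) → N.netIn f x = 0) (hv : 0 ≤ N.netIn f v)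
    (hac : ∀ d, 0 < f d → ¬ N.Reaches (pos f) (N.head d) (N.tail d)) {d : D} (hd : 0 < f d) :
    N.Reaches (pos f) u (N.tail d) ∧ N.Reaches (pos f) (N.head d) v := by
  have hu := netIn_source hf huv h0
  constructor
  · obtain ⟨w, hw, hr⟩ := (flow_back hf hd).resolve_left (hac d hd)
    by_cases h1 : w = u
    · exact h1 ▸ hr
    · exfalso
      by_cases h2 : w = v
      · subst h2; linarith
      · rw [h0 w (by simp [h1, h2])] at hw; exact lt_irrefl _ hw
  · obtain ⟨w, hw, hr⟩ := (flow_forward hf hd).resolve_left (hac d hd)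
    by_cases h1 : w = v
    · exact h1 ▸ hr
    · exfalso
      by_cases h2 : w = u
      · subst h2; linarith
      · rw [h0 w (by simp [h1, h2])] at hw; exact lt_irrefl _ hw

/-- On the clockwise boundary of a positive maximal level set, `g < f ≤ c`, so all its darts are
residual for `g`, against `exists_boundary`. With the roles of `f` and `g` exchanged this yields
uniqueness of leftmost flows. -/
theorem potential_nonpos {A : Set D} {c f g : D → ℝ} {Φ : N.Face → ℝ} (h0 : Φ N.outer = 0)
    (hΦ : N.bdry Φ = f - g) (hg : N.NoResidualClockwise A (c - g)) (hf : ∀ d, f d ≤ c d)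
    (hfA : ∀ d, d ∉ A → f d = 0) (hgA : ∀ d, d ∉ A → g d = 0) (x : N.Face) : Φ x ≤ 0 := by
  by_contra hx
  rw [not_le] at hx
  obtain ⟨y, -, hy⟩ := Finset.exists_max_image (Finset.univ : Finset N.Face) Φ ⟨x, by simp⟩
  have hM := hx.trans_le (hy x (by simp))
  obtain ⟨d, h1, h2, h3⟩ := hg.exists_boundary (J := {d | Φ (N.leftFace d) = Φ y})
    (fun d hd => by simpa only [Set.mem_ofPred_eq, leftFace_next] using hd)
    (fun h => by
      have : Φ N.outer = Φ y := h
      linarith)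
    (by
      induction y using Quotient.inductionOn with | _ e
      exact ⟨e, rfl⟩)
  simp only [Set.mem_ofPred_eq] at h1 h2
  have h4 := lt_of_le_of_ne (hy (N.leftFace d) (by simp)) h2
  have h5 := congrFun hΦ d
  simp only [bdry_apply, rightFace, Pi.sub_apply] at h5
  refine h3 ⟨?_, ?_⟩
  · by_contra hd
    rw [hfA d hd, hgA d hd] at h5
    linarith
  · have := hf d
    simp only [Pi.sub_apply]
    linarith

theorem IsLeftmostMaxFlow.unique {A : Set D} {c f g : D → ℝ} {u v : V} (huv : u ≠ v)
    (hf : N.IsLeftmostMaxFlow A c u v f) (hg : N.IsLeftmostMaxFlow A c u v g) : f = g := by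
  obtain ⟨hf1, hf2⟩ := hf.1.single
  obtain ⟨hg1, hg2⟩ := hg.1.single
  have hv : N.netIn f v = N.netIn g v := le_antisymm (hg2 _ hf1) (hf2 _ hg1)
  have ha : N.Anti (f - g) := hf1.anti.sub hg1.anti
  have h0 : ∀ x, x ∉ ({u, v} : Set V) → N.netIn (f - g) x = 0 := by
    intro x hx
    rw [netIn_sub, hf1.2.2.1 x hx, hg1.2.2.1 x hx, sub_zero]
  have hc : ∀ x, N.netIn (f - g) x = 0 := by
    intro x
    have hv0 : N.netIn (f - g) v = 0 := by rw [netIn_sub, hv, sub_self]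
    by_cases h1 : x = v
    · rw [h1, hv0]
    by_cases h2 : x = u
    · rw [h2, netIn_source ha huv h0, hv0, neg_zero]
    · exact h0 x (by simp [h1, h2])
  obtain ⟨Φ, hΦ0, hΦ⟩ := exists_face_potential ha hc
  have h1 := potential_nonpos hΦ0 hΦ hg.2 hf1.2.1 hf1.2.2.2 hg1.2.2.2
  have h2 := potential_nonpos (Φ := -Φ) (by simp [hΦ0]) (by rw [map_neg, hΦ, neg_sub]) hf.2
    hg1.2.1 hg1.2.2.2 hf1.2.2.2
  have h3 : Φ = 0 := funext fun x => le_antisymm (h1 x) (by simpa using h2 x)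
  rw [h3, map_zero] at hΦ
  exact sub_eq_zero.1 hΦ.symm

/-- A linear functional that counts the faces in the interior of a cycle. -/
theorem exists_area (N : BoundaryNetwork V D m) : ∃ w : (D → ℝ) →ₗ[ℝ] ℝ,
    ∀ Φ : N.Face → ℝ, Φ N.outer = 0 → w (N.bdry Φ) = ∑ x, Φ x := by
  -- Recording the value at the infinite face makes the boundary map injective, so it has a linear
  -- left inverse defined on all dart functions.
  let j : (N.Face → ℝ) →ₗ[ℝ] (D → ℝ) × ℝ := N.bdry.prod (LinearMap.proj N.outer)
  have hj : LinearMap.ker j = ⊥ := by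
    rw [LinearMap.ker_eq_bot']
    intro Φ hΦ
    have h1 : N.bdry Φ = 0 := congrArg Prod.fst hΦ
    have h2 : Φ N.outer = 0 := congrArg Prod.snd hΦ
    funext x
    rw [eq_const_of_bdry_eq_zero h1 x N.outer, h2]; rfl
  obtain ⟨g, hg⟩ := j.exists_leftInverse_of_injective hj
  refine ⟨(∑ x, LinearMap.proj x) ∘ₗ g ∘ₗ LinearMap.inl ℝ _ _, fun Φ h0 => ?_⟩
  have h1 : (N.bdry Φ, (0 : ℝ)) = j Φ := by
    simp [j, h0]
  have h2 : g (j Φ) = Φ := congrArg (fun f => f Φ) hg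
  simp only [LinearMap.comp_apply, LinearMap.inl_apply, h1, h2]
  simp

theorem isCompact_flows (A : Set D) (T : Set V) (c : D → ℝ) :
    IsCompact {f | N.IsFlow A T c f} := by
  have hn : ∀ v, Continuous fun f : D → ℝ => N.netIn f v := fun v =>
    continuous_finsetSum _ fun d _ => continuous_apply d
  have hcl : IsClosed {f | N.IsFlow A T c f} := by
    have : {f | N.IsFlow A T c f} = (⋂ d, {f | f (N.rev d) = - f d}) ∩ (⋂ d, {f | f d ≤ c d}) ∩
        (⋂ v, {f | v ∉ T → N.netIn f v = 0}) ∩ (⋂ d, {f | d ∉ A → f d = 0}) := by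
      ext f
      simp only [IsFlow, Set.mem_ofPred_eq, Set.mem_inter_iff, Set.mem_iInter]
      tauto
    rw [this]
    refine ((IsClosed.inter ?_ ?_).inter ?_).inter ?_
    · exact isClosed_iInter fun d => isClosed_eq (continuous_apply _) (continuous_apply _).neg
    · exact isClosed_iInter fun d => isClosed_le (continuous_apply _) continuous_const
    · refine isClosed_iInter fun v => ?_
      by_cases hv : v ∈ T
      · simp [hv]
      · simpa [hv] using isClosed_eq (hn v) continuous_const
    · refine isClosed_iInter fun d => ?_
      by_cases hd : d ∈ A
      · simp [hd]
      · simpa [hd] using isClosed_eq (continuous_apply (A := fun _ => ℝ) d) continuous_const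
  refine (isCompact_Icc (a := fun d => - c (N.rev d)) (b := c)).of_isClosed_subset hcl ?_
  intro f hf
  refine ⟨fun d => ?_, hf.2.1⟩
  have h1 := hf.2.1 (N.rev d)
  rw [hf.1 d] at h1
  linarith

/-- By compactness, take a maximum flow that also maximizes the area functional `w`. Pushing ε along
a residual clockwise cycle would raise `w` by ε times the number of enclosed faces without changing
the value. -/
theorem exists_leftmost {A : Set D} (hA : ∀ d ∈ A, N.rev d ∈ A) (S T : Finset V) {c : D → ℝ}
    (hc : ∀ d, 0 ≤ c d) : ∃ f, N.IsMaxFlow A S T c f ∧ N.NoResidualClockwise A (c - f) := by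
  have hn : Continuous fun f : D → ℝ => ∑ v ∈ T, N.netIn f v :=
    continuous_finsetSum _ fun v _ => continuous_finsetSum _ fun d _ => continuous_apply d
  have hK := N.isCompact_flows A (↑S ∪ ↑T) c
  obtain ⟨f₁, hf₁, hmax₁⟩ := hK.exists_isMaxOn ⟨0, isFlow_zero hc⟩ hn.continuousOn
  obtain ⟨w, hw⟩ := N.exists_area
  have hwc : Continuous w := w.continuous_of_finiteDimensional
  have hK' := hK.inter_right (isClosed_eq hn (continuous_const (y := ∑ v ∈ T, N.netIn f₁ v)))
  obtain ⟨f, ⟨hf, hfv⟩, hmax⟩ := hK'.exists_isMaxOn ⟨f₁, hf₁, rfl⟩ hwc.continuousOn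
  have hfv' : ∑ v ∈ T, N.netIn f v = ∑ v ∈ T, N.netIn f₁ v := hfv
  refine ⟨f, ⟨hf, fun g hg => hfv'.symm ▸ hmax₁ hg⟩, ?_⟩
  intro p hp hpA ⟨I, hI, henc⟩
  by_contra hcon
  push Not at hcon
  obtain ⟨h1, h2⟩ := encloses_iff.1 henc
  have hbal : ∀ v, N.netIn (N.rchain p) v = 0 := fun v => by
    rw [h2]; exact N.netIn_bdry _ v
  obtain ⟨ε, h0, hpush⟩ := IsFlow.push hA hf (hp.2.2.of_map _)
    (fun d hd => ⟨hpA d hd, hcon d hd⟩) (fun v _ => hbal v)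
  have h3 : w (f + ε • N.rchain p) ≤ w f := by
    refine hmax ⟨hpush, ?_⟩
    simp only [Set.mem_ofPred_eq]
    rw [sum_netIn_add, hfv']
    simp [netIn_smul, hbal]
  rw [map_add, map_smul, h2, setBdry, hw _ (by simp [h1])] at h3
  have h4 : (0 : ℝ) < ∑ x : N.Face, (if x ∈ I then 1 else 0) := by
    obtain ⟨x, hx⟩ := hI
    refine Finset.sum_pos' (fun _ _ => by split_ifs <;> norm_num) ⟨x, by simp, by simp [hx]⟩
  have := mul_pos h0 h4
  simp only [smul_eq_mul] at h3
  linarith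

/-! ### Potentials and path decompositions of leftmost flows -/

/-- The converse of `exists_potential`. It makes the boundary of an upper level set a unit flow
between the same two positions. -/
theorem IsPotential.netIn {g : D → ℝ} {p q : ℕ} {r : ℝ} {Ψ : D → ℝ}
    (h : N.IsPotential g p q r Ψ) (hpq : p ≤ q) (hq : q < N.period) (x : V) :
    N.netIn g x = r * ((if x = N.tail (N.outerDart q) then 1 else 0) -
      (if x = N.tail (N.outerDart p) then 1 else 0)) := by
  have h1 : g - r • N.rchain (N.arcList p q) =
      fun d => (fun d => Ψ d - r * (if d ∈ N.arcList p q then 1 else 0)) d -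
        (fun d => Ψ d - r * (if d ∈ N.arcList p q then 1 else 0)) (N.rev d) := by
    funext d
    simp only [Pi.sub_apply, Pi.smul_apply, smul_eq_mul, h.eq d,
      rchain_of_nodup (nodup_arcList hq.le)]
    ring
  have h2 : N.netIn (g - r • N.rchain (N.arcList p q)) x = 0 := by
    rw [h1, netIn_potential]
    refine Finset.sum_eq_zero fun d _ => ?_
    have key : ∀ d, N.leftFace d = N.outer →
        Ψ d - r * (if d ∈ N.arcList p q then 1 else 0) = 0 := by
      intro d hd
      obtain ⟨k, hk, rfl⟩ := exists_outerDart hd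
      rw [h.outer k hk]
      simp only [mem_arcList hq.le hk]
      split_ifs <;> simp
    by_cases hd : N.leftFace d = N.outer
    · rw [key d hd, key (N.next d) ((N.leftFace_next d).trans hd), sub_zero]
    · have h3 : d ∉ N.arcList p q := fun h => hd (leftFace_of_mem_arcList h)
      have h4 : N.next d ∉ N.arcList p q := fun h =>
        hd ((N.leftFace_next d).symm.trans (leftFace_of_mem_arcList h))
      rw [h.inner d hd, if_neg h3, if_neg h4, sub_self]
  rw [netIn_sub, netIn_smul, (isWalk_arcList hpq).netIn_rchain] at h2
  linarith

theorem IsFlow.exists_potential {A : Set D} {c f : D → ℝ} {i j : Fin m} (hij : i ≤ j)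
    (hf : N.IsFlow A {N.s i, N.t j} c f) :
    ∃ Ψ, N.IsPotential f (N.srcPos i) (N.sinkPos j) (N.netIn f (N.t j)) Ψ := by
  refine BoundaryNetwork.exists_potential hf.anti (src_lt_sink_of_le hij).le (sinkPos_lt j) ?_
  intro x
  rw [tail_srcPos, tail_sinkPos]
  by_cases h1 : x = N.t j
  · subst h1; simp [(s_ne_t i j).symm]
  by_cases h2 : x = N.s i
  · subst h2
    rw [netIn_source hf.anti (s_ne_t i j) hf.2.2.1]
    simp [s_ne_t]
  · rw [hf.2.2.1 x (by simp [h1, h2])]; simp [h1, h2]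

/-- A level outside the range of the boundary values occupies finite faces only. Around a minimum
below zero the flow is positive, hence residual for `c`; around a maximum above `r` it is negative,
hence residual for `c - f`. -/
theorem IsPotential.bounds {A : Set D} {c f : D → ℝ} {p q : ℕ} {r : ℝ} {Ψ : D → ℝ} (hr : 0 ≤ r)
    (hΨ : N.IsPotential f p q r Ψ) (h1 : N.NoResidualClockwise A c)
    (h2 : N.NoResidualClockwise A (c - f)) (hc : ∀ d, 0 ≤ c d) (hle : ∀ d, f d ≤ c d)
    (hA : ∀ d, f d ≠ 0 → d ∈ A) (d : D) : 0 ≤ Ψ d ∧ Ψ d ≤ r := by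
  have hout : ∀ d, Ψ d ≠ 0 → Ψ d ≠ r → N.leftFace d ≠ N.outer := by
    intro d h0 h1 ho
    obtain ⟨k, hk, rfl⟩ := exists_outerDart ho
    rw [hΨ.outer k hk] at h0 h1
    split_ifs at h0 h1 <;> simp_all
  have hbase : Ψ N.base = 0 ∨ Ψ N.base = r := by
    by_contra hc
    push Not at hc
    exact hout _ hc.1 hc.2 rfl
  constructor
  · obtain ⟨y, -, hy⟩ := Finset.exists_min_image (Finset.univ : Finset D) Ψ ⟨N.base, by simp⟩
    by_contra hcon
    rw [not_le] at hcon
    have hM : Ψ y < 0 := (hy d (by simp)).trans_lt hcon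
    obtain ⟨e, h3, h4, h5⟩ := h1.exists_boundary (J := {d | Ψ d = Ψ y}) (fun d hd => by
        simp only [Set.mem_ofPred_eq] at hd ⊢
        rw [hΨ.inner d (hout d (by linarith) (by linarith)), hd])
      (by simp only [Set.mem_ofPred_eq]; rcases hbase with h | h <;> linarith) ⟨y, rfl⟩
    simp only [Set.mem_ofPred_eq] at h3 h4
    have h6 := lt_of_le_of_ne (hy e (by simp)) (Ne.symm h4)
    have h7 := hΨ.eq e
    have h8 := hle e
    exact h5 ⟨hA e (by linarith), by linarith⟩
  · obtain ⟨y, -, hy⟩ := Finset.exists_max_image (Finset.univ : Finset D) Ψ ⟨N.base, by simp⟩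
    by_contra hcon
    rw [not_le] at hcon
    have hM : r < Ψ y := hcon.trans_le (hy d (by simp))
    obtain ⟨e, h3, h4, h5⟩ := h2.exists_boundary (J := {d | Ψ d = Ψ y}) (fun d hd => by
        simp only [Set.mem_ofPred_eq] at hd ⊢
        rw [hΨ.inner d (hout d (by linarith) (by linarith)), hd])
      (by simp only [Set.mem_ofPred_eq]; rcases hbase with h | h <;> linarith) ⟨y, rfl⟩
    simp only [Set.mem_ofPred_eq] at h3 h4
    have h6 := lt_of_le_of_ne (hy e (by simp)) h4
    have h7 := hΨ.eq e
    have h8 := hc e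
    refine h5 ⟨hA e (by linarith), ?_⟩
    simp only [Pi.sub_apply]
    linarith

/-- The chain of the upper level set of a potential. -/
def level (N : BoundaryNetwork V D m) (Ψ : D → ℝ) (x : ℝ) (d : D) : ℝ :=
  (if x ≤ Ψ d then 1 else 0) - (if x ≤ Ψ (N.rev d) then 1 else 0)

/-- The boundary of the upper level set is a unit flow supported where `f` is positive, so it
contains a simple path. What is left is a circulation inside an acyclic support, hence zero. -/
theorem IsPotential.exists_level_path {f : D → ℝ} {p q : ℕ} {r : ℝ} {Ψ : D → ℝ}
    (hΨ : N.IsPotential f p q r Ψ) (hpq : p ≤ q) (hq : q < N.period)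
    (hne : N.tail (N.outerDart p) ≠ N.tail (N.outerDart q))
    (hac : ∀ d, 0 < f d → ¬ N.Reaches (pos f) (N.head d) (N.tail d)) {x : ℝ} (h0 : 0 < x)
    (hx : x ≤ r) : ∃ P, N.IsSimplePath (N.tail (N.outerDart p)) P (N.tail (N.outerDart q)) ∧
      N.rchain P = N.level Ψ x := by
  have hz : N.IsPotential (N.level Ψ x) p q 1 (fun d => if x ≤ Ψ d then 1 else 0) := by
    refine ⟨fun d => rfl, fun k hk => ?_, fun d hd => ?_⟩
    · rw [hΨ.outer k hk]
      split_ifs <;> first | rfl | linarith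
    · simp only [hΨ.inner d hd]
  have hza : N.Anti (N.level Ψ x) := by intro d; simp [level]
  have hzf : ∀ d, 0 < N.level Ψ x d → 0 < f d := by
    intro d hd
    rw [hΨ.eq]
    simp only [level] at hd
    split_ifs at hd <;> linarith
  have hz1 : ∀ d, 0 < N.level Ψ x d → N.level Ψ x d = 1 := by
    intro d hd
    simp only [level] at hd ⊢
    split_ifs at hd ⊢ <;> linarith
  obtain ⟨w, hw, hr⟩ := exists_reaches_of_netIn_neg hza (u := N.tail (N.outerDart p)) (by
    rw [hz.netIn hpq hq, if_neg hne, if_pos rfl]; norm_num)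
  have hwt : w = N.tail (N.outerDart q) := by
    by_contra h
    rw [hz.netIn hpq hq, if_neg h] at hw
    split_ifs at hw <;> linarith
  subst hwt
  obtain ⟨P, hP, hPz⟩ := hr.exists_simplePath
  refine ⟨P, hP, ?_⟩
  set y := N.level Ψ x - N.rchain P with hy
  have hya : N.Anti y := hza.sub (rchain_anti P)
  have hyb : ∀ v, N.netIn y v = 0 := by
    intro v
    rw [hy, netIn_sub, hz.netIn hpq hq, hP.1.netIn_rchain]; ring
  have hyz : ∀ d, 0 < y d → 0 < N.level Ψ x d := by
    intro d hd
    simp only [hy, Pi.sub_apply, rchain_of_nodup hP.nodup] at hd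
    by_contra hcon
    by_cases h1 : d ∈ P
    · exact hcon (hPz d h1)
    · rw [if_neg h1] at hd
      split_ifs at hd with h2
      · have h3 := hz1 _ (hPz _ h2)
        rw [hza d] at h3
        linarith
      · linarith
  have hy0 : ∀ d, y d ≤ 0 := by
    intro d
    by_contra hd
    rw [not_le] at hd
    rcases flow_back hya hd with h | ⟨w, hw, -⟩
    · exact hac d (hzf d (hyz d hd)) (h.mono fun e he => hzf e (hyz e he))
    · rw [hyb] at hw; exact lt_irrefl _ hw
  funext d
  have h1 := hy0 d
  have h2 := hy0 (N.rev d)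
  rw [hya d] at h2
  have h3 : y d = 0 := by linarith
  simp only [hy, Pi.sub_apply] at h3
  linarith

/-- The faces between the two paths are those with potential in `[y, x)`. They are finite because
the infinite face only has the values `0` and `r`, and there are some because `y` is attained. -/
theorem IsPotential.leftOf {f : D → ℝ} {p q : ℕ} {r : ℝ} {Ψ : D → ℝ}
    (hΨ : N.IsPotential f p q r Ψ) {x y : ℝ} (hy : 0 < y) (hyx : y < x) (hx : x ≤ r)
    (hyΨ : ∃ d, Ψ d = y) {P Q : List D} (hP : N.rchain P = N.level Ψ x)
    (hQ : N.rchain Q = N.level Ψ y) : N.LeftOf P Q := by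
  obtain ⟨I, hI⟩ : ∃ I : Set N.Face, ∀ a, a ∈ I ↔
    ∃ e, N.leftFace e = a ∧ a ≠ N.outer ∧ y ≤ Ψ e ∧ Ψ e < x := ⟨{a | _}, fun _ => Iff.rfl⟩
  have hout : ∀ e, N.leftFace e = N.outer → Ψ e = 0 ∨ Ψ e = r := by
    intro e he
    obtain ⟨k, hk, rfl⟩ := exists_outerDart he
    rw [hΨ.outer k hk]
    split_ifs <;> simp
  have hmem : ∀ e, N.leftFace e ∈ I ↔ y ≤ Ψ e ∧ Ψ e < x := by
    intro e
    rw [hI]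
    constructor
    · rintro ⟨f, hf, ho, h⟩
      have := mem_of_leftFace_eq (N := N)
        (J := {e | N.leftFace e ≠ N.outer ∧ y ≤ Ψ e ∧ Ψ e < x})
        (fun e he => ⟨by rw [leftFace_next]; exact he.1, by rw [hΨ.inner e he.1]; exact he.2⟩)
        hf ⟨hf ▸ ho, h⟩
      exact this.2
    · intro h
      refine ⟨e, rfl, fun ho => ?_, h⟩
      rcases hout e ho with h' | h' <;> linarith [h.1, h.2]
  refine ⟨I, ?_, ?_, fun d => ?_⟩
  · obtain ⟨d, hd⟩ := hyΨ
    exact ⟨N.leftFace d, (hmem d).2 ⟨hd.ge, by linarith⟩⟩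
  · intro h
    have : N.leftFace N.base ∈ I := h
    rw [hI] at this
    obtain ⟨_, _, h', _⟩ := this
    exact h' rfl
  · have h1 := congrFun hP d
    have h2 := congrFun hQ d
    simp only [rchain, level] at h1 h2
    rw [← @Int.cast_inj ℝ]
    push_cast
    rw [h1, h2]
    simp only [rightFace, hmem]
    have aux : ∀ a : ℝ, (if y ≤ a ∧ a < x then (1 : ℝ) else 0) =
        (if y ≤ a then 1 else 0) - (if x ≤ a then 1 else 0) := by
      intro a
      rcases lt_or_ge a y with h3 | h3
      · rw [if_neg (by grind), if_neg (by linarith), if_neg (by linarith)]; norm_num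
      rcases lt_or_ge a x with h4 | h4
      · rw [if_pos ⟨h3, h4⟩, if_pos h3, if_neg (by linarith)]; norm_num
      · rw [if_neg (by grind), if_pos h3, if_pos h4]; norm_num
    rw [aux, aux]
    ring

/-- The largest entry of a decreasing list of levels that is at most `y`. -/
def floorLevel : List ℝ → ℝ → ℝ
  | [], _ => 0
  | x :: l, y => (x - l.headD 0) * (if x ≤ y then 1 else 0) + floorLevel l y

theorem floorLevel_of_le : ∀ {l : List ℝ}, l.Pairwise (· > ·) → ∀ {y : ℝ}, (∀ x ∈ l, x ≤ y) →
    floorLevel l y = l.headD 0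
  | [], _, _, _ => rfl
  | x :: l, hl, y, h => by
    rw [List.pairwise_cons] at hl
    rw [floorLevel, floorLevel_of_le hl.2 fun z hz => h z (by simp [hz]),
      if_pos (h x (by simp))]
    simp

theorem floorLevel_zero {l : List ℝ} (hl : ∀ x ∈ l, 0 < x) : floorLevel l 0 = 0 := by
  induction l with
  | nil => rfl
  | cons x l ih =>
    rw [floorLevel, ih fun y hy => hl y (by simp [hy]), if_neg (not_le.2 (hl x (by simp)))]
    simp

theorem floorLevel_mem {l : List ℝ} (hl : l.Pairwise (· > ·)) {y : ℝ} (hy : y ∈ l) :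
    floorLevel l y = y := by
  induction l with
  | nil => simp at hy
  | cons x l ih =>
    rw [List.pairwise_cons] at hl
    rcases List.mem_cons.1 hy with rfl | hy
    · rw [floorLevel, floorLevel_of_le hl.2 fun z hz => (hl.1 z hz).le]
      simp
    · rw [floorLevel, ih hl.2 hy, if_neg (not_le.2 (hl.1 y hy))]
      simp

/-- Each level is paired with its level path, weighted by the gap to the next lower level (the
default zero below the last). The gaps telescope to `floorLevel`. Higher levels bound smaller
regions next to the arc, so a decreasing list runs from left to right. -/
theorem IsPotential.exists_decomposition {f : D → ℝ} {p q : ℕ} {r : ℝ} {Ψ : D → ℝ}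
    (hΨ : N.IsPotential f p q r Ψ) (hpq : p ≤ q) (hq : q < N.period)
    (hne : N.tail (N.outerDart p) ≠ N.tail (N.outerDart q))
    (hac : ∀ d, 0 < f d → ¬ N.Reaches (pos f) (N.head d) (N.tail d)) (l : List ℝ)
    (hl : l.Pairwise (· > ·)) (hl' : ∀ x ∈ l, 0 < x ∧ x ≤ r ∧ ∃ d, Ψ d = x) :
    ∃ L : List (List D × ℝ),
      (∀ a ∈ L, N.IsSimplePath (N.tail (N.outerDart p)) a.1 (N.tail (N.outerDart q)) ∧ 0 < a.2) ∧
      L.Pairwise (fun a b => N.LeftOf a.1 b.1) ∧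
      (∀ a ∈ L, ∃ x ∈ l, N.rchain a.1 = N.level Ψ x) ∧
      ∀ d, (L.map (fun a => a.2 * (N.chain a.1 d : ℝ))).sum =
        floorLevel l (Ψ d) - floorLevel l (Ψ (N.rev d)) := by
  induction l with
  | nil => exact ⟨[], by simp, by simp, by simp, by simp [floorLevel]⟩
  | cons x l ih =>
    rw [List.pairwise_cons] at hl
    obtain ⟨L, h1, h2, h3, h4⟩ := ih hl.2 fun y hy => hl' y (by simp [hy])
    obtain ⟨hx0, hxr, -⟩ := hl' x (by simp)
    obtain ⟨P, hP, hPx⟩ := hΨ.exists_level_path hpq hq hne hac hx0 hxr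
    refine ⟨(P, x - l.headD 0) :: L, ?_, ?_, ?_, ?_⟩
    · intro a ha
      rcases List.mem_cons.1 ha with rfl | ha
      · refine ⟨hP, ?_⟩
        cases l with
        | nil => simpa using hx0
        | cons y l => simpa using hl.1 y (by simp)
      · exact h1 a ha
    · refine List.pairwise_cons.2 ⟨fun a ha => ?_, h2⟩
      obtain ⟨y, hy, hay⟩ := h3 a ha
      obtain ⟨hy0, -, hyΨ⟩ := hl' y (by simp [hy])
      exact hΨ.leftOf hy0 (hl.1 y hy) hxr hyΨ hPx hay
    · intro a ha
      rcases List.mem_cons.1 ha with rfl | ha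
      · exact ⟨x, by simp, hPx⟩
      · obtain ⟨y, hy, hay⟩ := h3 a ha
        exact ⟨y, by simp [hy], hay⟩
    · intro d
      have h5 := congrFun hPx d
      simp only [rchain, level] at h5
      rw [List.map_cons, List.sum_cons, h4 d, h5, floorLevel, floorLevel]
      ring

theorem IsLeftmostMaxFlow.acyclic {A : Set D} {c f : D → ℝ} {u v : V} (hc : ∀ d, 0 ≤ c d)
    (hcw : N.NoResidualClockwise A c) (hf : N.IsLeftmostMaxFlow A c u v f) {d : D}
    (hd : 0 < f d) : ¬ N.Reaches (pos f) (N.head d) (N.tail d) :=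
  acyclic_of_noResidualClockwise hc hcw hf.2 hf.1.1.anti hf.1.1.2.1 (fun _ h => hf.1.1.mem h) hd

theorem IsLeftmostMaxFlow.support {A : Set D} {c f : D → ℝ} {u v : V} (huv : u ≠ v)
    (hc : ∀ d, 0 ≤ c d) (hcw : N.NoResidualClockwise A c)
    (hf : N.IsLeftmostMaxFlow A c u v f) {d : D} (hd : 0 < f d) :
    N.Reaches (pos f) u (N.tail d) ∧ N.Reaches (pos f) (N.head d) v :=
  support_reaches hf.1.1.anti huv hf.1.single.1.2.2.1 (hf.1.value_nonneg hc)
    (fun _ => hf.acyclic hc hcw) hd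

theorem IsLeftmostMaxFlow.exists_decomposition {A : Set D} {c f : D → ℝ} {i j : Fin m}
    (hij : i ≤ j) (hc : ∀ d, 0 ≤ c d) (hcw : N.NoResidualClockwise A c)
    (hf : N.IsLeftmostMaxFlow A c (N.s i) (N.t j) f) :
    ∃ L, N.IsPathDecomposition f (N.s i) (N.t j) L := by
  have hfl := hf.1.single.1
  obtain ⟨Ψ, hΨ⟩ := hfl.exists_potential hij
  have hb := hΨ.bounds (hf.1.value_nonneg hc) hcw hf.2 hc hfl.2.1 (fun _ h => hfl.mem h)
  -- With all positive values of the potential as levels, `floorLevel` reproduces the potential.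
  set l := ((Finset.univ.image Ψ).filter (0 < ·)).sort (· ≥ ·) with hl
  have hmem : ∀ x, x ∈ l ↔ (∃ d, Ψ d = x) ∧ 0 < x := by
    intro x; rw [hl, Finset.mem_sort]; simp
  have hsort : l.Pairwise (· > ·) := Finset.sortedGT_sort _ |>.pairwise
  obtain ⟨L, h1, h2, -, h4⟩ := hΨ.exists_decomposition (src_lt_sink_of_le hij).le (sinkPos_lt j)
    (s_ne_t i j) (fun _ => hf.acyclic hc hcw) l hsort (by
      intro x hx
      obtain ⟨⟨d, rfl⟩, h0⟩ := (hmem x).1 hx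
      exact ⟨h0, (hb d).2, d, rfl⟩)
  refine ⟨L, h1, h2, fun d => ?_⟩
  have hfloor : ∀ d, floorLevel l (Ψ d) = Ψ d := by
    intro d
    rcases (hb d).1.eq_or_lt with h | h
    · rw [← h, floorLevel_zero fun x hx => ((hmem x).1 hx).2]
    · exact floorLevel_mem hsort ((hmem _).2 ⟨⟨d, rfl⟩, h⟩)
  rw [h4, hfloor, hfloor, hΨ.eq]

/-! ### Augmentation and residual paths -/

theorem sum_netIn_pair {f : D → ℝ} (hf : N.Anti f) {u v : V} (huv : u ≠ v)
    (h0 : ∀ x, x ∉ ({u, v} : Set V) → N.netIn f x = 0) (W : Set V) :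
    ∑ x with x ∈ W, N.netIn f x =
      (if v ∈ W then N.netIn f v else 0) - (if u ∈ W then N.netIn f v else 0) := by
  have hu := netIn_source hf huv h0
  have h : ∀ x, N.netIn f x = (if x = v then N.netIn f v else 0) -
      (if x = u then N.netIn f v else 0) := by
    intro x
    by_cases h1 : x = v
    · subst h1; simp [huv.symm]
    by_cases h2 : x = u
    · subst h2; simp [huv, hu]
    · rw [h0 x (by simp [h1, h2])]; simp [h1, h2]
  rw [Finset.sum_congr rfl fun x _ => h x, Finset.sum_sub_distrib, Finset.sum_ite_eq',
    Finset.sum_ite_eq']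
  simp

/-- Augmenting from `u` to `v` creates no residual path between two vertices `x` and `y` if there
was none from `x` to `y` and `v`, or none from `x` and `u` to `y`. -/
theorem IsMaxFlow.not_reaches_of_not_reaches {A B : Set D} {c f : D → ℝ} (hc : ∀ d, 0 ≤ c d)
    {u v : V} (huv : u ≠ v) (hf : N.IsMaxFlow A {u} {v} c f) (hAB : ∀ d, 0 < f d → d ∈ B)
    {x y : V} (hxy : ¬ N.Reaches (res B c) x y)
    (h : ¬ N.Reaches (res B c) x v ∨ ¬ N.Reaches (res B c) u y) :
    ¬ N.Reaches (res B (c - f)) x y := by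
  intro hr
  obtain ⟨hfl, -⟩ := hf.single
  have hv := hf.value_nonneg hc
  have hres : ∀ d, 0 < f d → d ∈ res B c := fun d hd => ⟨hAB d hd, hd.trans_le (hfl.2.1 d)⟩
  rcases h with h | h
  · set X : Set V := {z | N.Reaches (res B c) x z}
    obtain ⟨d, hd, h1, h2, -, -⟩ := hr.exists_exit (W := X) (Reaches.refl x) hxy
    -- Flow darts are residual, so no flow leaves `X`. As `v` is outside, balance excludes flow into
    -- `X` too, and capacities across the boundary of `X` do not change.
    have h3 := enter_eq_zero hfl.anti (W := Xᶜ) (fun e he h4 h5 =>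
      h4 (Reaches.trans h5 (Reaches.dart (hres e he)))) (by
        rw [sum_netIn_pair hfl.anti huv hfl.2.2.1, if_pos (show v ∈ Xᶜ from h)]
        split_ifs <;> linarith) h2 (not_not.2 h1)
    have h4 := hd.2
    simp only [Pi.sub_apply, h3, sub_zero] at h4
    exact h2 (Reaches.trans h1 (Reaches.dart ⟨hd.1, h4⟩))
  · set Y : Set V := {z | N.Reaches (res B c) z y}
    obtain ⟨d, hd, h1, h2, -, -⟩ := hr.exists_exit (W := Yᶜ) hxy (not_not.2 (Reaches.refl y))
    have h2' : N.head d ∈ Y := not_not.1 h2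
    have h3 := enter_eq_zero hfl.anti (W := Y) (fun e he h4 =>
      Reaches.trans (Reaches.dart (hres e he)) h4) (by
        rw [sum_netIn_pair hfl.anti huv hfl.2.2.1, if_neg (show u ∉ Y from h)]
        split_ifs <;> linarith) h2' h1
    have h4 := hd.2
    simp only [Pi.sub_apply, h3, sub_zero] at h4
    exact h1 (Reaches.trans (Reaches.dart ⟨hd.1, h4⟩) h2')

/-- All darts into the set `W` of vertices that are not residually reachable from `S` are saturated,
and the value of any flow is what it sends across them. -/
theorem isMaxFlow_of_not_reaches {S T : Finset V} {c f : D → ℝ}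
    (hf : N.IsFlow Set.univ (↑S ∪ ↑T) c f)
    (h : ∀ u ∈ S, ∀ v ∈ T, ¬ N.Reaches {d | 0 < (c - f) d} u v) :
    N.IsMaxFlow Set.univ S T c f := by
  refine ⟨hf, fun g hg => ?_⟩
  obtain ⟨W, hW⟩ : ∃ W : Set V, ∀ v, v ∈ W ↔ ¬ ∃ u ∈ S, N.Reaches {d | 0 < (c - f) d} u v :=
    ⟨{v | _}, fun _ => Iff.rfl⟩
  have key : ∀ g, N.IsFlow Set.univ (↑S ∪ ↑T) c g →
      ∑ v ∈ T, N.netIn g v = ∑ d with N.head d ∈ W ∧ N.tail d ∉ W, g d := by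
    intro g hg
    rw [← N.sum_netIn hg.anti W]
    refine Finset.sum_subset ?_ ?_
    · intro v hv
      simp only [Finset.mem_filter, Finset.mem_univ, true_and, hW]
      rintro ⟨u, hu, hr⟩
      exact h u hu v hv hr
    · intro v hv hvT
      refine hg.2.2.1 v ?_
      rintro (h1 | h1)
      · simp only [Finset.mem_filter, Finset.mem_univ, true_and, hW] at hv
        exact hv ⟨v, h1, Reaches.refl v⟩
      · exact hvT h1
  rw [key f hf, key g hg]
  refine Finset.sum_le_sum fun d hd => ?_
  simp only [Finset.mem_filter, Finset.mem_univ, true_and] at hd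
  obtain ⟨h1, h2⟩ := hd
  rw [hW] at h1 h2
  obtain ⟨u, hu, hr⟩ := not_not.1 h2
  have h3 : ¬ 0 < (c - f) d := fun h3 =>
    h1 ⟨u, hu, hr.trans (Reaches.dart (A := {d | 0 < (c - f) d}) h3)⟩
  simp only [Pi.sub_apply, not_lt] at h3
  have := hg.2.1 d
  linarith

/-! ### The double loop -/

/-- The pairs of the double loop with sink `j` from source `i` on. -/
def rowFrom (i j : Fin m) : List (Fin m × Fin m) :=
  ((List.finRange m).filter (fun a => a ≤ i)).reverse.map (fun a => (a, j))

/-- The pairs of the double loop that correspond to a list of source-sink pairs. -/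
def block (pairs : List (Fin m × Fin m)) : List (Fin m × Fin m) :=
  pairs.flatMap (fun p => rowFrom p.1 p.2)

theorem doubleLoop_eq_block :
    doubleLoop m = block ((List.finRange m).map (fun i => (i, i))) := by
  simp only [doubleLoop, block, rowFrom, List.flatMap_map]

/-- The order in which the double loop runs through the pairs. -/
def Before (p q : Fin m × Fin m) : Prop := p.2 < q.2 ∨ (p.2 = q.2 ∧ q.1 < p.1)

theorem mem_rowFrom {i j : Fin m} {p : Fin m × Fin m} :
    p ∈ rowFrom i j ↔ p.1 ≤ i ∧ p.2 = j := by
  simp only [rowFrom, List.mem_map, List.mem_reverse, List.mem_filter, List.mem_finRange,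
    true_and, decide_eq_true_eq]
  constructor
  · rintro ⟨a, h, rfl⟩; exact ⟨h, rfl⟩
  · rintro ⟨h, rfl⟩; exact ⟨p.1, h, rfl⟩

theorem pairwise_rowFrom (i j : Fin m) : (rowFrom i j).Pairwise Before := by
  rw [rowFrom, List.pairwise_map, List.pairwise_reverse]
  exact ((List.pairwise_lt_finRange m).filter _).imp fun h => Or.inr ⟨rfl, h⟩

theorem mem_doubleLoop {p : Fin m × Fin m} : p ∈ doubleLoop m ↔ p.1 ≤ p.2 := by
  rw [doubleLoop_eq_block]
  simp only [block, List.mem_flatMap, List.mem_map, List.mem_finRange, true_and]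
  constructor
  · rintro ⟨_, ⟨a, rfl⟩, h⟩
    obtain ⟨h1, h2⟩ := mem_rowFrom.1 h
    exact h2 ▸ h1
  · intro h
    exact ⟨(p.2, p.2), ⟨p.2, rfl⟩, mem_rowFrom.2 ⟨h, rfl⟩⟩

theorem pairwise_doubleLoop : (doubleLoop m).Pairwise Before := by
  rw [doubleLoop_eq_block, block, List.pairwise_flatMap]
  constructor
  · intro p _; exact pairwise_rowFrom _ _
  · rw [List.pairwise_map]
    refine (List.pairwise_lt_finRange m).imp fun {a b} h => ?_
    intro x hx y hy
    left
    rw [(mem_rowFrom.1 hx).2, (mem_rowFrom.1 hy).2]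
    exact h

theorem doubleLoop_split {done todo : List (Fin m × Fin m)} {p : Fin m × Fin m}
    (h : doubleLoop m = done ++ p :: todo) :
    (∀ q, q ∈ done ↔ q.1 ≤ q.2 ∧ Before q p) ∧ (∀ q, q ∈ todo ↔ q.1 ≤ q.2 ∧ Before p q) ∧
      p.1 ≤ p.2 := by
  have hpw := pairwise_doubleLoop (m := m)
  rw [h, List.pairwise_append, List.pairwise_cons] at hpw
  obtain ⟨-, ⟨h1, -⟩, h2⟩ := hpw
  have hmem : ∀ q : Fin m × Fin m, q.1 ≤ q.2 ↔ q ∈ done ∨ q = p ∨ q ∈ todo := by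
    intro q
    rw [← mem_doubleLoop, h]; simp
  have hirr : ∀ q q' : Fin m × Fin m, Before q q' → q = q' → False := by
    rintro q _ hq rfl
    rcases hq with hq | hq
    exacts [lt_irrefl _ hq, lt_irrefl _ hq.2]
  have hasymm : ∀ q q' : Fin m × Fin m, Before q q' → Before q' q → False := by
    intro q q' ha hb
    unfold Before at ha hb
    omega
  refine ⟨fun q => ⟨fun hq => ⟨(hmem q).2 (Or.inl hq), h2 q hq p (by simp)⟩, ?_⟩,
    fun q => ⟨fun hq => ⟨(hmem q).2 (Or.inr (Or.inr hq)), h1 q hq⟩, ?_⟩,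
    (hmem p).2 (Or.inr (Or.inl rfl))⟩
  · rintro ⟨hq, hb⟩
    rcases (hmem q).1 hq with hq | hq | hq
    · exact hq
    · exact (hirr _ _ hb hq).elim
    · exact (hasymm _ _ hb (h1 q hq)).elim
  · rintro ⟨hq, hb⟩
    rcases (hmem q).1 hq with hq | hq | hq
    · exact (hasymm _ _ hb (h2 q hq p (by simp))).elim
    · exact (hirr _ _ hb hq.symm).elim
    · exact hq

/-- The invariant of the double loop after the pairs of `done`. -/
structure LoopInv (N : BoundaryNetwork V D m) (done : List (Fin m × Fin m)) (c : D → ℝ) :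
    Prop where
  nonneg : ∀ d, 0 ≤ c d
  noClockwise : N.NoResidualClockwise Set.univ c
  noPath : ∀ a b, (b < a ∨ (a, b) ∈ done) → ¬ N.Reaches (res Set.univ c) (N.s a) (N.t b)

theorem LoopInv.step {done todo : List (Fin m × Fin m)} {i j : Fin m} {c f : D → ℝ}
    (hdl : doubleLoop m = done ++ (i, j) :: todo) (h : N.LoopInv done c)
    (hf : N.IsLeftmostMaxFlow Set.univ c (N.s i) (N.t j) f) :
    N.LoopInv (done ++ [(i, j)]) (c - f) := by
  obtain ⟨hdone, -, hij⟩ := doubleLoop_split hdl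
  refine ⟨fun d => ?_, hf.2, fun a b hab => ?_⟩
  · have := hf.1.single.1.2.1 d
    simp only [Pi.sub_apply]; linarith
  by_cases hnew : a = i ∧ b = j
  · obtain ⟨rfl, rfl⟩ := hnew
    exact hf.1.not_reaches (fun _ _ => Set.mem_univ _) (by simp) (by simpa using s_ne_t a b) (by simp)
  have hab' : b < a ∨ (a, b) ∈ done := by
    simp only [List.mem_append, List.mem_singleton, Prod.mk.injEq] at hab
    tauto
  refine hf.1.not_reaches_of_not_reaches h.nonneg (s_ne_t i j) (fun _ _ => Set.mem_univ _)
    (h.noPath a b hab') ?_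
  -- If `b < j`, the pair `(i, b)` is already without residual path; if `b ≥ j`, the pair `(a, j)`
  -- is. This is where the order of the double loop matters.
  have key : (j < a ∨ (a, j) ∈ done) ∨ (b < i ∨ (i, b) ∈ done) := by
    simp only [hdone, Before, lt_self_iff_false, true_and, false_or] at hab' hij ⊢
    omega
  exact key.imp (h.noPath a j) (h.noPath i b)

theorem LoopRun.inv {done ℓ after : List (Fin m × Fin m)} {c c' : D → ℝ}
    {tr : List (Augmentation D m)} (hr : N.LoopRun ℓ c tr c')
    (hdl : doubleLoop m = done ++ ℓ ++ after) (h : N.LoopInv done c) :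
    N.LoopInv (done ++ ℓ) c' := by
  induction hr generalizing done with
  | nil c => simpa using h
  | cons i j rest c f c' tr hf _ ih =>
    have h1 := h.step (todo := rest ++ after) (by rw [hdl]; simp) hf
    have h2 := ih (done := done ++ [(i, j)]) (by rw [hdl]; simp) h1
    simpa using h2

theorem LoopRun.append {ℓ₁ ℓ₂ : List (Fin m × Fin m)} {c c' : D → ℝ}
    {tr : List (Augmentation D m)} (hr : N.LoopRun (ℓ₁ ++ ℓ₂) c tr c') :
    ∃ tr₁ tr₂ c₁, tr = tr₁ ++ tr₂ ∧ N.LoopRun ℓ₁ c tr₁ c₁ ∧ N.LoopRun ℓ₂ c₁ tr₂ c' := by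
  induction ℓ₁ generalizing c tr with
  | nil => exact ⟨[], tr, c, rfl, LoopRun.nil c, hr⟩
  | cons p ℓ₁ ih =>
    cases hr with
    | cons i j _ _ f _ tr hf hr =>
      obtain ⟨tr₁, tr₂, c₁, rfl, h1, h2⟩ := ih hr
      exact ⟨_, tr₂, c₁, rfl, LoopRun.cons i j _ c f c₁ tr₁ hf h1, h2⟩

theorem LoopRun.final {ℓ : List (Fin m × Fin m)} {c c' : D → ℝ}
    {tr : List (Augmentation D m)} (hr : N.LoopRun ℓ c tr c') :
    c' = c - (tr.map (fun a => a.flow)).sum := by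
  induction hr with
  | nil c => simp
  | cons i j rest c f c' tr hf _ ih => rw [ih]; simp [sub_sub]

theorem LoopRun.mem {ℓ : List (Fin m × Fin m)} {c c' : D → ℝ}
    {tr : List (Augmentation D m)} (hr : N.LoopRun ℓ c tr c') :
    ∀ a ∈ tr, (a.source, a.sink) ∈ ℓ := by
  induction hr with
  | nil c => simp
  | cons i j rest c f c' tr hf _ ih =>
    intro a ha
    rcases List.mem_cons.1 ha with rfl | ha
    · simp
    · exact List.mem_cons_of_mem _ (ih a ha)

theorem exists_loopRun (ℓ : List (Fin m × Fin m)) {c : D → ℝ} (hc : ∀ d, 0 ≤ c d) :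
    ∃ tr c', N.LoopRun ℓ c tr c' := by
  induction ℓ generalizing c with
  | nil => exact ⟨[], c, LoopRun.nil c⟩
  | cons p ℓ ih =>
    obtain ⟨f, hf, hf'⟩ := exists_leftmost (N := N) (A := Set.univ) (fun _ _ => Set.mem_univ _)
      {N.s p.1} {N.t p.2} hc
    obtain ⟨tr, c', h⟩ := ih (c := c - f) fun d => by
      have := hf.single.1.2.1 d
      simp only [Pi.sub_apply]; linarith
    exact ⟨_, c', LoopRun.cons p.1 p.2 ℓ c f c' tr ⟨hf, hf'⟩ h⟩

theorem LoopRun.netIn_sum {ℓ : List (Fin m × Fin m)} {c c' : D → ℝ}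
    {tr : List (Augmentation D m)} (hr : N.LoopRun ℓ c tr c') :
    N.Anti (tr.map (fun a => a.flow)).sum ∧
      ∀ v, v ∉ (↑N.sources ∪ ↑N.sinks : Set V) → N.netIn (tr.map (fun a => a.flow)).sum v = 0 := by
  induction hr with
  | nil c => exact ⟨Anti.zero, fun v _ => N.netIn_zero v⟩
  | cons i j rest c f c' tr hf _ ih =>
    rw [List.map_cons, List.sum_cons]
    refine ⟨hf.1.1.anti.add ih.1, fun v hv => ?_⟩
    rw [netIn_add, ih.2 v hv, hf.1.single.1.2.2.1 v, add_zero]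
    rintro (rfl | h)
    · exact hv (Or.inl (by simp [sources]))
    · rw [Set.mem_singleton_iff] at h
      subst h
      exact hv (Or.inr (by simp [sinks]))

theorem res_univ {E : Type*} (c : E → ℝ) : res Set.univ c = {d | 0 < c d} := by
  ext d; simp [res]

theorem IsInitialSaturation.loopInv {c f₀ : D → ℝ} (h : N.IsInitialSaturation c f₀) :
    N.LoopInv [] (c - f₀) := by
  refine ⟨fun d => ?_, h.2.2, fun a b hab => ?_⟩
  · have := h.1.2.1 d
    simp only [Pi.sub_apply]; linarith
  · rw [res_univ]
    refine h.2.1 b a ?_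
    simpa using hab

/-- A leftmost maximum flow from all sources to all sinks leaves no residual path between any source
and any sink, which is more than needed. -/
theorem exists_initialSaturation {c : D → ℝ} (hc : ∀ d, 0 ≤ c d) :
    ∃ f₀, N.IsInitialSaturation c f₀ := by
  obtain ⟨f, hf, hf'⟩ := exists_leftmost (N := N) (A := Set.univ) (fun _ _ => Set.mem_univ _)
    N.sources N.sinks hc
  refine ⟨f, hf.1, fun i j _ => ?_, hf'⟩
  rw [← res_univ]
  refine hf.not_reaches (fun _ _ => Set.mem_univ _) (by simp [sources]) ?_ (by simp [sinks])
  simp only [sinks, Finset.mem_image, Finset.mem_univ, true_and, not_exists]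
  exact fun a h => s_ne_t _ _ h.symm

/-- The double loop ends with a maximum flow. -/
theorem AbstractFlow.isMaxFlow {c f₀ cEnd : D → ℝ} {tr : List (Augmentation D m)}
    (h : N.AbstractFlow c f₀ tr cEnd) : total f₀ tr = c - cEnd ∧
      N.IsMaxFlow Set.univ N.sources N.sinks c (total f₀ tr) := by
  obtain ⟨h0, hr⟩ := h
  have hfin := hr.final
  have htot : total f₀ tr = c - cEnd := by rw [hfin, total]; abel
  have hinv := hr.inv (done := []) (after := []) (by simp) h0.loopInv
  refine ⟨htot, isMaxFlow_of_not_reaches ⟨?_, ?_, ?_, fun d hd => absurd trivial hd⟩ ?_⟩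
  · exact h0.1.anti.add hr.netIn_sum.1
  · intro d
    rw [htot]
    have := hinv.nonneg d
    simp only [Pi.sub_apply]; linarith
  · intro v hv
    rw [total, netIn_add, h0.1.2.2.1 v hv, hr.netIn_sum.2 v hv, add_zero]
  · intro u hu v hv
    simp only [sources, sinks, Finset.mem_image, Finset.mem_univ, true_and] at hu hv
    obtain ⟨a, rfl⟩ := hu
    obtain ⟨b, rfl⟩ := hv
    rw [htot, sub_sub_cancel, ← res_univ]
    refine hinv.noPath a b ?_
    simp only [List.nil_append, mem_doubleLoop]
    exact lt_or_ge _ _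

/-! ### Flows to the left of a flow path -/

/-- For two paths one of which is left of the other, the chains differ by at most one on each dart.
So no path uses a dart against another path, and the contributions do not cancel. -/
theorem IsPathDecomposition.pos {f : D → ℝ} {u v : V} {L : List (List D × ℝ)}
    (hL : N.IsPathDecomposition f u v L) {q : List D × ℝ} (hq : q ∈ L) {d : D} (hd : d ∈ q.1) :
    0 < f d := by
  obtain ⟨h1, h2, h3⟩ := hL
  have hone : N.rchain q.1 d = 1 :=
    rchain_eq_one (h1 q hq).1.nodup hd ((h1 q hq).1.rev_notMem hd)
  have hone' : N.chain q.1 d = 1 := by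
    have : (N.chain q.1 d : ℝ) = 1 := hone
    exact_mod_cast this
  have key : ∀ r ∈ L, 0 ≤ r.2 * (N.chain r.1 d : ℝ) := by
    intro r hr
    have : Std.Symm fun q r : List D × ℝ => q = r ∨ N.LeftOf q.1 r.1 ∨ N.LeftOf r.1 q.1 :=
      ⟨fun x y h => by rcases h with h | h | h <;> simp [h]⟩
    have hsym := List.Pairwise.forall_of_forall
      (R := fun q r : List D × ℝ => q = r ∨ N.LeftOf q.1 r.1 ∨ N.LeftOf r.1 q.1) (l := L)
      (fun x _ => Or.inl rfl) (h2.imp fun h => Or.inr (Or.inl h)) hq hr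
    refine mul_nonneg (h1 r hr).2.le ?_
    have : 0 ≤ N.chain r.1 d := by
      rcases hsym with rfl | ⟨I, -, -, hI⟩ | ⟨I, -, -, hI⟩
      · omega
      all_goals
        have := hI d
        simp only at this
        split_ifs at this <;> omega
    exact_mod_cast this
  rw [h3 d]
  refine lt_of_lt_of_le ?_ (List.single_le_sum (fun x hx => by
    obtain ⟨r, hr, rfl⟩ := List.mem_map.1 hx
    exact key r hr) _ (List.mem_map.2 ⟨q, hq, rfl⟩))
  rw [hone']
  simpa using (h1 q hq).2

/-- Flow paths cannot be reached from later sources. -/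
theorem LoopInv.not_reaches_path {done : List (Fin m × Fin m)} {i j : Fin m} {c f : D → ℝ}
    (h : N.LoopInv done c) (hf : N.IsLeftmostMaxFlow Set.univ c (N.s i) (N.t j) f)
    {P : List D} (hP : N.IsSimplePath (N.s i) P (N.t j)) (hpos : ∀ d ∈ P, 0 < f d)
    {a : Fin m} (ha : j < a) {x : V} (hx : x ∈ N.s i :: P.map N.head) :
    ¬ N.Reaches (res Set.univ (c - f)) (N.s a) x := by
  obtain ⟨T, hT⟩ : ∃ T : Set V, ∀ v, v ∈ T ↔ N.Reaches (res Set.univ c) v (N.t j) :=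
    ⟨{v | _}, fun _ => Iff.rfl⟩
  have hc : ∀ d, 0 < c d → N.head d ∈ T → N.tail d ∈ T := fun d hd h' =>
    (hT _).2 ((Reaches.dart (A := res Set.univ c) ⟨Set.mem_univ _, hd⟩).trans ((hT _).1 h'))
  have hPT : ∀ y ∈ N.s i :: P.map N.head, y ∈ T := fun y hy => (hT y).2
    (hP.1.reaches_mem (fun d hd => hf.1.1.mem_res (hpos d hd)) hy).2
  have hsi : N.s i ∈ T := hPT _ (by simp)
  have hti : N.t j ∈ T := (hT _).2 (Reaches.refl _)
  -- `T` contains both ends of the flow and is closed backwards under residual darts, so the flow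
  -- does not cross its boundary. Hence a residual dart into `T` afterwards was residual before.
  have hzero : ∀ d, N.head d ∈ T → N.tail d ∉ T → f d = 0 := fun d h1 h2 => by
    refine enter_eq_zero hf.1.1.anti (W := T) (fun e he => hc e (lt_of_lt_of_le he (hf.1.1.2.1 e)))
      ?_ h1 h2
    rw [sum_netIn_pair hf.1.1.anti (s_ne_t i j) hf.1.single.1.2.2.1 T]
    simp [hsi, hti]
  intro hr
  refine h.noPath a j (Or.inl ha) ((hT _).1 ?_)
  by_contra hsa
  obtain ⟨d, hd, h1, h2, -⟩ := hr.exists_exit (W := Tᶜ) hsa (by simpa using hPT x hx)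
  have h2' : N.head d ∈ T := by simpa using h2
  have := hzero d h2' h1
  have hd' : 0 < (c - f) d := hd.2
  simp only [Pi.sub_apply, this, sub_zero] at hd'
  exact h1 (hc d hd' h2')

/-- A path along which a flow was found, with the residual capacities `c₁` afterwards. -/
structure FlowPath (N : BoundaryNetwork V D m) (i j : Fin m) (c₁ : D → ℝ) (P : List D)
    (Θ : D → ℝ) : Prop where
  path : N.IsSimplePath (N.s i) P (N.t j)
  potential : N.IsPotential (N.rchain P) (N.srcPos i) (N.sinkPos j) 1 Θ
  zero_or_one : ∀ d, Θ d = 0 ∨ Θ d = 1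
  nonneg : ∀ d, 0 ≤ c₁ d
  noClockwise : N.NoResidualClockwise Set.univ c₁
  not_reaches : ∀ a, j < a → ∀ x ∈ N.s i :: P.map N.head,
    ¬ N.Reaches (res Set.univ c₁) (N.s a) x
  rev_residual : ∀ d ∈ P, 0 < c₁ (N.rev d)

/-- What the later flows preserve; `γ` is the amount sent from sources up to `i`, and `Ψ` is a
potential of the sum of the later flows. -/
structure LeftState (N : BoundaryNetwork V D m) (i j : Fin m) (c₁ Θ c : D → ℝ) (γ : ℝ)
    (Ψ : D → ℝ) : Prop where
  eq : ∀ d, c₁ d - c d = Ψ d - Ψ (N.rev d)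
  nonneg : ∀ d, 0 ≤ c d
  noClockwise : N.NoResidualClockwise Set.univ c
  left : ∀ d, Θ d = 1 → γ ≤ Ψ d
  source_le : ∀ a ≤ i, Ψ (N.outerDart (N.srcPos a)) ≤ γ
  jump : ∀ d, Ψ d < Ψ (N.next d) →
    ∃ a, N.next d = N.outerDart (N.srcPos a) ∧ (a ≤ i ∨ j < a)

theorem FlowPath.mem_of_side {i j : Fin m} {c₁ : D → ℝ} {P : List D} {Θ : D → ℝ}
    (h : N.FlowPath i j c₁ P Θ) {d : D} (h1 : Θ (N.rev d) = 1) (h0 : Θ d ≠ 1) : N.rev d ∈ P := by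
  refine mem_of_rchain_pos (N := N) ?_
  rw [h.potential.eq, N.rev_rev, h1, (h.zero_or_one d).resolve_right h0]
  norm_num

theorem FlowPath.side {i j : Fin m} {c₁ : D → ℝ} {P : List D} {Θ : D → ℝ}
    (h : N.FlowPath i j c₁ P Θ) {d : D} (hd : d ∈ P) : Θ d = 1 := by
  have h1 := rchain_eq_one (N := N) h.path.nodup hd (h.path.rev_notMem hd)
  rw [h.potential.eq] at h1
  rcases h.zero_or_one d with h0 | h0
  · rcases h.zero_or_one (N.rev d) with h2 | h2 <;> rw [h0, h2] at h1 <;> norm_num at h1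
  · exact h0

/-- The total potential can pass above `γ` around a vertex only at sources beyond `j`, since it is
at most `γ` at the sources up to `i`. The boundary of the region above `γ` thus consists of residual
paths from those later sources, which never reach `P`. So all darts at vertices of `P` are on the
same side of the level, and the boundary dart at `s i` is not above it. -/
theorem FlowPath.le_of_mem {i j : Fin m} {c₁ : D → ℝ} {P : List D} {Θ c : D → ℝ}
    (h : N.FlowPath i j c₁ P Θ) {γ : ℝ} {Ψ : D → ℝ} (hs : N.LeftState i j c₁ Θ c γ Ψ) {d : D}
    (hd : d ∈ P) : Ψ (N.rev d) ≤ γ := by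
  by_contra hlt
  rw [not_le] at hlt
  obtain ⟨J, hJ⟩ : ∃ J : Set D, ∀ e, e ∈ J ↔ γ < Ψ e := ⟨{e | _}, fun _ => Iff.rfl⟩
  set z : D → ℝ := fun e => (if e ∈ J then (1 : ℝ) else 0) - (if N.rev e ∈ J then 1 else 0) with hz
  have hza : N.Anti z := indicator_anti J
  set W : Set V := {x | x ∈ N.s i :: P.map N.head} with hW
  have hjump : ∀ e, e ∉ J → N.next e ∈ J →
      ∃ a, j < a ∧ N.next e = N.outerDart (N.srcPos a) := by
    intro e h1 h2
    rw [hJ] at h1 h2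
    obtain ⟨a, ha, ha'⟩ := hs.jump e (lt_of_le_of_lt (not_lt.1 h1) h2)
    rcases ha' with ha' | ha'
    · rw [ha] at h2
      exact absurd (hs.source_le a ha') (not_le.2 h2)
    · exact ⟨a, ha', ha⟩
  have hG : ∀ e, 0 < z e → 0 < (c₁ - c) e := by
    intro e he
    obtain ⟨h1, h2⟩ := indicator_pos.1 he
    rw [hJ] at h1 h2
    rw [Pi.sub_apply, hs.eq]
    linarith
  have hres : ∀ e, 0 < z e → e ∈ res Set.univ c₁ := fun e he => by
    refine ⟨Set.mem_univ _, ?_⟩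
    have h1 := hG e he
    have h2 := hs.nonneg e
    simp only [Pi.sub_apply] at h1
    linarith
  have hGa : N.Anti (c₁ - c) := fun e => by
    rw [Pi.sub_apply, Pi.sub_apply, hs.eq, hs.eq, N.rev_rev]; ring
  -- The positive part of `z` lies in the acyclic flow `c₁ - c`, so tracing it back ends at a
  -- deficit vertex. There some dart outside `J` is followed by one inside, which happens only at a
  -- source beyond `j`.
  have hfar : ∀ e, 0 < z e → ∃ a, j < a ∧ N.Reaches (res Set.univ c₁) (N.s a) (N.tail e) := by
    intro e he
    rcases flow_back hza he with hcyc | ⟨w, hw, hr⟩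
    · exact absurd (hcyc.mono hG) (acyclic_of_noResidualClockwise (A := Set.univ) (c := c₁)
        h.nonneg h.noClockwise (by rw [sub_sub_cancel]; exact hs.noClockwise) hGa
        (fun e => by
          have := hs.nonneg e
          simp only [Pi.sub_apply]; linarith) (fun _ _ => Set.mem_univ _) (hG e he))
    · have hsum : N.netIn z w = ∑ d with N.head d = w,
          ((if d ∈ J then (1 : ℝ) else 0) - (if N.next d ∈ J then 1 else 0)) :=
        netIn_potential N (fun d => if d ∈ J then (1 : ℝ) else 0) w
      rw [hsum] at hw
      obtain ⟨e', he', h1, h2⟩ : ∃ e', N.head e' = w ∧ e' ∉ J ∧ N.next e' ∈ J := by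
        by_contra! hcon
        refine absurd hw (not_lt.2 (Finset.sum_nonneg fun d hd => ?_))
        have := hcon d (Finset.mem_filter.1 hd).2
        by_cases h1 : d ∈ J
        · rw [if_pos h1]; split_ifs <;> norm_num
        · simp [h1, this h1]
      obtain ⟨a, ha, ha'⟩ := hjump e' h1 h2
      refine ⟨a, ha, ?_⟩
      have hwa : w = N.s a := by rw [← he', ← tail_next, ha', tail_srcPos]
      rw [← hwa]
      exact hr.mono hres
  have hz0 : ∀ e, N.tail e ∈ W → (e ∈ J ↔ N.rev e ∈ J) := by
    intro e he
    constructor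
    · intro h1
      by_contra h2
      obtain ⟨a, ha, hr⟩ := hfar e (indicator_pos.2 ⟨h1, h2⟩)
      exact h.not_reaches a ha _ he hr
    · intro h1
      by_contra h2
      have hp : 0 < z (N.rev e) := indicator_pos.2 ⟨h1, by rwa [N.rev_rev]⟩
      obtain ⟨a, ha, hr⟩ := hfar _ hp
      refine h.not_reaches a ha _ he (hr.trans ?_)
      have := Reaches.dart (N := N) (hres _ hp)
      rwa [head_rev] at this
  have hz0' : ∀ e, N.head e ∈ W → (e ∈ J ↔ N.rev e ∈ J) := fun e he => by
    have := hz0 (N.rev e) he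
    rw [N.rev_rev] at this
    exact this.symm
  have hup : ∀ e, N.head e ∈ W → N.next e ∈ J → e ∈ J := by
    intro e he h1
    by_contra h2
    obtain ⟨a, ha, ha'⟩ := hjump e h2 h1
    refine h.not_reaches a ha _ he ?_
    rw [← tail_next, ha', tail_srcPos]
    exact Reaches.refl _
  -- As `z` vanishes at the vertices of `P`, entries into `J` and exits from it balance around such
  -- a vertex. There are no entries, so there are no exits.
  have hnext : ∀ e, N.head e ∈ W → (N.next e ∈ J ↔ e ∈ J) := by
    intro e he
    refine ⟨hup e he, fun h1 => ?_⟩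
    by_contra h2
    have hsum : N.netIn z (N.head e) = ∑ d with N.head d = N.head e,
        ((if d ∈ J then (1 : ℝ) else 0) - (if N.next d ∈ J then 1 else 0)) :=
      netIn_potential N (fun d => if d ∈ J then (1 : ℝ) else 0) _
    have hzero : N.netIn z (N.head e) = 0 := by
      refine Finset.sum_eq_zero fun d hd => ?_
      have hd' : N.head d ∈ W := by rw [(Finset.mem_filter.1 hd).2]; exact he
      simp only [hz, hz0' d hd', sub_self]
    rw [hzero] at hsum
    have hall := (Finset.sum_eq_zero_iff_of_nonneg (fun d hd => ?_)).1 hsum.symm e (by simp)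
    · simp [h1, h2] at hall
    · have hd' : N.head d ∈ W := by rw [(Finset.mem_filter.1 hd).2]; exact he
      have := hup d hd'
      by_cases h3 : N.next d ∈ J
      · simp [h3, this h3]
      · simp only [h3, if_false, sub_zero]; split_ifs <;> norm_num
  have hinv := Reaches.eq_of_invariant (N := N) (A := {e | e ∈ P}) (W := W) (h := fun e => e ∈ J)
    (fun e he => by
      rw [rot_eq]
      exact propext ((hnext (N.rev e) (by rw [head_rev]; exact he)).trans (hz0 e he).symm))
    (fun e he => ⟨h.path.1.tail_mem he, List.mem_cons_of_mem _ (List.mem_map_of_mem he),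
      propext (hz0 e (h.path.1.tail_mem he)).symm⟩)
    ((h.path.1.reaches_mem (A := {e | e ∈ P}) (fun _ he => he)
      (List.mem_cons_of_mem _ (List.mem_map_of_mem hd))).1) (List.mem_cons_self ..)
    (d := N.outerDart (N.srcPos i)) (e := N.rev d) (tail_srcPos i) rfl
  have hi : N.outerDart (N.srcPos i) ∈ J := by
    rw [show (N.outerDart (N.srcPos i) ∈ J) = (N.rev d ∈ J) from hinv, hJ]
    exact hlt
  rw [hJ] at hi
  exact absurd (hs.source_le i le_rfl) (not_le.2 hi)

/-- The potential is at least `γ` just left of `P` and at most `γ` just right of it. Hence the sum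
of the later flows does not run against `P`, and the reverse capacities are no smaller than at the
start. -/
theorem FlowPath.rev_residual_of_state {i j : Fin m} {c₁ : D → ℝ} {P : List D} {Θ c : D → ℝ}
    (h : N.FlowPath i j c₁ P Θ) {γ : ℝ} {Ψ : D → ℝ} (hs : N.LeftState i j c₁ Θ c γ Ψ) {d : D}
    (hd : d ∈ P) : 0 < c (N.rev d) := by
  have h1 := h.le_of_mem hs hd
  have h2 := hs.left d (h.side hd)
  have h3 := hs.eq (N.rev d)
  rw [N.rev_rev] at h3
  have h4 := h.rev_residual d hd
  linarith

/-- On the left side, deviations from the boundary value `x` occur on finite faces only, so they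
form sets to which `exists_boundary` applies. -/
theorem IsPotential.next_of_side {g : D → ℝ} {p q p' q' : ℕ} {r x : ℝ} {g' Ψ Θ : D → ℝ}
    (hΘ : N.IsPotential g p q 1 Θ) (hΨ : N.IsPotential g' p' q' r Ψ)
    (hx : ∀ k, p ≤ k ∧ k < q → (if p' ≤ k ∧ k < q' then r else 0) = x) {d : D} (h1 : Θ d = 1)
    (h2 : Ψ d ≠ x) : Θ (N.next d) = 1 ∧ Ψ (N.next d) = Ψ d ∧ d ≠ N.base := by
  have key : N.leftFace d ≠ N.outer := by
    intro ho
    obtain ⟨k, hk, rfl⟩ := exists_outerDart ho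
    rw [hΘ.outer k hk] at h1
    rw [hΨ.outer k hk] at h2
    exact h2 (hx k (by by_contra h; simp [h] at h1))
  exact ⟨by rw [hΘ.inner d key, h1], hΨ.inner d key, fun h => key (by rw [h]; rfl)⟩

theorem srcPos_le_srcPos {i j : Fin m} (h : i ≤ j) : N.srcPos i ≤ N.srcPos j := by
  rcases h.eq_or_lt with rfl | h
  · exact le_rfl
  · exact (srcPos_lt_srcPos h).le

theorem sinkPos_le_sinkPos {i j : Fin m} (h : i ≤ j) : N.sinkPos i ≤ N.sinkPos j := by
  rcases h.eq_or_lt with rfl | h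
  · exact le_rfl
  · exact (sinkPos_lt_sinkPos h).le

/-- Left of `P` the potential of the new flow is the constant `ρ`. A region with another value would
be entered across a non-residual dart; but a dart coming from the left side is residual by the sign
of `g`, and one coming across `P` is the reverse of a dart of `P`. -/
theorem FlowPath.step {i j a b : Fin m} {c₁ : D → ℝ} {P : List D} {Θ c g : D → ℝ}
    (h : N.FlowPath i j c₁ P Θ) {γ : ℝ} {Ψ : D → ℝ} (hs : N.LeftState i j c₁ Θ c γ Ψ)
    (hab : a ≤ b) (hg : N.IsLeftmostMaxFlow Set.univ c (N.s a) (N.t b) g)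
    (hty : (a ≤ i ∧ j ≤ b) ∨ (i ≤ j ∧ j < a)) :
    (∃ γ' Ψ', N.LeftState i j c₁ Θ (c - g) γ' Ψ') ∧
      ∀ d, N.StrictlyLeft i j P d → g d = 0 := by
  obtain ⟨Ω, hΩ⟩ := hg.1.single.1.exists_potential hab
  have hr0 := hg.1.value_nonneg hs.nonneg
  set r := N.netIn g (N.t b) with hr
  have hle := hg.1.single.1.2.1
  -- A flow from `a ≤ i` to `b ≥ j` spans the whole boundary stretch from `s i` to `t j` and has
  -- potential `r` there; a flow from `a > j` starts after the stretch and has potential zero.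
  obtain ⟨ρ, hρ, hρs⟩ : ∃ ρ : ℝ, (∀ k, N.srcPos i ≤ k ∧ k < N.sinkPos j →
      (if N.srcPos a ≤ k ∧ k < N.sinkPos b then r else 0) = ρ) ∧
      ∀ a' ≤ i, Ω (N.outerDart (N.srcPos a')) ≤ ρ := by
    rcases hty with ⟨h1, h2⟩ | ⟨h1, h2⟩
    · refine ⟨r, fun k hk => ?_, fun a' _ => ?_⟩
      · exact if_pos ⟨(srcPos_le_srcPos h1).trans hk.1,
          lt_of_lt_of_le hk.2 (sinkPos_le_sinkPos h2)⟩
      · rw [hΩ.outer _ (srcPos_lt a')]; split_ifs <;> simp [hr0]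
    · refine ⟨0, fun k hk => if_neg fun hk' => ?_, fun a' ha' => ?_⟩
      · have := N.sink_lt_src j a h2
        omega
      · rw [hΩ.outer _ (srcPos_lt a'), if_neg]
        intro hk'
        have := srcPos_lt_srcPos (N := N) (lt_of_le_of_lt ha' (lt_of_le_of_lt h1 h2))
        omega
  have hgΩ := hΩ.eq
  have lower : ∀ d, Θ d = 1 → ρ ≤ Ω d := by
    by_contra! hne
    obtain ⟨d, hd⟩ := hne
    obtain ⟨e, h1, h2, h3⟩ := hs.noClockwise.exists_boundary (J := {d | Θ d = 1 ∧ Ω d < ρ})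
      (fun d hd => by
        obtain ⟨h1, h2, -⟩ := h.potential.next_of_side hΩ hρ hd.1 hd.2.ne
        exact ⟨h1, by rw [h2]; exact hd.2⟩)
      (fun hd => (h.potential.next_of_side hΩ hρ hd.1 hd.2.ne).2.2 rfl) ⟨d, hd⟩
    refine h3 ⟨Set.mem_univ _, ?_⟩
    by_cases he : Θ e = 1
    · have h4 : ρ ≤ Ω e := by
        by_contra h4
        exact h2 ⟨he, not_le.1 h4⟩
      have h5 := h1.2
      have := hgΩ e
      have := hle e
      linarith
    · have := h.rev_residual_of_state hs (h.mem_of_side h1.1 he)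
      rwa [N.rev_rev] at this
  -- The lower bound alone carries the invariant over to `c - g`. The upper bound then needs this
  -- new state, as it uses residual darts after the augmentation.
  have hstate : N.LeftState i j c₁ Θ (c - g) (γ + ρ) (Ψ + Ω) := by
    refine ⟨fun d => ?_, fun d => ?_, hg.2, fun d hd => add_le_add (hs.left d hd) (lower d hd),
      fun a' ha' => add_le_add (hs.source_le a' ha') (hρs a' ha'), fun d hd => ?_⟩
    · have := hs.eq d
      have := hgΩ d
      simp only [Pi.sub_apply, Pi.add_apply]; linarith
    · have := hle d
      simp only [Pi.sub_apply]; linarith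
    · by_cases h1 : Ψ d < Ψ (N.next d)
      · exact hs.jump d h1
      · have h2 : Ω d < Ω (N.next d) := by
          simp only [Pi.add_apply] at hd; linarith
        exact ⟨a, (hΩ.jump (sinkPos_lt b) hr0 d).1 h2,
          hty.imp (·.1) (·.2)⟩
  have upper : ∀ d, Θ d = 1 → Ω d ≤ ρ := by
    by_contra! hne
    obtain ⟨d, hd⟩ := hne
    obtain ⟨e, h1, h2, h3⟩ := hg.2.exists_boundary (J := {d | Θ d = 1 ∧ ρ < Ω d})
      (fun d hd => by
        obtain ⟨h1, h2, -⟩ := h.potential.next_of_side hΩ hρ hd.1 hd.2.ne'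
        exact ⟨h1, by rw [h2]; exact hd.2⟩)
      (fun hd => (h.potential.next_of_side hΩ hρ hd.1 hd.2.ne').2.2 rfl) ⟨d, hd⟩
    refine h3 ⟨Set.mem_univ _, ?_⟩
    by_cases he : Θ e = 1
    · have h4 : Ω e ≤ ρ := by
        by_contra h4
        exact h2 ⟨he, not_le.1 h4⟩
      have h5 := h1.2
      have := hgΩ e
      have := hs.nonneg e
      simp only [Pi.sub_apply]; linarith
    · have := h.rev_residual_of_state hstate (h.mem_of_side h1.1 he)
      rwa [N.rev_rev] at this
  refine ⟨⟨_, _, hstate⟩, fun d hd => ?_⟩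
  obtain ⟨h1, h2, h3⟩ := (strictlyLeft_iff h.path h.potential h.zero_or_one d).1 hd
  have h4 : Θ (N.rev d) = 1 := by
    have := rchain_of_nodup (N := N) h.path.nodup d
    rw [h.potential.eq, if_neg h1, if_neg h2] at this
    linarith
  rw [hgΩ, le_antisymm (upper d h3) (lower d h3), le_antisymm (upper _ h4) (lower _ h4), sub_self]

theorem FlowPath.run {i j : Fin m} {c₁ : D → ℝ} {P : List D} {Θ c c' : D → ℝ}
    (h : N.FlowPath i j c₁ P Θ) (hs : ∃ γ Ψ, N.LeftState i j c₁ Θ c γ Ψ)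
    {ℓ : List (Fin m × Fin m)} {tr : List (Augmentation D m)} (hr : N.LoopRun ℓ c tr c')
    (hℓ : ∀ p ∈ ℓ, p.1 ≤ p.2)
    (hty : ∀ x ∈ tr, x.flow ≠ 0 → (x.source ≤ i ∧ j ≤ x.sink) ∨ (i ≤ j ∧ j < x.source)) :
    ∀ x ∈ tr, ∀ d, N.StrictlyLeft i j P d → x.flow d = 0 := by
  induction hr with
  | nil => simp
  | cons a b rest c g c' tr hg _ ih =>
    obtain ⟨γ, Ψ, hs⟩ := hs
    simp only [List.forall_mem_cons] at hℓ hty ⊢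
    by_cases hg0 : g = 0
    · subst hg0
      exact ⟨fun _ _ => rfl, ih ⟨γ, Ψ, by rwa [sub_zero]⟩ hℓ.2 hty.2⟩
    · obtain ⟨h1, h2⟩ := h.step hs hℓ.1 hg (hty.1 hg0)
      exact ⟨h2, ih h1 hℓ.2 hty.2⟩

/-- After a flow from `s i` to `t j` was found, nothing strictly left of one of its paths is used
by later flows, if these are from sources up to `i` to sinks from `j` on, or from sources
beyond `j`. -/
theorem LoopInv.eq_zero_of_strictlyLeft {done todo ℓ : List (Fin m × Fin m)} {i j : Fin m}
    {c f c' : D → ℝ} (hdl : doubleLoop m = done ++ (i, j) :: todo) (h : N.LoopInv done c)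
    (hf : N.IsLeftmostMaxFlow Set.univ c (N.s i) (N.t j) f) {P : List D}
    (hP : N.IsSimplePath (N.s i) P (N.t j)) (hpos : ∀ d ∈ P, 0 < f d)
    {tr : List (Augmentation D m)} (hr : N.LoopRun ℓ (c - f) tr c')
    (hℓ : ∀ p ∈ ℓ, p.1 ≤ p.2)
    (hty : ∀ x ∈ tr, x.flow ≠ 0 → (x.source ≤ i ∧ j ≤ x.sink) ∨ j < x.source) :
    ∀ x ∈ tr, ∀ d, N.StrictlyLeft i j P d → x.flow d = 0 := by
  have hij := (doubleLoop_split hdl).2.2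
  obtain ⟨Θ, hΘ, h01⟩ := IsSimplePath.exists_side (N := N) (src_lt_sink_of_le hij).le
    (sinkPos_lt j) hP
  have h1 := h.step hdl hf
  have hfp : N.FlowPath i j (c - f) P Θ :=
    ⟨hP, hΘ, h01, h1.nonneg, h1.noClockwise,
      fun a ha x hx => h.not_reaches_path hf hP hpos ha hx, fun d hd => by
        have h2 := h.nonneg (N.rev d)
        have h3 := hpos d hd
        have h4 := hf.1.1.anti d
        simp only [Pi.sub_apply]; linarith⟩
  -- Before any later flow, the amount sent and the potential are both zero.
  refine hfp.run ⟨0, 0, fun d => by simp, h1.nonneg, h1.noClockwise, fun _ _ => le_rfl,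
    fun _ _ => le_rfl, fun d hd => absurd hd (lt_irrefl _)⟩ hr hℓ
    fun x hx hx0 => (hty x hx hx0).imp id fun h => ⟨hij, h⟩

/-! ### Leftmost minimum cuts -/

theorem cutValue_eq {H : Piece V D} {c f : D → ℝ} {u v : V} (huv : u ≠ v)
    (hf : N.IsFlow H.darts {u, v} c f) {X : Set V} (hu : u ∈ X) (hv : v ∉ X) :
    N.cutValue H c X = N.netIn f v + N.cutValue H (c - f) X := by
  have h1 : N.netIn f v = N.cutValue H f X := by
    have h2 := sum_netIn_pair hf.anti huv hf.2.2.1 Xᶜ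
    rw [sum_netIn N hf.anti] at h2
    simp only [Set.mem_compl_iff, hv, not_false_eq_true, if_true, hu, not_true_eq_false, if_false,
      sub_zero, not_not] at h2
    rw [← h2, cutValue]
    refine (Finset.sum_subset (fun d hd => ?_) fun d hd hd' => ?_).symm
    · have hd' : d ∈ N.cutDarts H X := (Finset.mem_filter.1 hd).2
      exact Finset.mem_filter.2 ⟨Finset.mem_univ _, hd'.2.2, hd'.2.1⟩
    · have hd'' := (Finset.mem_filter.1 hd).2
      exact hf.2.2.2 d fun h => hd' (Finset.mem_filter.2 ⟨Finset.mem_univ _, h, hd''.2, hd''.1⟩)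
  rw [h1, cutValue, cutValue, cutValue, ← Finset.sum_add_distrib]
  exact Finset.sum_congr rfl fun d _ => by simp

theorem cutValue_sub_nonneg {H : Piece V D} {c f : D → ℝ} {T : Set V}
    (hf : N.IsFlow H.darts T c f) (X : Set V) : 0 ≤ N.cutValue H (c - f) X :=
  Finset.sum_nonneg fun d _ => by
    have := hf.2.1 d
    simp only [Pi.sub_apply]; linarith

/-- The cut that a maximum flow `f` saturates next to the vertices with a residual path to `v`. -/
def leftCut (N : BoundaryNetwork V D m) (H : Piece V D) (c f : D → ℝ) (u v : V) : Set V :=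
  {x | N.Reaches {d | d ∈ H.darts ∧ ¬ N.Reaches (res H.darts (c - f)) (N.tail d) v ∧
    ¬ N.Reaches (res H.darts (c - f)) (N.head d) v} u x}

theorem leftCut_disjoint {H : Piece V D} {c f : D → ℝ} {u v : V}
    (hf : ¬ N.Reaches (res H.darts (c - f)) u v) {x : V} (hx : x ∈ N.leftCut H c f u v) :
    ¬ N.Reaches (res H.darts (c - f)) x v :=
  Reaches.mem_of_closed (W := {x | ¬ N.Reaches (res H.darts (c - f)) x v}) hx hf
    fun _ hd _ => hd.2.2

theorem leftCut_step {H : Piece V D} {c f : D → ℝ} {u v : V}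
    (hf : ¬ N.Reaches (res H.darts (c - f)) u v) {d : D} (hd : d ∈ H.darts)
    (ht : N.tail d ∈ N.leftCut H c f u v) (hh : N.head d ∉ N.leftCut H c f u v) :
    N.Reaches (res H.darts (c - f)) (N.head d) v := by
  by_contra h
  exact hh (Reaches.trans ht (Reaches.dart (A := {d | d ∈ H.darts ∧ _ ∧ _})
    ⟨hd, leftCut_disjoint hf ht, h⟩))

theorem leftCut_saturated {H : Piece V D} {c f : D → ℝ} {u v : V}
    (hf : ¬ N.Reaches (res H.darts (c - f)) u v) {d : D}
    (hd : d ∈ N.cutDarts H (N.leftCut H c f u v)) : ¬ 0 < (c - f) d := fun h =>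
  leftCut_disjoint hf hd.2.1 ((Reaches.dart (A := res H.darts (c - f)) ⟨hd.1, h⟩).trans
    (leftCut_step hf hd.1 hd.2.1 hd.2.2))

theorem leftCut_isSimpleCut {H : Piece V D} (hA : ∀ d ∈ H.darts, N.rev d ∈ H.darts)
    (hV : ∀ d ∈ H.darts, N.tail d ∈ H.verts)
    (hcon : ∀ x ∈ H.verts, ∀ y ∈ H.verts, N.Reaches H.darts x y) {c f : D → ℝ} {u v : V}
    (hv : v ∈ H.verts) (hf : ¬ N.Reaches (res H.darts (c - f)) u v) :
    N.IsSimpleCut H u v (N.leftCut H c f u v) := by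
  set X := N.leftCut H c f u v with hX
  have hvX : v ∉ X := fun h => leftCut_disjoint hf h (Reaches.refl v)
  refine ⟨Reaches.refl u, hvX, fun x hx => ?_, fun x hx => ?_, fun x hx hxX => ?_⟩
  · exact Reaches.mem_of_closed (W := insert u H.verts) hx (Set.mem_insert _ _)
      fun d hd _ => Or.inr (hV _ (hA d hd.1))
  · exact (Reaches.through hx).mono (B := {d | d ∈ H.darts ∧ N.tail d ∈ X ∧ N.head d ∈ X})
      fun d hd => ⟨hd.1.1, hd.2, Reaches.trans hd.2 (Reaches.dart hd.1)⟩
  · obtain ⟨B, hB⟩ : ∃ B : Set D, ∀ d, d ∈ B ↔ d ∈ H.darts ∧ N.tail d ∉ X ∧ N.head d ∉ X :=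
      ⟨{d | _}, fun _ => Iff.rfl⟩
    have hBr : ∀ d ∈ B, N.rev d ∈ B := fun d hd => by
      rw [hB] at hd ⊢
      exact ⟨hA d hd.1, hd.2.2, by rw [head_rev]; exact hd.2.1⟩
    have hY : ∀ y, N.Reaches (res H.darts (c - f)) y v → N.Reaches B y v := fun y hy => by
      refine (Reaches.through' hy).mono fun d hd => (hB d).2 ⟨hd.1.1, fun h => ?_, fun h => ?_⟩
      · exact leftCut_disjoint hf h ((Reaches.dart hd.1).trans hd.2)
      · exact leftCut_disjoint hf h hd.2
    have hxv : N.Reaches B x v := by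
      by_contra hne
      -- A walk in `H` to `v` leaves the set of bad vertices. If it steps into `X`, its last bad
      -- vertex is adjacent to `X` and so has a residual path to `v`; otherwise the step itself
      -- connects that vertex to `v` outside `X`.
      obtain ⟨d, hd, h1, h2, -⟩ := (hcon x hx v hv).exists_exit
        (W := {y | y ∉ X ∧ ¬ N.Reaches B y v}) ⟨hxX, hne⟩ fun h => h.2 (Reaches.refl v)
      by_cases h3 : N.head d ∈ X
      · refine h1.2 (hY _ ?_)
        have := leftCut_step hf (d := N.rev d) (hA d hd) h3 (by rw [head_rev]; exact h1.1)
        rwa [head_rev] at this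
      · have h4 : N.Reaches B (N.head d) v := by
          by_contra h4
          exact h2 ⟨h3, h4⟩
        exact h1.2 ((Reaches.dart ((hB d).2 ⟨hd, h1.1, h3⟩)).trans h4)
    exact (hxv.reverse hBr).mono fun d hd => (hB d).1 hd

/-- Every dart leaving the cut is saturated, so its capacity is the flow value. The source side of
any simple minimum cut contains no vertex with a residual path to `v` and is connected, so it lies
in the component of `u` that defines `leftCut`. -/
theorem leftCut_isLeftmostCut {H : Piece V D} (hA : ∀ d ∈ H.darts, N.rev d ∈ H.darts)
    (hV : ∀ d ∈ H.darts, N.tail d ∈ H.verts)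
    (hcon : ∀ x ∈ H.verts, ∀ y ∈ H.verts, N.Reaches H.darts x y) {c f : D → ℝ} {u v : V}
    (huv : u ≠ v) (hv : v ∈ H.verts) (hf : N.IsMaxFlow H.darts {u} {v} c f) :
    N.IsLeftmostCut H c u v (N.leftCut H c f u v) := by
  have hfl := hf.single.1
  have hr : ¬ N.Reaches (res H.darts (c - f)) u v :=
    hf.not_reaches hA (by simp) (by simpa using huv) (by simp)
  have hX := leftCut_isSimpleCut hA hV hcon hv hr
  have hval : N.cutValue H c (N.leftCut H c f u v) = N.netIn f v := by
    rw [cutValue_eq huv hfl hX.1 hX.2.1, add_eq_left]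
    refine Finset.sum_eq_zero fun d hd => ?_
    have h1 := leftCut_saturated hr (Finset.mem_filter.1 hd).2
    have h2 := hfl.2.1 d
    simp only [Pi.sub_apply] at h1 ⊢; linarith
  refine ⟨⟨hX, fun Y hu hv' => ?_⟩, fun Y hY x hx => ?_⟩
  · rw [hval, cutValue_eq huv hfl hu hv']
    have := cutValue_sub_nonneg hfl Y
    linarith
  · have h1 := hY.2 _ hX.1 hX.2.1
    rw [hval, cutValue_eq huv hfl hY.1.1 hY.1.2.1] at h1
    have h2 : N.cutValue H (c - f) Y = 0 :=
      le_antisymm (by linarith) (cutValue_sub_nonneg hfl Y)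
    have h3 := (Finset.sum_eq_zero_iff_of_nonneg (fun d _ => by
      have := hfl.2.1 d
      simp only [Pi.sub_apply]; linarith)).1 h2
    have h4 : ∀ y ∈ Y, ¬ N.Reaches (res H.darts (c - f)) y v := by
      intro y hy hyr
      obtain ⟨d, hd, h5, h6, -⟩ := hyr.exists_exit hy hY.1.2.1
      exact hd.2.ne' (h3 d (Finset.mem_filter.2 ⟨Finset.mem_univ _, (⟨hd.1, h5, h6⟩ : d ∈ N.cutDarts H Y)⟩))
    exact (hY.1.2.2.2.1 x hx).mono (B := {d | d ∈ H.darts ∧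
      ¬ N.Reaches (res H.darts (c - f)) (N.tail d) v ∧
      ¬ N.Reaches (res H.darts (c - f)) (N.head d) v}) fun d hd => ⟨hd.1, h4 _ hd.2.1, h4 _ hd.2.2⟩

theorem IsLeftmostCut.eq {H : Piece V D} {c : D → ℝ} {u v : V} {X Y : Set V}
    (hX : N.IsLeftmostCut H c u v X) (hY : N.IsLeftmostCut H c u v Y) : X = Y :=
  Set.Subset.antisymm (hY.2 X hX.1) (hX.2 Y hY.1)

/-! ### The recursive calls -/

/-- What holds for the arguments of every recursive call. -/
structure CallInv (N : BoundaryNetwork V D m) (H : Piece V D) (early : List (Fin m))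
    (pairs : List (Fin m × Fin m)) : Prop where
  rev_mem : ∀ d ∈ H.darts, N.rev d ∈ H.darts
  tail_mem : ∀ d ∈ H.darts, N.tail d ∈ H.verts
  connected : ∀ x ∈ H.verts, ∀ y ∈ H.verts, N.Reaches H.darts x y
  sink_mem : ∀ p ∈ pairs, N.t p.2 ∈ H.verts
  early_mem : ∀ e ∈ early, N.s e ∈ H.verts
  source : ∀ a, N.s a ∈ H.verts → a ∈ early ∨ (∃ p ∈ pairs, p.1 = a) ∨ ∀ p ∈ pairs, p.2 < a
  early_sorted : early.Pairwise (· < ·)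
  early_lt : ∀ e ∈ early, ∀ p ∈ pairs, e < p.1
  pair_le : ∀ p ∈ pairs, p.1 ≤ p.2
  pair_eq : ∀ p ∈ pairs.tail, p.1 = p.2
  pair_sorted : pairs.Pairwise fun p q => p.2 < q.1

/-- The flow, its decomposition and the cut found in a recursive call. -/
structure CallStep (N : BoundaryNetwork V D m) (H : Piece V D) (early : List (Fin m))
    (i j : Fin m) (rest : List (Fin m × Fin m)) (c f : D → ℝ) (L : List (List D × ℝ))
    (X : Set V) : Prop where
  inv : N.CallInv H early ((i, j) :: rest)
  nonneg : ∀ d, 0 ≤ c d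
  leftmost : N.IsLeftmostMaxFlow H.darts c (N.s i) (N.t j) f
  decomposition : N.IsPathDecomposition f (N.s i) (N.t j) L
  cut : N.IsLeftmostCut H c (N.s i) (N.t j) X

section CallStep

variable {H : Piece V D} {early : List (Fin m)} {i j : Fin m} {rest : List (Fin m × Fin m)}
  {c f : D → ℝ} {L : List (List D × ℝ)} {X : Set V}

theorem CallStep.le (h : N.CallStep H early i j rest c f L X) : i ≤ j :=
  h.inv.pair_le _ (List.mem_cons_self ..)

/-- The cut of a run is specified by extremality only; identifying it with `leftCut` gives access to
residual reachability. -/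
theorem CallStep.cut_eq (h : N.CallStep H early i j rest c f L X) :
    X = N.leftCut H c f (N.s i) (N.t j) :=
  h.cut.eq (leftCut_isLeftmostCut h.inv.rev_mem h.inv.tail_mem h.inv.connected (s_ne_t i j)
    (h.inv.sink_mem _ (List.mem_cons_self ..)) h.leftmost.1)

theorem CallStep.not_reaches (h : N.CallStep H early i j rest c f L X) :
    ¬ N.Reaches (res H.darts (c - f)) (N.s i) (N.t j) :=
  h.leftmost.1.not_reaches h.inv.rev_mem (by simp) (by simpa using s_ne_t i j) (by simp)

theorem CallStep.nonneg' (h : N.CallStep H early i j rest c f L X) (d : D) : 0 ≤ (c - f) d := by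
  have := h.leftmost.1.1.2.1 d
  simp only [Pi.sub_apply]; linarith

theorem CallStep.saturated (h : N.CallStep H early i j rest c f L X) {d : D}
    (hd : d ∈ N.cutDarts H X) : (c - f) d = 0 := by
  rw [h.cut_eq] at hd
  exact le_antisymm (not_lt.1 (leftCut_saturated h.not_reaches hd)) (h.nonneg' d)

theorem CallStep.cut_reaches (h : N.CallStep H early i j rest c f L X) {d : D}
    (hd : d ∈ N.cutDarts H X) : N.Reaches (res H.darts (c - f)) (N.head d) (N.t j) := by
  rw [h.cut_eq] at hd
  exact leftCut_step h.not_reaches hd.1 hd.2.1 hd.2.2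

theorem CallStep.cut_nonneg (h : N.CallStep H early i j rest c f L X) {d : D}
    (hd : d ∈ N.cutDarts H X) : 0 ≤ f d := by
  have h1 := h.saturated hd
  have h2 := h.nonneg d
  simp only [Pi.sub_apply] at h1; linarith

theorem CallStep.source_mem (h : N.CallStep H early i j rest c f L X) : N.s i ∈ X := h.cut.1.1.1

theorem CallStep.sink_notMem (h : N.CallStep H early i j rest c f L X) : N.t j ∉ X := h.cut.1.1.2.1

theorem CallStep.strictlyLeft_rev (h : N.CallStep H early i j rest c f L X) {q : List D × ℝ}
    (hq : q ∈ L) {d : D} (hd : N.StrictlyLeft i j q.1 d) : N.StrictlyLeft i j q.1 (N.rev d) := by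
  have hP := (h.decomposition.1 q hq).1
  obtain ⟨Θ, hΘ, h01⟩ := IsSimplePath.exists_side (N := N) (src_lt_sink_of_le h.le).le
    (sinkPos_lt j) hP
  rw [strictlyLeft_iff hP hΘ h01] at hd ⊢
  refine ⟨hd.2.1, by rw [N.rev_rev]; exact hd.1, ?_⟩
  have := rchain_of_nodup (N := N) hP.nodup d
  rw [hΘ.eq, if_neg hd.1, if_neg hd.2.1] at this
  linarith [hd.2.2]

theorem CallStep.remaining_rev (h : N.CallStep H early i j rest c f L X) {d : D}
    (hd : d ∈ N.remaining H i j L X) : N.rev d ∈ N.remaining H i j L X := by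
  refine ⟨h.inv.rev_mem d hd.1, fun q hq hl => hd.2.1 q hq ?_, hd.2.2.2, by
    rw [N.rev_rev]; exact hd.2.2.1⟩
  have := h.strictlyLeft_rev (List.mem_of_getLast? hq) hl
  rwa [N.rev_rev] at this

theorem CallStep.remaining_side (h : N.CallStep H early i j rest c f L X) {d : D}
    (hd : d ∈ N.remaining H i j L X) : N.tail d ∈ X ↔ N.head d ∈ X := by
  constructor
  · intro h1
    by_contra h2
    exact hd.2.2.1 ⟨hd.1, h1, h2⟩
  · intro h1
    by_contra h2
    exact hd.2.2.2 ⟨h.inv.rev_mem d hd.1, h1, by rwa [head_rev]⟩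

theorem CallStep.reaches_symm (h : N.CallStep H early i j rest c f L X) {x y : V}
    (hr : N.Reaches (N.remaining H i j L X) x y) : N.Reaches (N.remaining H i j L X) y x :=
  hr.reverse fun _ => h.remaining_rev

theorem CallStep.reaches_side (h : N.CallStep H early i j rest c f L X) {x y : V}
    (hr : N.Reaches (N.remaining H i j L X) x y) : x ∈ X ↔ y ∈ X := by
  have key : ∀ {x y : V}, N.Reaches (N.remaining H i j L X) x y → x ∈ X → y ∈ X :=
    fun hr hx => hr.mem_of_closed hx fun d hd => (h.remaining_side hd).1
  exact ⟨key hr, key (h.reaches_symm hr)⟩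

/-- A boundary vertex to the right of the flow paths stays connected to them. -/
theorem CallStep.exists_reaches_path (h : N.CallStep H early i j rest c f L X) {q : List D × ℝ}
    (hq : q ∈ L.getLast?) {k : ℕ} (hk : k < N.period)
    (hk' : ¬ (N.srcPos i ≤ k ∧ k < N.sinkPos j)) {y : V}
    (hr : N.Reaches {d | d ∈ H.darts ∧ d ∉ N.cutDarts H X ∧ N.rev d ∉ N.cutDarts H X}
      (N.tail (N.outerDart k)) y) (hy : y ∈ N.s i :: q.1.map N.head) :
    ∃ z ∈ N.s i :: q.1.map N.head,
      N.Reaches (N.remaining H i j L X) (N.tail (N.outerDart k)) z := by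
  have hP := (h.decomposition.1 q (List.mem_of_getLast? hq)).1
  obtain ⟨Θ, hΘ, h01⟩ := IsSimplePath.exists_side (N := N) (src_lt_sink_of_le h.le).le
    (sinkPos_lt j) hP
  have hoff : ∀ d, N.tail d ∉ N.s i :: q.1.map N.head → d ∉ q.1 ∧ N.rev d ∉ q.1 := by
    intro d hd
    refine ⟨fun h => hd (hP.1.tail_mem h), fun h => hd ?_⟩
    have := List.mem_map_of_mem (f := N.head) h
    rw [head_rev] at this
    exact List.mem_cons_of_mem _ this
  have hchain : ∀ d, N.tail d ∉ N.s i :: q.1.map N.head → N.rchain q.1 d = 0 := by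
    intro d hd
    rw [rchain_of_nodup hP.nodup, if_neg (hoff d hd).1, if_neg (hoff d hd).2, sub_zero]
  have hconst : ∀ d e, N.tail d ∉ N.s i :: q.1.map N.head → N.tail e = N.tail d → Θ e = Θ d := by
    intro d e hd he
    refine Reaches.eq_of_invariant (N := N) (A := ∅) (W := {N.tail d}) (h := Θ) (fun a ha => ?_)
      (by simp) (Reaches.refl (N.tail d)) rfl he rfl
    rw [Set.mem_singleton_iff] at ha
    refine hΘ.rot_eq (sinkPos_lt j) zero_le_one ?_ ?_
      (hchain a (by rwa [ha]))
    · intro h'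
      exact hd (by rw [← ha, h', tail_srcPos]; exact List.mem_cons_self ..)
    · intro h'
      exact hd (by rw [← ha, h', tail_sinkPos]; exact hP.1.end_mem)
  by_contra! hne
  -- The walk starts on the right of the path. As long as it avoids the vertices of the path, `Θ`
  -- stays zero around its vertices, so none of its darts is strictly left and all remain.
  obtain ⟨W, hW⟩ : ∃ W : Set V, ∀ x, x ∈ W ↔
      N.Reaches (N.remaining H i j L X) (N.tail (N.outerDart k)) x ∧
        ∀ d, N.tail d = x → Θ d = 0 := ⟨{x | _}, fun _ => Iff.rfl⟩
  have hk0 : N.tail (N.outerDart k) ∈ W := by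
    refine (hW _).2 ⟨Reaches.refl _, fun d hd => ?_⟩
    rw [hconst (N.outerDart k) d (fun h' => hne _ h' (Reaches.refl _)) hd, hΘ.outer k hk,
      if_neg hk']
  have hyW : y ∈ W := by
    refine hr.mem_of_closed hk0 fun d hd ht => (hW _).2 ?_
    obtain ⟨h1, h2⟩ := (hW _).1 ht
    have hdR : d ∈ N.remaining H i j L X := by
      refine ⟨hd.1, fun q' hq' hl => ?_, hd.2⟩
      obtain rfl : q' = q := Option.mem_unique hq' hq
      rw [strictlyLeft_iff hP hΘ h01] at hl
      rw [h2 d rfl] at hl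
      norm_num at hl
    have h3 : N.Reaches (N.remaining H i j L X) (N.tail (N.outerDart k)) (N.head d) :=
      h1.trans (Reaches.dart hdR)
    refine ⟨h3, fun e he => ?_⟩
    have h4 : N.tail (N.rev d) ∉ N.s i :: q.1.map N.head := fun h' => hne _ h' h3
    rw [hconst (N.rev d) e h4 he]
    have h5 := hΘ.eq d
    rw [hchain d fun h' => hne _ h' h1, h2 d rfl] at h5
    linarith
  exact hne y hy ((hW y).1 hyW).1

/-- Cut darts are saturated and so carry non-negative flow; hence a flow path can cross the cut only
outwards. -/
theorem CallStep.path_side (h : N.CallStep H early i j rest c f L X) {q : List D × ℝ} (hq : q ∈ L)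
    {d : D} (hd : d ∈ q.1) (ht : N.head d ∈ X) : N.tail d ∈ X := by
  have hpos := h.decomposition.pos hq hd
  by_contra hn
  have hdH := h.leftmost.1.1.mem hpos.ne'
  have := h.cut_nonneg (d := N.rev d) ⟨h.inv.rev_mem d hdH, ht, by rwa [head_rev]⟩
  have h2 := h.leftmost.1.1.anti d
  linarith

theorem CallStep.path_mem_remaining (h : N.CallStep H early i j rest c f L X) {q : List D × ℝ}
    (hq : q ∈ L.getLast?) {d : D} (hd : d ∈ q.1) (hs : N.tail d ∈ X ↔ N.head d ∈ X) :
    d ∈ N.remaining H i j L X := by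
  refine ⟨h.leftmost.1.1.mem (h.decomposition.pos (List.mem_of_getLast? hq) hd).ne',
    fun q' hq' hl => ?_, fun h' => h'.2.2 (hs.1 h'.2.1), fun h' => ?_⟩
  · obtain rfl : q' = q := Option.mem_unique hq' hq
    exact hl.1 hd
  · have := h'.2.2
    rw [head_rev] at this
    exact this (hs.2 h'.2.1)

/-- Deleting the edges left of the rightmost path may break a walk inside `X` to `s i`, but the
boundary vertex still reaches some vertex of that path, and from there the path leads back to `s i`
inside `X`. -/
theorem CallStep.source_reaches (h : N.CallStep H early i j rest c f L X) {k : ℕ}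
    (hk : k < N.period) (hk' : ¬ (N.srcPos i ≤ k ∧ k < N.sinkPos j))
    (hX : N.tail (N.outerDart k) ∈ X) :
    N.Reaches (N.remaining H i j L X) (N.s i) (N.tail (N.outerDart k)) := by
  have hr := (h.cut.1.1.2.2.2.1 _ hX).mono
    (B := {d | d ∈ H.darts ∧ d ∉ N.cutDarts H X ∧ N.rev d ∉ N.cutDarts H X})
    fun d hd => ⟨hd.1, fun h' => h'.2.2 hd.2.2, fun h' => h'.2.2 (by rw [head_rev]; exact hd.2.1)⟩
  rcases hL : L.getLast? with _ | q
  · refine hr.mono (B := N.remaining H i j L X) fun d hd => ⟨hd.1, ?_, hd.2⟩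
    rw [hL]; simp
  · have hq : q ∈ L.getLast? := hL
    have hr' := hr.reverse (B := {d | d ∈ H.darts ∧ d ∉ N.cutDarts H X ∧ N.rev d ∉ N.cutDarts H X})
      fun d hd => ⟨h.inv.rev_mem d hd.1, hd.2.2, by rw [N.rev_rev]; exact hd.2.1⟩
    obtain ⟨z, hz, hzr⟩ := h.exists_reaches_path hq hk hk' hr' (List.mem_cons_self ..)
    have hzX : z ∈ X := (h.reaches_side hzr).1 hX
    have hP := (h.decomposition.1 q (List.mem_of_getLast? hq)).1
    refine Reaches.trans ?_ (h.reaches_symm hzr)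
    exact (hP.1.prefix_reaches (fun d hd => h.path_side (List.mem_of_getLast? hq) hd) hz hzX).2.mono
      fun d hd => h.path_mem_remaining hq hd.1 (iff_of_true hd.2.1 hd.2.2)

theorem CallStep.sink_reaches (h : N.CallStep H early i j rest c f L X) {k : ℕ}
    (hk : k < N.period) (hk' : ¬ (N.srcPos i ≤ k ∧ k < N.sinkPos j))
    (hH : N.tail (N.outerDart k) ∈ H.verts) (hX : N.tail (N.outerDart k) ∉ X) :
    N.Reaches (N.remaining H i j L X) (N.t j) (N.tail (N.outerDart k)) := by
  have hr := (h.cut.1.1.2.2.2.2 _ hH hX).mono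
    (B := {d | d ∈ H.darts ∧ d ∉ N.cutDarts H X ∧ N.rev d ∉ N.cutDarts H X})
    fun d hd => ⟨hd.1, fun h' => hd.2.1 h'.2.1, fun h' => hd.2.2 h'.2.1⟩
  rcases hL : L.getLast? with _ | q
  · refine hr.mono (B := N.remaining H i j L X) fun d hd => ⟨hd.1, ?_, hd.2⟩
    rw [hL]; simp
  · have hq : q ∈ L.getLast? := hL
    have hr' := hr.reverse (B := {d | d ∈ H.darts ∧ d ∉ N.cutDarts H X ∧ N.rev d ∉ N.cutDarts H X})
      fun d hd => ⟨h.inv.rev_mem d hd.1, hd.2.2, by rw [N.rev_rev]; exact hd.2.1⟩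
    have hP := (h.decomposition.1 q (List.mem_of_getLast? hq)).1
    obtain ⟨z, hz, hzr⟩ := h.exists_reaches_path hq hk hk' hr' hP.1.end_mem
    have hzX : z ∈ Xᶜ := fun h' => hX ((h.reaches_side hzr).2 h')
    refine h.reaches_symm (hzr.trans ?_)
    exact (hP.1.suffix_reaches (X := Xᶜ)
      (fun d hd h1 h2 => h1 (h.path_side (List.mem_of_getLast? hq) hd h2)) hz hzX).mono
      fun d hd => h.path_mem_remaining hq hd.1 (iff_of_false hd.2.1 hd.2.2)

/-- The two sides of the cut do not interleave along the boundary. -/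
theorem CallStep.not_interleaved (h : N.CallStep H early i j rest c f L X) {k₁ k₂ k₃ k₄ : ℕ}
    (h12 : k₁ < k₂) (h23 : k₂ < k₃) (h34 : k₃ < k₄) (h4 : k₄ < N.period)
    (h1 : N.tail (N.outerDart k₁) ∈ X) (h2 : N.tail (N.outerDart k₂) ∈ H.verts ∧
      N.tail (N.outerDart k₂) ∉ X) (h3 : N.tail (N.outerDart k₃) ∈ X)
    (h4' : N.tail (N.outerDart k₄) ∈ H.verts ∧ N.tail (N.outerDart k₄) ∉ X) : False := by
  refine BoundaryNetwork.not_interleaved (N := N) (U := X) (W := Xᶜ) disjoint_compl_right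
    (A := {d | d ∈ H.darts ∧ N.tail d ∈ X ∧ N.head d ∈ X})
    (B := {d | d ∈ H.darts ∧ N.tail d ∉ X ∧ N.head d ∉ X})
    (fun d hd => hd.2) (fun d hd => hd.2) h12 h23 h34 h4 h1 h2.2 ?_ ?_
  · refine Reaches.trans (Reaches.reverse (fun d hd => ?_) (h.cut.1.1.2.2.2.1 _ h1))
      (h.cut.1.1.2.2.2.1 _ h3)
    exact ⟨h.inv.rev_mem d hd.1, hd.2.2, by rw [head_rev]; exact hd.2.1⟩
  · refine Reaches.trans (Reaches.reverse (fun d hd => ?_) (h.cut.1.1.2.2.2.2 _ h2.1 h2.2))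
      (h.cut.1.1.2.2.2.2 _ h4'.1 h4'.2)
    exact ⟨h.inv.rev_mem d hd.1, hd.2.2, by rw [head_rev]; exact hd.2.1⟩

theorem CallStep.not_interleaved' (h : N.CallStep H early i j rest c f L X) {k₁ k₂ k₃ k₄ : ℕ}
    (h12 : k₁ < k₂) (h23 : k₂ < k₃) (h34 : k₃ < k₄) (h4 : k₄ < N.period)
    (h1 : N.tail (N.outerDart k₁) ∈ H.verts ∧ N.tail (N.outerDart k₁) ∉ X)
    (h2 : N.tail (N.outerDart k₂) ∈ X)
    (h3 : N.tail (N.outerDart k₃) ∈ H.verts ∧ N.tail (N.outerDart k₃) ∉ X)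
    (h4' : N.tail (N.outerDart k₄) ∈ X) : False := by
  refine BoundaryNetwork.not_interleaved (N := N) (U := Xᶜ) (W := X) disjoint_compl_left
    (B := {d | d ∈ H.darts ∧ N.tail d ∈ X ∧ N.head d ∈ X})
    (A := {d | d ∈ H.darts ∧ N.tail d ∉ X ∧ N.head d ∉ X})
    (fun d hd => hd.2) (fun d hd => hd.2) h12 h23 h34 h4 h1.2 h2 ?_ ?_
  · refine Reaches.trans (Reaches.reverse (fun d hd => ?_) (h.cut.1.1.2.2.2.2 _ h1.1 h1.2))
      (h.cut.1.1.2.2.2.2 _ h3.1 h3.2)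
    exact ⟨h.inv.rev_mem d hd.1, hd.2.2, by rw [head_rev]; exact hd.2.1⟩
  · refine Reaches.trans (Reaches.reverse (fun d hd => ?_) (h.cut.1.1.2.2.2.1 _ h2))
      (h.cut.1.1.2.2.2.1 _ h4')
    exact ⟨h.inv.rev_mem d hd.1, hd.2.2, by rw [head_rev]; exact hd.2.1⟩

end CallStep

/-! ### Components and splittings of lists -/

theorem component_eq {A : Set D} (hA : ∀ d ∈ A, N.rev d ∈ A) {x y : V} (h : N.Reaches A x y) :
    N.component A x = N.component A y := by
  have key : ∀ z, N.Reaches A x z ↔ N.Reaches A y z :=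
    fun z => ⟨fun h' => (h.reverse hA).trans h', fun h' => h.trans h'⟩
  simp only [component, key]

theorem component_rev {A : Set D} (hA : ∀ d ∈ A, N.rev d ∈ A) {v : V} :
    ∀ d ∈ (N.component A v).darts, N.rev d ∈ (N.component A v).darts :=
  fun d hd => ⟨hA d hd.1, hd.2.trans (Reaches.dart hd.1)⟩

theorem component_connected {A : Set D} (hA : ∀ d ∈ A, N.rev d ∈ A) {v : V} :
    ∀ x ∈ (N.component A v).verts, ∀ y ∈ (N.component A v).verts,
      N.Reaches (N.component A v).darts x y := fun _ hx _ hy =>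
  ((Reaches.through hx).reverse (component_rev hA)).trans (Reaches.through hy)

theorem filter_not_append_filter {α : Type*} (Q : α → Prop) [DecidablePred Q] {l : List α}
    (h : l.Pairwise fun a b => Q a → Q b) :
    l = l.filter (fun a => ¬ Q a) ++ l.filter (fun a => Q a) := by
  induction l with
  | nil => rfl
  | cons a l ih =>
    rw [List.pairwise_cons] at h
    by_cases ha : Q a
    · have h1 : l.filter (fun a => ¬ Q a) = [] :=
        List.filter_eq_nil_iff.2 fun b hb => by simpa using h.1 b hb ha
      have h2 : l.filter (fun a => Q a) = l :=
        List.filter_eq_self.2 fun b hb => by simpa using h.1 b hb ha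
      simp only [List.filter_cons, ha, not_true_eq_false, decide_false, decide_true, if_true]
      rw [h1, h2]
      simp
    · simp only [List.filter_cons, ha, not_false_eq_true, decide_false, decide_true, if_true]
      simpa using ih h.2

theorem exists_last {α : Type*} {Q : α → Prop} {l : List α} (h : ∃ a ∈ l, Q a) :
    ∃ l₁ a l₂, l = l₁ ++ a :: l₂ ∧ Q a ∧ ∀ b ∈ l₂, ¬ Q b := by
  induction l with
  | nil => simp at h
  | cons a l ih =>
    by_cases h' : ∃ b ∈ l, Q b
    · obtain ⟨l₁, b, l₂, rfl, hb⟩ := ih h'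
      exact ⟨a :: l₁, b, l₂, rfl, hb⟩
    · push Not at h'
      obtain ⟨b, hb, hQ⟩ := h
      rcases List.mem_cons.1 hb with rfl | hb
      · exact ⟨[], b, l, rfl, hQ, h'⟩
      · exact absurd hQ (h' b hb)

/-! ### How the cut distributes the terminals -/

section CallStep

variable {H : Piece V D} {early : List (Fin m)} {i j : Fin m} {rest : List (Fin m × Fin m)}
  {c f : D → ℝ} {L : List (List D × ℝ)} {X : Set V}

theorem CallStep.rest_eq (h : N.CallStep H early i j rest c f L X) {p : Fin m × Fin m}
    (hp : p ∈ rest) : p.1 = p.2 := h.inv.pair_eq p hp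

theorem CallStep.rest_gt (h : N.CallStep H early i j rest c f L X) {p : Fin m × Fin m}
    (hp : p ∈ rest) : j < p.2 := by
  rw [← h.rest_eq hp]
  exact (List.pairwise_cons.1 h.inv.pair_sorted).1 p hp

theorem CallStep.rest_sorted (h : N.CallStep H early i j rest c f L X) :
    rest.Pairwise fun p q => p.2 < q.2 :=
  (List.pairwise_cons.1 h.inv.pair_sorted).2.imp_of_mem fun _ hq hpq => by
    rwa [← h.rest_eq hq]

theorem CallStep.early_lt (h : N.CallStep H early i j rest c f L X) {e : Fin m}
    (he : e ∈ early) : e < i := h.inv.early_lt e he _ (List.mem_cons_self ..)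

theorem CallStep.rest_mem (h : N.CallStep H early i j rest c f L X) {p : Fin m × Fin m}
    (hp : p ∈ rest) : N.t p.2 ∈ H.verts := h.inv.sink_mem p (List.mem_cons_of_mem _ hp)

theorem CallStep.sink_mem (h : N.CallStep H early i j rest c f L X) : N.t j ∈ H.verts :=
  h.inv.sink_mem _ (List.mem_cons_self ..)

/-- For the terminals that matter later, the components after the deletions are simply the two sides
of the cut. Earlier sources and later sinks lie outside the boundary stretch from `s i` to `t j`, so
`source_reaches` applies. -/
theorem CallStep.reaches_source_iff (h : N.CallStep H early i j rest c f L X) {x : V}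
    (hx : x = N.s i ∨ (∃ e ∈ early, x = N.s e) ∨ ∃ p ∈ rest, x = N.t p.2) :
    N.Reaches (N.remaining H i j L X) (N.s i) x ↔ x ∈ X := by
  refine ⟨fun hr => (h.reaches_side hr).1 h.source_mem, fun hX => ?_⟩
  rcases hx with rfl | ⟨e, he, rfl⟩ | ⟨p, hp, rfl⟩
  · exact Reaches.refl _
  · refine h.source_reaches (srcPos_lt e) ?_ hX
    have := srcPos_lt_srcPos (N := N) (h.early_lt he)
    omega
  · refine h.source_reaches (sinkPos_lt p.2) ?_ hX
    have := sinkPos_lt_sinkPos (N := N) (h.rest_gt hp)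
    omega

theorem CallStep.reaches_sink_iff (h : N.CallStep H early i j rest c f L X) {x : V}
    (hx : x = N.t j ∨ (∃ e ∈ early, x = N.s e) ∨ ∃ p ∈ rest, x = N.t p.2) :
    N.Reaches (N.remaining H i j L X) (N.t j) x ↔ x ∉ X := by
  refine ⟨fun hr h' => h.sink_notMem ((h.reaches_side hr).2 h'), fun hX => ?_⟩
  rcases hx with rfl | ⟨e, he, rfl⟩ | ⟨p, hp, rfl⟩
  · exact Reaches.refl _
  · refine h.sink_reaches (srcPos_lt e) ?_ (h.inv.early_mem e he) hX
    have := srcPos_lt_srcPos (N := N) (h.early_lt he)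
    omega
  · refine h.sink_reaches (sinkPos_lt p.2) ?_ (h.rest_mem hp) hX
    have := sinkPos_lt_sinkPos (N := N) (h.rest_gt hp)
    omega

/-- Sinks on the side of `s i` come after those on the side of `t j`. -/
theorem CallStep.sink_mono (h : N.CallStep H early i j rest c f L X) {p q : Fin m × Fin m}
    (hp : p ∈ rest) (hq : q ∈ rest) (hpq : p.2 < q.2) (hpX : N.t p.2 ∈ X) : N.t q.2 ∈ X := by
  by_contra hqX
  exact h.not_interleaved (src_lt_sink_of_le h.le) (sinkPos_lt_sinkPos (h.rest_gt hp))
    (sinkPos_lt_sinkPos hpq) (sinkPos_lt _) h.source_mem ⟨h.sink_mem, h.sink_notMem⟩ hpX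
    ⟨h.rest_mem hq, hqX⟩

theorem CallStep.rest_append (h : N.CallStep H early i j rest c f L X) :
    rest = rest.filter (fun p => N.t p.2 ∉ X) ++ rest.filter (fun p => N.t p.2 ∈ X) :=
  filter_not_append_filter _ (h.rest_sorted.imp_of_mem fun hp hq hpq => h.sink_mono hp hq hpq)

theorem CallStep.filter_sink (h : N.CallStep H early i j rest c f L X) :
    rest.filter (fun p => ∃ q ∈ rest, p.2 ≤ q.2 ∧
      N.t q.2 ∈ (N.component (N.remaining H i j L X) (N.t j)).verts) =
    rest.filter (fun p => N.t p.2 ∉ X) := by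
  refine List.filter_congr fun p hp => decide_eq_decide.2 ⟨?_, fun hX => ?_⟩
  · rintro ⟨q, hq, hpq, hr⟩ hpX
    have hqX := (h.reaches_sink_iff (Or.inr (Or.inr ⟨q, hq, rfl⟩))).1 hr
    rcases hpq.lt_or_eq with hlt | heq
    · exact hqX (h.sink_mono hp hq hlt hpX)
    · exact hqX (heq ▸ hpX)
  · exact ⟨p, hp, le_rfl, (h.reaches_sink_iff (Or.inr (Or.inr ⟨p, hp, rfl⟩))).2 hX⟩

theorem CallStep.filter_source (h : N.CallStep H early i j rest c f L X) :
    rest.filter (fun p => ∃ q ∈ rest, q.2 ≤ p.2 ∧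
      N.t q.2 ∈ (N.component (N.remaining H i j L X) (N.s i)).verts) =
    rest.filter (fun p => N.t p.2 ∈ X) := by
  refine List.filter_congr fun p hp => decide_eq_decide.2 ⟨?_, fun hX => ?_⟩
  · rintro ⟨q, hq, hpq, hr⟩
    have hqX := (h.reaches_source_iff (Or.inr (Or.inr ⟨q, hq, rfl⟩))).1 hr
    rcases hpq.lt_or_eq with hlt | heq
    · exact h.sink_mono hq hp hlt hqX
    · exact heq ▸ hqX
  · exact ⟨p, hp, le_rfl, (h.reaches_source_iff (Or.inr (Or.inr ⟨p, hp, rfl⟩))).2 hX⟩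

theorem eq_nil_or_headD_mem {α : Type*} (early : List α) (i : α) :
    early = [] ∨ early.headD i ∈ early := by
  cases early <;> simp

theorem CallStep.headD_lt (h : N.CallStep H early i j rest c f L X) {e : Fin m}
    (he : e ∈ early) (hne : e ≠ early.headD i) : early.headD i < e := by
  have hs := h.inv.early_sorted
  cases early with
  | nil => simp at he
  | cons a l =>
    rcases List.mem_cons.1 he with rfl | he'
    · exact absurd rfl hne
    · exact (List.pairwise_cons.1 hs).1 e he'

theorem CallStep.component_headD_source (h : N.CallStep H early i j rest c f L X)
    (hX : N.s (early.headD i) ∈ X) :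
    N.component (N.remaining H i j L X) (N.s (early.headD i)) =
      N.component (N.remaining H i j L X) (N.s i) := by
  refine (component_eq (fun _ => h.remaining_rev) ((h.reaches_source_iff ?_).2 hX)).symm
  rcases eq_nil_or_headD_mem early i with h' | h'
  · exact Or.inl (by rw [h']; rfl)
  · exact Or.inr (Or.inl ⟨_, h', rfl⟩)

theorem CallStep.component_headD_sink (h : N.CallStep H early i j rest c f L X)
    (hX : N.s (early.headD i) ∉ X) :
    early.headD i ∈ early ∧ N.component (N.remaining H i j L X) (N.s (early.headD i)) =
      N.component (N.remaining H i j L X) (N.t j) := by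
  have hm : early.headD i ∈ early := by
    refine (eq_nil_or_headD_mem early i).resolve_left fun h' => hX ?_
    rw [h']
    exact h.source_mem
  exact ⟨hm, (component_eq (fun _ => h.remaining_rev)
    ((h.reaches_sink_iff (Or.inr (Or.inl ⟨_, hm, rfl⟩))).2 hX)).symm⟩

/-- The two kinds of recursive step differ by the side of the cut on which the first source of the
call lies. -/
theorem CallStep.split_iff (h : N.CallStep H early i j rest c f L X) :
    N.t j ∉ (N.component (N.remaining H i j L X) (N.s (early.headD i))).verts ↔
      N.s (early.headD i) ∈ X := by
  constructor
  · intro h1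
    by_contra h2
    rw [(h.component_headD_sink h2).2] at h1
    exact h1 (Reaches.refl _)
  · intro h1 h2
    exact h.sink_notMem ((h.reaches_side h2).1 h1)

/-- In boundary order: the first source, `s e`, `s i`, `t j`. With `s e` outside `X`, the two sides
would alternate. -/
theorem CallStep.early_mem_cut (h : N.CallStep H early i j rest c f L X)
    (hX : N.s (early.headD i) ∈ X) {e : Fin m} (he : e ∈ early) : N.s e ∈ X := by
  by_contra heX
  have hne : e ≠ early.headD i := fun h' => heX (h' ▸ hX)
  exact h.not_interleaved (srcPos_lt_srcPos (h.headD_lt he hne))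
    (srcPos_lt_srcPos (h.early_lt he)) (src_lt_sink_of_le h.le) (sinkPos_lt j) hX
    ⟨h.inv.early_mem e he, heX⟩ h.source_mem ⟨h.sink_mem, h.sink_notMem⟩

/-- In boundary order: the first source, `s i`, `t j`, `t p.2`. With the last one in `X`, the two
sides would alternate. -/
theorem CallStep.rest_notMem_cut (h : N.CallStep H early i j rest c f L X)
    (hX : N.s (early.headD i) ∉ X) {p : Fin m × Fin m} (hp : p ∈ rest) : N.t p.2 ∉ X := by
  intro hpX
  have hm := (h.component_headD_sink hX).1
  exact h.not_interleaved' (srcPos_lt_srcPos (h.early_lt hm)) (src_lt_sink_of_le h.le)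
    (sinkPos_lt_sinkPos (h.rest_gt hp)) (sinkPos_lt _) ⟨h.inv.early_mem _ hm, hX⟩ h.source_mem
    ⟨h.sink_mem, h.sink_notMem⟩ hpX

theorem CallStep.early_notMem_cut (h : N.CallStep H early i j rest c f L X)
    (hX : N.s (early.headD i) ∉ X) {e k : Fin m} (he : e ∈ early) (hk : k ∈ early) (hek : e < k)
    (hkX : N.s k ∉ X) : N.s e ∉ X := by
  intro heX
  have hm := (h.component_headD_sink hX).1
  have hne : e ≠ early.headD i := fun h' => hX (h' ▸ heX)
  exact h.not_interleaved' (srcPos_lt_srcPos (h.headD_lt he hne)) (srcPos_lt_srcPos hek)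
    (srcPos_lt_srcPos (h.early_lt hk)) (srcPos_lt i) ⟨h.inv.early_mem _ hm, hX⟩ heX
    ⟨h.inv.early_mem k hk, hkX⟩ h.source_mem

/-- A vertex of a component is a vertex of `H`. -/
theorem CallStep.component_verts (h : N.CallStep H early i j rest c f L X) {v x : V}
    (hr : N.Reaches (N.remaining H i j L X) v x) : x = v ∨ x ∈ H.verts :=
  hr.mem_of_closed (W := {y | y = v ∨ y ∈ H.verts}) (Or.inl rfl)
    fun d hd _ => Or.inr (h.inv.tail_mem _ (h.inv.rev_mem d hd.1))

theorem CallStep.inv_sink (h : N.CallStep H early i j rest c f L X)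
    (hX : N.s (early.headD i) ∈ X) :
    N.CallInv (N.component (N.remaining H i j L X) (N.t j)) []
      (rest.filter (fun p => N.t p.2 ∉ X)) := by
  have hmem : ∀ p ∈ rest.filter (fun p => N.t p.2 ∉ X), p ∈ rest ∧ N.t p.2 ∉ X := by
    intro p hp
    simpa using List.mem_filter.1 hp
  refine ⟨component_rev fun _ => h.remaining_rev, fun d hd => hd.2,
    component_connected fun _ => h.remaining_rev, fun p hp => ?_, by simp, fun a ha => ?_,
    List.Pairwise.nil, by simp, fun p hp => ?_, fun p hp => ?_, ?_⟩
  · exact (h.reaches_sink_iff (Or.inr (Or.inr ⟨p, (hmem p hp).1, rfl⟩))).2 (hmem p hp).2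
  · have haX : N.s a ∉ X := fun h' => h.sink_notMem ((h.reaches_side ha).2 h')
    have haH := (h.component_verts ha).resolve_left (s_ne_t a j)
    rcases h.inv.source a haH with h1 | ⟨p, hp, rfl⟩ | h1
    · exact absurd (h.early_mem_cut hX h1) haX
    · rcases List.mem_cons.1 hp with rfl | hp
      · exact absurd h.source_mem haX
      by_cases hpX : N.t p.2 ∈ X
      -- The source of `p` is in this component but its sink is not. By `sink_mono` all kept sinks
      -- have smaller index, so the source is beyond them.
      · refine Or.inr (Or.inr fun q hq => ?_)
        obtain ⟨hq, hqX⟩ := hmem q hq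
        rw [h.rest_eq hp]
        by_contra hle
        rcases (not_lt.1 hle).lt_or_eq with hlt | heq
        · exact hqX (h.sink_mono hp hq hlt hpX)
        · exact hqX (heq ▸ hpX)
      · exact Or.inr (Or.inl ⟨p, List.mem_filter.2 ⟨hp, by simpa using hpX⟩, rfl⟩)
    · exact Or.inr (Or.inr fun p hp => h1 p (List.mem_cons_of_mem _ (hmem p hp).1))
  · exact (h.rest_eq (hmem p hp).1).le
  · exact h.rest_eq (hmem p (List.mem_of_mem_tail hp)).1
  · exact (List.pairwise_cons.1 h.inv.pair_sorted).2.filter _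

theorem CallStep.inv_source (h : N.CallStep H early i j rest c f L X)
    (hX : N.s (early.headD i) ∈ X) :
    N.CallInv (N.component (N.remaining H i j L X) (N.s i)) (early ++ [i])
      (rest.filter (fun p => N.t p.2 ∈ X)) := by
  have hmem : ∀ p ∈ rest.filter (fun p => N.t p.2 ∈ X), p ∈ rest ∧ N.t p.2 ∈ X := by
    intro p hp
    simpa using List.mem_filter.1 hp
  refine ⟨component_rev fun _ => h.remaining_rev, fun d hd => hd.2,
    component_connected fun _ => h.remaining_rev, fun p hp => ?_, fun e he => ?_, fun a ha => ?_,
    ?_, fun e he p hp => ?_, fun p hp => ?_, fun p hp => ?_, ?_⟩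
  · exact (h.reaches_source_iff (Or.inr (Or.inr ⟨p, (hmem p hp).1, rfl⟩))).2 (hmem p hp).2
  · rcases List.mem_append.1 he with he | he
    · exact (h.reaches_source_iff (Or.inr (Or.inl ⟨e, he, rfl⟩))).2 (h.early_mem_cut hX he)
    · rw [List.mem_singleton.1 he]
      exact Reaches.refl _
  · have haX : N.s a ∈ X := (h.reaches_side ha).1 h.source_mem
    rcases h.component_verts ha with h1 | haH
    · exact Or.inl (by simp [s_inj h1])
    rcases h.inv.source a haH with h1 | ⟨p, hp, rfl⟩ | h1
    · exact Or.inl (List.mem_append_left _ h1)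
    · rcases List.mem_cons.1 hp with rfl | hp
      · exact Or.inl (by simp)
      -- In the order `s i`, `t j`, `s p.1`, `t p.2`, the third is in `X` and the second is not, so
      -- the fourth must be in `X`.
      refine Or.inr (Or.inl ⟨p, List.mem_filter.2 ⟨hp, ?_⟩, rfl⟩)
      by_contra hpX
      have hjp := h.rest_gt hp
      rw [h.rest_eq hp] at haX
      exact h.not_interleaved (src_lt_sink_of_le h.le) (N.sink_lt_src _ _ hjp)
        (N.src_lt_sink p.2) (sinkPos_lt _) h.source_mem ⟨h.sink_mem, h.sink_notMem⟩ haX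
        ⟨h.rest_mem hp, fun h' => hpX (decide_eq_true h')⟩
    · exact Or.inr (Or.inr fun p hp => h1 p (List.mem_cons_of_mem _ (hmem p hp).1))
  · refine List.pairwise_append.2 ⟨h.inv.early_sorted, List.pairwise_singleton _ _,
      fun e he k hk => ?_⟩
    rw [List.mem_singleton.1 hk]
    exact h.early_lt he
  · rw [h.rest_eq (hmem p hp).1]
    refine lt_of_le_of_lt ?_ (h.rest_gt (hmem p hp).1)
    rcases List.mem_append.1 he with he | he
    · exact (h.early_lt he).le.trans h.le
    · rw [List.mem_singleton.1 he]
      exact h.le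
  · exact (h.rest_eq (hmem p hp).1).le
  · exact h.rest_eq (hmem p (List.mem_of_mem_tail hp)).1
  · exact (List.pairwise_cons.1 h.inv.pair_sorted).2.filter _

theorem CallStep.inv_back {early₁ early₂ : List (Fin m)} {k : Fin m}
    (h : N.CallStep H (early₁ ++ k :: early₂) i j rest c f L X)
    (hX : N.s ((early₁ ++ k :: early₂).headD i) ∉ X)
    (hk : N.s k ∈ (N.component (N.remaining H i j L X) (N.t j)).verts)
    (hk' : ∀ l ∈ early₂, N.s l ∉ (N.component (N.remaining H i j L X) (N.t j)).verts) :
    N.CallInv (N.component (N.remaining H i j L X) (N.t j)) early₁ ((k, j) :: rest) := by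
  have hkm : k ∈ early₁ ++ k :: early₂ := by simp
  have hkX := (h.reaches_sink_iff (Or.inr (Or.inl ⟨k, hkm, rfl⟩))).1 hk
  obtain ⟨hs1, hs2, hs3⟩ := List.pairwise_append.1 h.inv.early_sorted
  refine ⟨component_rev fun _ => h.remaining_rev, fun d hd => hd.2,
    component_connected fun _ => h.remaining_rev, fun p hp => ?_, fun e he => ?_, fun a ha => ?_,
    hs1, fun e he p hp => ?_, fun p hp => ?_, h.inv.pair_eq, ?_⟩
  · rcases List.mem_cons.1 hp with rfl | hp
    · exact Reaches.refl _
    · exact (h.reaches_sink_iff (Or.inr (Or.inr ⟨p, hp, rfl⟩))).2 (h.rest_notMem_cut hX hp)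
  · have hem : e ∈ early₁ ++ k :: early₂ := List.mem_append_left _ he
    exact (h.reaches_sink_iff (Or.inr (Or.inl ⟨e, hem, rfl⟩))).2
      (h.early_notMem_cut hX hem hkm (hs3 e he k (List.mem_cons_self ..)) hkX)
  · have haX : N.s a ∉ X := fun h' => h.sink_notMem ((h.reaches_side ha).2 h')
    rcases h.inv.source a ((h.component_verts ha).resolve_left (s_ne_t a j)) with
      h1 | ⟨p, hp, rfl⟩ | h1
    · rcases List.mem_append.1 h1 with h1 | h1
      · exact Or.inl h1
      rcases List.mem_cons.1 h1 with rfl | h1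
      · exact Or.inr (Or.inl ⟨_, List.mem_cons_self .., rfl⟩)
      · exact absurd ha (hk' a h1)
    · rcases List.mem_cons.1 hp with rfl | hp
      · exact absurd h.source_mem haX
      · exact Or.inr (Or.inl ⟨p, List.mem_cons_of_mem _ hp, rfl⟩)
    · simp only [List.forall_mem_cons] at h1 ⊢
      exact Or.inr (Or.inr h1)
  · rcases List.mem_cons.1 hp with rfl | hp
    · exact hs3 e he k (List.mem_cons_self ..)
    · exact h.inv.early_lt e (List.mem_append_left _ he) p (List.mem_cons_of_mem _ hp)
  · rcases List.mem_cons.1 hp with rfl | hp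
    · exact (h.early_lt hkm).le.trans h.le
    · exact (h.rest_eq hp).le
  · have := h.inv.pair_sorted
    rw [List.pairwise_cons] at this ⊢
    exact this

end CallStep

/-! ### Existence and termination of the recursion -/

theorem CallInv.exists_step {H : Piece V D} {early : List (Fin m)} {i j : Fin m}
    {rest : List (Fin m × Fin m)} {c : D → ℝ} (h : N.CallInv H early ((i, j) :: rest))
    (hc : ∀ d, 0 ≤ c d) (hcw : N.NoResidualClockwise H.darts c) :
    ∃ f L X, N.CallStep H early i j rest c f L X := by
  obtain ⟨f, hf⟩ := exists_leftmost h.rev_mem {N.s i} {N.t j} hc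
  obtain ⟨L, hL⟩ := IsLeftmostMaxFlow.exists_decomposition (h.pair_le _ (List.mem_cons_self ..))
    hc hcw hf
  exact ⟨f, L, _, h, hc, hf, hL, leftCut_isLeftmostCut h.rev_mem h.tail_mem h.connected
    (s_ne_t i j) (h.sink_mem _ (List.mem_cons_self ..)) hf.1⟩

theorem NoResidualClockwise.mono {A B : Set D} (hAB : A ⊆ B) {c : D → ℝ}
    (h : N.NoResidualClockwise B c) : N.NoResidualClockwise A c :=
  fun p hp hA => h p hp fun d hd => hAB (hA d hd)

theorem component_remaining_subset {H : Piece V D} {i j : Fin m} {L : List (List D × ℝ)}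
    {X : Set V} {v : V} : (N.component (N.remaining H i j L X) v).darts ⊆ H.darts :=
  fun _ hd => hd.1.1

/-- Termination is lexicographic: a split loses a pair, while going back keeps the number of pairs
and shortens the list of earlier sources. -/
theorem CallInv.exists_helperRun {H : Piece V D} {early : List (Fin m)}
    {pairs : List (Fin m × Fin m)} {c : D → ℝ} (h : N.CallInv H early pairs)
    (hc : ∀ d, 0 ≤ c d) (hcw : N.NoResidualClockwise H.darts c) :
    ∃ tr, N.HelperRun H early pairs c tr := by
  obtain ⟨n, hn⟩ : ∃ n, pairs.length ≤ n := ⟨_, le_rfl⟩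
  induction n generalizing H early pairs c with
  | zero =>
    rw [List.length_eq_zero_iff.1 (Nat.le_zero.1 hn)]
    exact ⟨[], HelperRun.done H early c⟩
  | succ n ih =>
    obtain ⟨l, hl⟩ : ∃ l, early.length < l := ⟨_, Nat.lt_succ_self _⟩
    induction l generalizing H early pairs c with
    | zero => exact absurd hl (Nat.not_lt_zero _)
    | succ l ihl =>
      rcases pairs with _ | ⟨⟨i, j⟩, rest⟩
      · exact ⟨[], HelperRun.done H early c⟩
      obtain ⟨f, L, X, hs⟩ := h.exists_step hc hcw
      by_cases hX : N.s (early.headD i) ∈ X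
      · have hlen : ∀ Q : Fin m × Fin m → Bool, (rest.filter Q).length ≤ n := fun Q =>
          (List.length_filter_le _ _).trans (by simpa using hn)
        obtain ⟨tr₂, h₂⟩ := ih (hs.inv_sink hX) hs.nonneg'
          (hs.leftmost.2.mono component_remaining_subset) (hlen _)
        obtain ⟨tr₁, h₁⟩ := ih (hs.inv_source hX) hs.nonneg'
          (hs.leftmost.2.mono component_remaining_subset) (hlen _)
        refine ⟨_, HelperRun.split H early i j rest c f L X _ _ tr₁ tr₂ hs.leftmost
          hs.decomposition hs.cut rfl (hs.split_iff.2 hX) rfl ?_ ?_⟩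
        · rwa [hs.filter_sink]
        · rwa [hs.component_headD_source hX, hs.filter_source]
      · obtain ⟨hm, heq⟩ := hs.component_headD_sink hX
        obtain ⟨early₁, k, early₂, rfl, hk, hk'⟩ := exists_last
          (Q := fun k => N.s k ∈ (N.component (N.remaining H i j L X) (N.t j)).verts)
          ⟨_, hm, (hs.reaches_sink_iff (Or.inr (Or.inl ⟨_, hm, rfl⟩))).2 hX⟩
        obtain ⟨tr, htr⟩ := ihl (hs.inv_back hX hk hk') hs.nonneg'
          (hs.leftmost.2.mono component_remaining_subset) (by simpa using hn)
          (by simp only [List.length_append, List.length_cons] at hl; omega)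
        refine ⟨_, HelperRun.back H early₁ early₂ k i j rest c f L X _ tr hs.leftmost
          hs.decomposition hs.cut rfl ?_ ?_ ?_ ?_⟩
        all_goals rw [heq]
        · exact Reaches.refl _
        · exact hk
        · exact hk'
        · exact htr

/-! ### The recursive algorithm follows the double loop -/

theorem exists_rowFrom_eq_cons (i j : Fin m) :
    ∃ row, rowFrom i j = (i, j) :: row ∧ ∀ p ∈ row, p.1 < i ∧ p.2 = j := by
  have hmem : (i, j) ∈ rowFrom i j := mem_rowFrom.2 ⟨le_rfl, rfl⟩
  have hpw := pairwise_rowFrom i j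
  have hle : ∀ p ∈ rowFrom i j, p.1 ≤ i ∧ p.2 = j := fun p => mem_rowFrom.1
  rcases hrow : rowFrom i j with _ | ⟨q, row⟩
  · simp [hrow] at hmem
  rw [hrow] at hmem hpw hle
  rw [List.pairwise_cons] at hpw
  have hq : q = (i, j) := by
    rcases List.mem_cons.1 hmem with h | h
    · exact h.symm
    · have h1 := hpw.1 _ h
      have h2 := hle q (List.mem_cons_self ..)
      unfold Before at h1
      simp only [h2.2, lt_self_iff_false, true_and, false_or] at h1
      exact absurd h1 (not_lt.2 h2.1)
  subst hq
  refine ⟨row, rfl, fun p hp => ?_⟩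
  have h1 := hpw.1 p hp
  have h2 := (hle p (List.mem_cons_of_mem _ hp)).2
  unfold Before at h1
  simp only [h2, lt_self_iff_false, true_and, false_or] at h1
  exact ⟨h1, h2⟩

/-- `mid` are the pairs that the recursion skips when it goes back from source `i` to source `k`. -/
theorem exists_rowFrom_eq_append {i j k : Fin m} (hk : k < i) :
    ∃ mid, rowFrom i j = (i, j) :: (mid ++ rowFrom k j) ∧ ∀ p ∈ mid, k < p.1 ∧ p.1 < i := by
  obtain ⟨row, hrow, hr⟩ := exists_rowFrom_eq_cons i j
  have h1 : rowFrom k j = (rowFrom i j).filter (fun p => p.1 ≤ k) := by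
    simp only [rowFrom, List.filter_map, List.filter_reverse, List.filter_filter]
    congr 2
    refine List.filter_congr fun a _ => ?_
    simp only [Function.comp_apply, ← Bool.decide_and, decide_eq_decide]
    exact ⟨fun h => ⟨h, h.trans hk.le⟩, fun h => h.1⟩
  have h2 : row = row.filter (fun p => ¬ p.1 ≤ k) ++ row.filter (fun p => p.1 ≤ k) := by
    have hpw := pairwise_rowFrom i j
    rw [hrow, List.pairwise_cons] at hpw
    refine filter_not_append_filter _ (hpw.2.imp_of_mem fun {p q} hp hq hpq h => ?_)
    have h3 := (hr p hp).2.trans (hr q hq).2.symm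
    unfold Before at hpq
    simp only [h3, lt_self_iff_false, true_and, false_or] at hpq
    exact hpq.le.trans h
  refine ⟨row.filter (fun p => ¬ p.1 ≤ k), ?_, fun p hp => ?_⟩
  · rw [h1, hrow, List.filter_cons_of_neg (by simpa using hk), ← h2]
  · rw [List.mem_filter] at hp
    exact ⟨by simpa using hp.2, (hr p hp.1).1⟩

theorem block_append (p q : List (Fin m × Fin m)) : block (p ++ q) = block p ++ block q :=
  List.flatMap_append

theorem mem_block {pairs : List (Fin m × Fin m)} {p : Fin m × Fin m} :
    p ∈ block pairs ↔ ∃ q ∈ pairs, p.1 ≤ q.1 ∧ p.2 = q.2 := by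
  simp only [block, List.mem_flatMap, mem_rowFrom]

/-! ### Where later flows of the double loop can run -/

theorem LoopRun.support {ℓ : List (Fin m × Fin m)} {c c' : D → ℝ}
    {tr : List (Augmentation D m)} (hr : N.LoopRun ℓ c tr c') (hc : ∀ d, 0 ≤ c d)
    (hcw : N.NoResidualClockwise Set.univ c) :
    ∀ x ∈ tr, N.Anti x.flow ∧ ∀ d, 0 < x.flow d →
      N.Reaches (pos x.flow) (N.s x.source) (N.tail d) ∧
      N.Reaches (pos x.flow) (N.head d) (N.t x.sink) := by
  induction hr with
  | nil => simp
  | cons a b rest c g c' tr hg _ ih =>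
    rw [List.forall_mem_cons]
    refine ⟨⟨hg.1.1.anti, fun d hd => hg.support (s_ne_t a b) hc hcw hd⟩, ih (fun d => ?_) hg.2⟩
    have := hg.1.1.2.1 d
    simp only [Pi.sub_apply]; linarith

/-- Flows from sources without a residual path to `Y` stay away from `Y`. -/
theorem LoopRun.sources_avoid {ℓ : List (Fin m × Fin m)} {c c' : D → ℝ}
    {tr : List (Augmentation D m)} (hr : N.LoopRun ℓ c tr c') (hc : ∀ d, 0 ≤ c d)
    (hcw : N.NoResidualClockwise Set.univ c) {B : Set D}
    (hB : ∀ x ∈ tr, ∀ d, x.flow d ≠ 0 → d ∈ B) {S : Set (Fin m)}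
    (hS : ∀ x ∈ tr, x.flow ≠ 0 → x.source ∈ S) {Y : Set V}
    (hY : ∀ a ∈ S, ∀ y ∈ Y, ¬ N.Reaches (res B c) (N.s a) y) :
    ∀ x ∈ tr, ∀ d, 0 < x.flow d → N.tail d ∉ Y ∧ N.head d ∉ Y := by
  induction hr with
  | nil => simp
  | cons a b rest c g c' tr hg _ ih =>
    rw [List.forall_mem_cons] at hB hS ⊢
    have hres : ∀ d, 0 < g d → d ∈ res B c := fun d hd =>
      ⟨hB.1 d hd.ne', lt_of_lt_of_le hd (hg.1.1.2.1 d)⟩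
    refine ⟨fun d hd => ?_, ih (fun d => ?_) hg.2 hB.2 hS.2 fun a' ha' y hy => ?_⟩
    · have haS : a ∈ S := hS.1 fun h0 => by
        simp only at h0
        simp [h0] at hd
      have h1 := ((hg.support (s_ne_t a b) hc hcw hd).1).mono hres
      exact ⟨fun h => hY a haS _ h h1, fun h => hY a haS _ h (h1.trans (Reaches.dart (hres d hd)))⟩
    · have := hg.1.1.2.1 d
      simp only [Pi.sub_apply]; linarith
    · by_cases h0 : g = 0
      · rw [h0, sub_zero]
        exact hY a' ha' y hy
      -- The source of the flow just found does not reach `Y` either, so augmenting from it opens no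
      -- path to `Y`.
      · exact hg.1.not_reaches_of_not_reaches hc (s_ne_t a b) (fun d hd => hB.1 d hd.ne')
          (hY a' ha' y hy) (Or.inr (hY a (hS.1 h0) y hy))

/-- Flows to sinks without a residual path from `Y` stay away from `Y`. -/
theorem LoopRun.sinks_avoid {ℓ : List (Fin m × Fin m)} {c c' : D → ℝ}
    {tr : List (Augmentation D m)} (hr : N.LoopRun ℓ c tr c') (hc : ∀ d, 0 ≤ c d)
    (hcw : N.NoResidualClockwise Set.univ c) {B : Set D}
    (hB : ∀ x ∈ tr, ∀ d, x.flow d ≠ 0 → d ∈ B) {T : Set (Fin m)}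
    (hT : ∀ x ∈ tr, x.sink ∈ T) {Y : Set V}
    (hY : ∀ b ∈ T, ∀ y ∈ Y, ¬ N.Reaches (res B c) y (N.t b)) :
    ∀ x ∈ tr, ∀ d, 0 < x.flow d → N.tail d ∉ Y ∧ N.head d ∉ Y := by
  induction hr with
  | nil => simp
  | cons a b rest c g c' tr hg _ ih =>
    rw [List.forall_mem_cons] at hB hT ⊢
    have hres : ∀ d, 0 < g d → d ∈ res B c := fun d hd =>
      ⟨hB.1 d hd.ne', lt_of_lt_of_le hd (hg.1.1.2.1 d)⟩
    refine ⟨fun d hd => ?_, ih (fun d => ?_) hg.2 hB.2 hT.2 fun b' hb' y hy => ?_⟩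
    · have h1 := ((hg.support (s_ne_t a b) hc hcw hd).2).mono hres
      exact ⟨fun h => hY b hT.1 _ h ((Reaches.dart (hres d hd)).trans h1),
        fun h => hY b hT.1 _ h h1⟩
    · have := hg.1.1.2.1 d
      simp only [Pi.sub_apply]; linarith
    · exact hg.1.not_reaches_of_not_reaches hc (s_ne_t a b) (fun d hd => hB.1 d hd.ne')
        (hY b' hb' y hy) (Or.inl (hY b hT.1 y hy))

theorem LoopRun.final_apply {ℓ : List (Fin m × Fin m)} {c c' : D → ℝ}
    {tr : List (Augmentation D m)} (hr : N.LoopRun ℓ c tr c') {d : D}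
    (hd : ∀ x ∈ tr, x.flow d = 0) : c' d = c d := by
  induction hr with
  | nil => rfl
  | cons a b rest c g c' tr hg _ ih =>
    rw [List.forall_mem_cons] at hd
    have h1 : g d = 0 := hd.1
    rw [ih hd.2, Pi.sub_apply, h1, sub_zero]

section CallStep

variable {H : Piece V D} {early : List (Fin m)} {i j : Fin m} {rest : List (Fin m × Fin m)}
  {c f : D → ℝ} {L : List (List D × ℝ)} {X : Set V}

/-- A leftmost flow of the whole graph that lives in `H` is the leftmost flow of `H`. -/
theorem CallStep.flow_eq (h : N.CallStep H early i j rest c f L X) {cA fA : D → ℝ}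
    (hcA : ∀ d, 0 ≤ cA d) (hag : ∀ d ∈ H.darts, c d = cA d)
    (hfA : N.IsLeftmostMaxFlow Set.univ cA (N.s i) (N.t j) fA)
    (hH : ∀ d, fA d ≠ 0 → d ∈ H.darts) : f = fA := by
  refine h.leftmost.unique (s_ne_t i j) ⟨isMaxFlow_single.2 ⟨⟨hfA.1.1.1, fun d => ?_,
    hfA.1.single.1.2.2.1, fun d hd => ?_⟩, fun g hg => ?_⟩, ?_⟩
  · by_cases hd : fA d = 0
    · rw [hd]; exact h.nonneg d
    · rw [hag d (hH d hd)]; exact hfA.1.1.2.1 d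
  · by_contra h0
    exact hd (hH d h0)
  · refine hfA.1.single.2 g ⟨hg.1, fun d => ?_, hg.2.2.1, fun d hd => absurd (Set.mem_univ d) hd⟩
    by_cases hd : g d = 0
    · rw [hd]; exact hcA d
    · rw [← hag d (hg.mem hd)]; exact hg.2.1 d
  · intro p hp hpH hcl
    obtain ⟨d, hd, hd'⟩ := hfA.2 p hp (fun _ _ => Set.mem_univ _) hcl
    refine ⟨d, hd, ?_⟩
    rwa [Pi.sub_apply, hag d (hpH d hd)]

/-- Sources of flows in `H`. -/
theorem CallStep.source_cases (h : N.CallStep H early i j rest c f L X)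
    {ℓ : List (Fin m × Fin m)} {cA cA' : D → ℝ} {tr : List (Augmentation D m)}
    (hr : N.LoopRun ℓ cA tr cA') (hcA : ∀ d, 0 ≤ cA d)
    (hcw : N.NoResidualClockwise Set.univ cA) (hH : ∀ x ∈ tr, ∀ d, x.flow d ≠ 0 → d ∈ H.darts)
    {x : Augmentation D m} (hx : x ∈ tr) (h0 : x.flow ≠ 0) :
    x.source ∈ early ∨ x.source = i ∨ j < x.source := by
  obtain ⟨hanti, hsup⟩ := hr.support hcA hcw x hx
  obtain ⟨d, hd⟩ : ∃ d, 0 < x.flow d := by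
    obtain ⟨d, hd⟩ := Function.ne_iff.1 h0
    rcases lt_or_gt_of_ne hd with hd | hd
    · exact ⟨N.rev d, by rw [hanti d]; simpa using hd⟩
    · exact ⟨d, hd⟩
  have hs : N.s x.source ∈ H.verts := by
    by_contra hn
    have := (hsup d hd).1.mem_of_closed (W := {N.s x.source}) rfl fun e he ht => by
      rw [Set.mem_singleton_iff] at ht
      exact absurd (ht ▸ h.inv.tail_mem e (hH x hx e (ne_of_gt he))) hn
    rw [Set.mem_singleton_iff] at this
    exact hn (this ▸ h.inv.tail_mem d (hH x hx d hd.ne'))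
  rcases h.inv.source _ hs with h1 | ⟨p, hp, h1⟩ | h1
  · exact Or.inl h1
  · rw [← h1]
    rcases List.mem_cons.1 hp with rfl | hp
    · exact Or.inr (Or.inl rfl)
    · rw [h.rest_eq hp]
      exact Or.inr (Or.inr (h.rest_gt hp))
  · exact Or.inr (Or.inr (h1 _ (List.mem_cons_self ..)))

/-- Later flows that live in `H` live in what remains of `H`. -/
theorem CallStep.mem_remaining_of_flow (h : N.CallStep H early i j rest c f L X)
    {done todo ℓ : List (Fin m × Fin m)} (hdl : doubleLoop m = done ++ (i, j) :: todo)
    {cA cA' : D → ℝ} (hinv : N.LoopInv done cA) (hag : ∀ d ∈ H.darts, c d = cA d)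
    (hf : N.IsLeftmostMaxFlow Set.univ cA (N.s i) (N.t j) f) {tr : List (Augmentation D m)}
    (hr : N.LoopRun ℓ (cA - f) tr cA') (hℓ : ∀ p ∈ ℓ, p ∈ todo)
    (hℓ' : ∀ p ∈ ℓ, p.2 = j ∨ ∃ q ∈ rest, p.2 = q.2)
    (hH : ∀ x ∈ tr, ∀ d, x.flow d ≠ 0 → d ∈ H.darts) :
    ∀ x ∈ tr, ∀ d, x.flow d ≠ 0 → d ∈ N.remaining H i j L X := by
  have hinv' := hinv.step hdl hf
  obtain ⟨-, htodo, hij⟩ := doubleLoop_split hdl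
  have hreseq : res H.darts (cA - f) = res H.darts (c - f) := by
    ext d
    simp only [res, Set.mem_ofPred_eq, Pi.sub_apply]
    exact and_congr_right fun hd => by rw [hag d hd]
  have hsrc := fun x hx h0 => h.source_cases hr hinv'.nonneg hinv'.noClockwise hH (x := x) hx h0
  have hleft : ∀ q ∈ L.getLast?, ∀ x ∈ tr, ∀ d, N.StrictlyLeft i j q.1 d → x.flow d = 0 := by
    intro q hq
    have hqL := List.mem_of_getLast? hq
    refine hinv.eq_zero_of_strictlyLeft hdl hf (h.decomposition.1 q hqL).1
      (fun d hd => h.decomposition.pos hqL hd) hr (fun p hp => ((htodo p).1 (hℓ p hp)).1)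
      fun x hx h0 => ?_
    have hj : j ≤ x.sink := by
      rcases hℓ' _ (hr.mem x hx) with h1 | ⟨q, hq, h1⟩
      · exact h1.ge
      · simp only at h1
        rw [h1]; exact (h.rest_gt hq).le
    rcases hsrc x hx h0 with h1 | h1 | h1
    · exact Or.inl ⟨(h.early_lt h1).le, hj⟩
    · exact Or.inl ⟨h1.le, hj⟩
    · exact Or.inr h1
  have hexit : ∀ x ∈ X, ∀ y, y ∉ X → ¬ N.Reaches (res H.darts (c - f)) x y := by
    intro x hx y hy hxy
    obtain ⟨d, hd, h1, h2, -⟩ := hxy.exists_exit hx hy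
    exact hd.2.ne' (h.saturated ⟨hd.1, h1, h2⟩)
  -- If the first source is in `X`, so are all earlier ones. Nothing residual leaves `X`, and
  -- sources beyond `j` do not reach the heads of cut darts, since those heads reach `t j`; so flows
  -- avoid these heads. Otherwise all sinks to come are outside `X`, and flows avoid the tails of
  -- cut darts.
  have hcut : ∀ x ∈ tr, ∀ d ∈ N.cutDarts H X, ¬ 0 < x.flow d ∧ ¬ 0 < x.flow (N.rev d) := by
    by_cases hX : N.s (early.headD i) ∈ X
    · have key := hr.sources_avoid hinv'.nonneg hinv'.noClockwise hH
        (S := {a | N.s a ∈ X ∨ j < a}) (Y := {y | ∃ d ∈ N.cutDarts H X, N.head d = y})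
        (fun x hx h0 => ?_) ?_
      · intro x hx d hd
        exact ⟨fun h0 => (key x hx d h0).2 ⟨d, hd, rfl⟩, fun h0 => (key x hx _ h0).1 ⟨d, hd, rfl⟩⟩
      · rcases hsrc x hx h0 with h1 | h1 | h1
        · exact Or.inl (h.early_mem_cut hX h1)
        · exact Or.inl (by rw [h1]; exact h.source_mem)
        · exact Or.inr h1
      · rintro a ha y ⟨d, hd, rfl⟩ hay
        rcases ha with ha | ha
        · rw [hreseq] at hay
          exact hexit _ ha _ hd.2.2 hay
        · refine hinv'.noPath a j (Or.inl ha) ((hay.trans ?_).mono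
            (A := res H.darts (cA - f)) (B := res Set.univ (cA - f))
            fun e he => ⟨Set.mem_univ _, he.2⟩)
          rw [hreseq]
          exact h.cut_reaches hd
    · have key := hr.sinks_avoid hinv'.nonneg hinv'.noClockwise hH
        (T := {b | N.t b ∉ X}) (Y := {y | ∃ d ∈ N.cutDarts H X, N.tail d = y})
        (fun x hx => ?_) ?_
      · intro x hx d hd
        exact ⟨fun h0 => (key x hx d h0).1 ⟨d, hd, rfl⟩, fun h0 => (key x hx _ h0).2
          ⟨d, hd, (head_rev ..).symm⟩⟩
      · rcases hℓ' _ (hr.mem x hx) with h1 | ⟨q, hq, h1⟩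
        · simp only at h1
          simp only [Set.mem_ofPred_eq, h1]
          exact h.sink_notMem
        · simp only at h1
          simp only [Set.mem_ofPred_eq, h1]
          exact h.rest_notMem_cut hX hq
      · rintro b hb y ⟨d, hd, rfl⟩ hby
        rw [hreseq] at hby
        exact hexit _ hd.2.1 _ hb hby
  intro x hx d hd
  have hanti := (hr.support hinv'.nonneg hinv'.noClockwise x hx).1
  refine ⟨hH x hx d hd, fun q hq hl => hd (hleft q hq x hx d hl), fun h' => ?_, fun h' => ?_⟩
  · have h1 := hcut x hx d h'
    rw [hanti d] at h1
    exact hd (by linarith [h1.1, h1.2])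
  · have h1 := hcut x hx _ h'
    rw [N.rev_rev, hanti d] at h1
    exact hd (by linarith [h1.1, h1.2])

end CallStep

theorem mem_component_of_support {A : Set D} (hA : ∀ d ∈ A, N.rev d ∈ A) {z : D → ℝ}
    (hz : N.Anti z) (hzA : ∀ d, z d ≠ 0 → d ∈ A) {v w : V} (hvw : N.Reaches A v w)
    (hw : ∀ d, 0 < z d → N.Reaches (pos z) (N.head d) w) {d : D} (hd : z d ≠ 0) :
    d ∈ (N.component A v).darts := by
  have hpos : ∀ e, 0 < z e → e ∈ A := fun e he => hzA e he.ne'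
  refine ⟨hzA d hd, ?_⟩
  rcases lt_or_gt_of_ne hd with h | h
  · have h1 := hw (N.rev d) (by rw [hz d]; linarith)
    rw [head_rev] at h1
    exact hvw.trans ((h1.mono hpos).reverse hA)
  · refine hvw.trans (((hw d h).mono hpos).reverse hA |>.trans ?_)
    have := Reaches.dart (N := N) (hA d (hzA d hd))
    rwa [head_rev] at this

/-- A positive dart would complete a path from `u` to `w` inside `A`. This shows that the pairs
skipped by the recursion carry no flow. -/
theorem eq_zero_of_support {A : Set D} {z : D → ℝ} (hz : N.Anti z) (hzA : ∀ d, z d ≠ 0 → d ∈ A)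
    {u w : V} (hsup : ∀ d, 0 < z d → N.Reaches (pos z) u (N.tail d) ∧
      N.Reaches (pos z) (N.head d) w) (huw : ¬ N.Reaches A u w) : z = 0 := by
  have hpos : ∀ e, 0 < z e → e ∈ A := fun e he => hzA e he.ne'
  have key : ∀ d, ¬ 0 < z d := fun d hd => huw ((((hsup d hd).1.trans (Reaches.dart hd)).trans
    (hsup d hd).2).mono hpos)
  funext d
  have h1 := key d
  have h2 := key (N.rev d)
  rw [hz d] at h2
  simp only [Pi.zero_apply]
  linarith

theorem block_cons (p : Fin m × Fin m) (pairs : List (Fin m × Fin m)) :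
    block (p :: pairs) = rowFrom p.1 p.2 ++ block pairs := rfl

theorem nonzero_append (tr tr' : List (Augmentation D m)) :
    nonzero (tr ++ tr') = nonzero tr ++ nonzero tr' := List.filter_append ..

theorem nonzero_eq_nil {tr : List (Augmentation D m)} (h : ∀ x ∈ tr, x.flow = 0) :
    nonzero tr = [] := List.filter_eq_nil_iff.2 fun x hx => by simp [h x hx]

theorem nonzero_cons_congr (x : Augmentation D m) {tr tr' : List (Augmentation D m)}
    (h : nonzero tr = nonzero tr') : nonzero (x :: tr) = nonzero (x :: tr') := by
  rw [← List.singleton_append, nonzero_append, h, ← nonzero_append, List.singleton_append]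

/-- A recursive call finds the non-zero flows of the corresponding part of the double loop. -/
theorem HelperRun.nonzero_eq {H : Piece V D} {early : List (Fin m)}
    {pairs : List (Fin m × Fin m)} {c : D → ℝ} {tr : List (Augmentation D m)}
    (hrun : N.HelperRun H early pairs c tr) {done after : List (Fin m × Fin m)}
    {cA cA' : D → ℝ} {trA : List (Augmentation D m)} (hI : N.CallInv H early pairs)
    (hc : ∀ d, 0 ≤ c d) (hdl : doubleLoop m = done ++ block pairs ++ after)
    (hinv : N.LoopInv done cA) (hloop : N.LoopRun (block pairs) cA trA cA')
    (hag : ∀ d ∈ H.darts, c d = cA d)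
    (hH : ∀ x ∈ trA, ∀ d, x.flow d ≠ 0 → d ∈ H.darts) : nonzero tr = nonzero trA := by
  induction hrun generalizing done after cA cA' trA with
  | done H early c =>
    cases hloop
    rfl
  | split H early i j rest c f L X G₁ G₂ tr₁ tr₂ hf hL hcut hG₁ ht hG₂ _ _ ih₂ ih₁ =>
    subst hG₁ hG₂
    have hs : N.CallStep H early i j rest c f L X :=
      ⟨hI, hc, hf, hL, hcut⟩
    have hX := hs.split_iff.1 ht
    rw [hs.filter_sink] at ih₂
    rw [hs.component_headD_source hX, hs.filter_source] at ih₁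
    obtain ⟨row, hrow, hrowm⟩ := exists_rowFrom_eq_cons i j
    -- Sinks outside `X` come first, so after finishing the row of `j` the double loop treats the
    -- pairs of `G₂` and then those of `G₁`, in the order of the recursive calls.
    have hb : block ((i, j) :: rest) = (i, j) :: (row ++
        (block (rest.filter (fun p => N.t p.2 ∉ X)) ++
          block (rest.filter (fun p => N.t p.2 ∈ X)))) := by
      rw [block_cons, hrow, List.cons_append, ← block_append, ← hs.rest_append]
    have hp2 : ∀ p ∈ block (rest.filter (fun p => N.t p.2 ∉ X)),
        ∃ q ∈ rest, p.2 = q.2 ∧ N.t q.2 ∉ X := fun p hp => by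
      obtain ⟨q, hq, h1⟩ := mem_block.1 hp
      rw [List.mem_filter, decide_eq_true_eq] at hq
      exact ⟨q, hq.1, h1.2, hq.2⟩
    have hp1 : ∀ p ∈ block (rest.filter (fun p => N.t p.2 ∈ X)),
        ∃ q ∈ rest, p.2 = q.2 ∧ N.t q.2 ∈ X := fun p hp => by
      obtain ⟨q, hq, h1⟩ := mem_block.1 hp
      rw [List.mem_filter, decide_eq_true_eq] at hq
      exact ⟨q, hq.1, h1.2, hq.2⟩
    rw [hb] at hdl hloop
    rcases hloop with _ | ⟨_, _, _, _, fA, _, trA, hfA, hloop⟩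
    obtain rfl := hs.flow_eq hinv.nonneg hag hfA (hH _ (List.mem_cons_self ..))
    have hdl' : doubleLoop m = done ++ (i, j) :: (row ++
        (block (rest.filter (fun p => N.t p.2 ∉ X)) ++
          block (rest.filter (fun p => N.t p.2 ∈ X))) ++ after) := by rw [hdl]; simp
    have hinv' := hinv.step hdl' hfA
    have hH' := fun x hx => hH x (List.mem_cons_of_mem _ hx)
    have hrem := hs.mem_remaining_of_flow hdl' hinv hag hfA hloop
      (fun p hp => List.mem_append_left _ hp) (fun p hp => by
        rcases List.mem_append.1 hp with hp | hp
        · exact Or.inl (hrowm p hp).2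
        rcases List.mem_append.1 hp with hp | hp
        · obtain ⟨q, hq, h1, -⟩ := hp2 p hp
          exact Or.inr ⟨q, hq, h1⟩
        · obtain ⟨q, hq, h1, -⟩ := hp1 p hp
          exact Or.inr ⟨q, hq, h1⟩) hH'
    have hsup := hloop.support hinv'.nonneg hinv'.noClockwise
    have hsrc := fun x hx h0 =>
      hs.source_cases hloop hinv'.nonneg hinv'.noClockwise hH' (x := x) hx h0
    obtain ⟨trR, trB, cB, rfl, hloopR, hloopB⟩ := hloop.append
    obtain ⟨trA₂, trA₁, cC, rfl, hloop2, hloop1⟩ := hloopB.append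
    -- For the rest of the row, a source that sends flow would be an earlier one. It lies in `X` and
    -- `t j` does not, so what remains of `H` does not connect them.
    have hzero : ∀ x ∈ trR, x.flow = 0 := by
      intro x hx
      have hx' : x ∈ trR ++ (trA₂ ++ trA₁) := List.mem_append_left _ hx
      obtain ⟨hlt, hsink⟩ := hrowm _ (hloopR.mem x hx)
      simp only at hlt hsink
      by_contra h0
      refine h0 (eq_zero_of_support (hsup x hx').1 (hrem x hx') (hsup x hx').2 fun hr => ?_)
      rw [hsink] at hr
      rcases hsrc x hx' h0 with h1 | h1 | h1
      · exact hs.sink_notMem ((hs.reaches_side hr).1 (hs.early_mem_cut hX h1))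
      · exact hlt.ne h1
      · exact absurd (hlt.trans_le hs.le) (not_lt.2 h1.le)
    have hcB : ∀ d, cB d = (cA - f) d := fun d =>
      hloopR.final_apply fun x hx => by rw [hzero x hx]; rfl
    have hinvB := hloopR.inv (after := block (rest.filter (fun p => N.t p.2 ∉ X)) ++
      (block (rest.filter (fun p => N.t p.2 ∈ X)) ++ after)) (by rw [hdl]; simp) hinv'
    have hinvC := hloop2.inv (after := block (rest.filter (fun p => N.t p.2 ∈ X)) ++ after)
      (by rw [hdl]; simp) hinvB
    have hH2 : ∀ x ∈ trA₂, ∀ d, x.flow d ≠ 0 →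
        d ∈ (N.component (N.remaining H i j L X) (N.t j)).darts := fun x hx d hd => by
      have hx' : x ∈ trR ++ (trA₂ ++ trA₁) := by simp [hx]
      obtain ⟨q, hq, h1, h2⟩ := hp2 _ (hloop2.mem x hx)
      refine mem_component_of_support (fun _ => hs.remaining_rev) (hsup x hx').1 (hrem x hx') ?_
        (fun e he => ((hsup x hx').2 e he).2) hd
      simp only at h1
      rw [h1]
      exact (hs.reaches_sink_iff (Or.inr (Or.inr ⟨q, hq, rfl⟩))).2 h2
    have hH1 : ∀ x ∈ trA₁, ∀ d, x.flow d ≠ 0 →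
        d ∈ (N.component (N.remaining H i j L X) (N.s i)).darts := fun x hx d hd => by
      have hx' : x ∈ trR ++ (trA₂ ++ trA₁) := by simp [hx]
      obtain ⟨q, hq, h1, h2⟩ := hp1 _ (hloop1.mem x hx)
      refine mem_component_of_support (fun _ => hs.remaining_rev) (hsup x hx').1 (hrem x hx') ?_
        (fun e he => ((hsup x hx').2 e he).2) hd
      simp only at h1
      rw [h1]
      exact (hs.reaches_source_iff (Or.inr (Or.inr ⟨q, hq, rfl⟩))).2 h2
    -- The components share no dart, so the flows in `G₂` do not alter the capacities with which
    -- `G₁` is called.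
    have hcut : ∀ d ∈ (N.component (N.remaining H i j L X) (N.s i)).darts,
        d ∉ (N.component (N.remaining H i j L X) (N.t j)).darts := fun d h1 h2 =>
      hs.sink_notMem ((hs.reaches_side h2.2).2 ((hs.reaches_side h1.2).1 hs.source_mem))
    have e2 := ih₂ (after := block (rest.filter (fun p => N.t p.2 ∈ X)) ++ after)
      (hs.inv_sink hX) hs.nonneg' (by rw [hdl]; simp) hinvB hloop2 (fun d hd => by
        rw [hcB, Pi.sub_apply, Pi.sub_apply, hag d (component_remaining_subset hd)]) hH2
    have e1 := ih₁ (after := after) (hs.inv_source hX) hs.nonneg' (by rw [hdl]; simp) hinvC hloop1 (fun d hd => by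
        rw [hloop2.final_apply fun x hx => by_contra fun h0 => hcut d hd (hH2 x hx d h0),
          hcB, Pi.sub_apply, Pi.sub_apply, hag d (component_remaining_subset hd)]) hH1
    refine nonzero_cons_congr _ ?_
    rw [nonzero_append, nonzero_append, nonzero_append, nonzero_eq_nil hzero, e1, e2,
      List.nil_append]
  | back H early₁ early₂ k i j rest c f L X G₁ tr hf hL hcut hG₁ ht hk hk' _ ih =>
    subst hG₁
    have hs : N.CallStep H (early₁ ++ k :: early₂) i j rest c f L X :=
      ⟨hI, hc, hf, hL, hcut⟩
    have hX := fun h => hs.split_iff.2 h ht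
    have hcomp := (hs.component_headD_sink hX).2
    rw [hcomp] at hk hk' ih
    have hki : k < i := hs.early_lt (by simp)
    obtain ⟨mid, hmid, hmidm⟩ := exists_rowFrom_eq_append (j := j) hki
    have hb : block ((i, j) :: rest) = (i, j) :: (mid ++ block ((k, j) :: rest)) := by
      rw [block_cons, hmid, block_cons, List.cons_append, List.append_assoc]
    have hp1 : ∀ p ∈ block ((k, j) :: rest), p.2 = j ∨ ∃ q ∈ rest, p.2 = q.2 := fun p hp => by
      obtain ⟨q, hq, h1⟩ := mem_block.1 hp
      rcases List.mem_cons.1 hq with rfl | hq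
      · exact Or.inl h1.2
      · exact Or.inr ⟨q, hq, h1.2⟩
    have hmidj : ∀ p ∈ mid, p.2 = j := fun p hp => (mem_rowFrom.1 (by
      rw [hmid]; simp [hp] : p ∈ rowFrom i j)).2
    rw [hb] at hdl hloop
    rcases hloop with _ | ⟨_, _, _, _, fA, _, trA, hfA, hloop⟩
    obtain rfl := hs.flow_eq hinv.nonneg hag hfA (hH _ (List.mem_cons_self ..))
    have hdl' : doubleLoop m = done ++ (i, j) :: (mid ++ block ((k, j) :: rest) ++ after) := by
      rw [hdl]; simp
    have hinv' := hinv.step hdl' hfA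
    have hH' := fun x hx => hH x (List.mem_cons_of_mem _ hx)
    have hrem := hs.mem_remaining_of_flow hdl' hinv hag hfA hloop
      (fun p hp => List.mem_append_left _ hp) (fun p hp => by
        rcases List.mem_append.1 hp with hp | hp
        · exact Or.inl (hmidj p hp)
        · exact hp1 p hp) hH'
    have hsup := hloop.support hinv'.nonneg hinv'.noClockwise
    have hsrc := fun x hx h0 =>
      hs.source_cases hloop hinv'.nonneg hinv'.noClockwise hH' (x := x) hx h0
    obtain ⟨trR, trB, cB, rfl, hloopR, hloopB⟩ := hloop.append
    -- The skipped sources are strictly between `k` and `i`. Only those of `early₂` could send flow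
    -- inside `H`, and they are not in the component of `t j`.
    have hzero : ∀ x ∈ trR, x.flow = 0 := by
      intro x hx
      have hx' : x ∈ trR ++ trB := List.mem_append_left _ hx
      obtain ⟨hgt, hlt⟩ := hmidm _ (hloopR.mem x hx)
      have hsink := hmidj _ (hloopR.mem x hx)
      simp only at hlt hgt hsink
      by_contra h0
      refine h0 (eq_zero_of_support (hsup x hx').1 (hrem x hx') (hsup x hx').2 fun hr => ?_)
      rw [hsink] at hr
      rcases hsrc x hx' h0 with h1 | h1 | h1
      · rcases List.mem_append.1 h1 with h1 | h1
        · exact absurd ((List.pairwise_append.1 hI.early_sorted).2.2 _ h1 k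
            (List.mem_cons_self ..)) (not_lt.2 hgt.le)
        rcases List.mem_cons.1 h1 with h1 | h1
        · exact hgt.ne' h1
        · exact hk' _ h1 (hs.reaches_symm hr)
      · exact hlt.ne h1
      · exact absurd (hlt.trans_le hs.le) (not_lt.2 h1.le)
    have hcB : ∀ d, cB d = (cA - f) d := fun d =>
      hloopR.final_apply fun x hx => by rw [hzero x hx]; rfl
    have hinvB := hloopR.inv (after := block ((k, j) :: rest) ++ after)
      (by rw [hdl]; simp) hinv'
    have hH1 : ∀ x ∈ trB, ∀ d, x.flow d ≠ 0 →
        d ∈ (N.component (N.remaining H i j L X) (N.t j)).darts := fun x hx d hd => by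
      have hx' : x ∈ trR ++ trB := by simp [hx]
      refine mem_component_of_support (fun _ => hs.remaining_rev) (hsup x hx').1 (hrem x hx') ?_
        (fun e he => ((hsup x hx').2 e he).2) hd
      rcases hp1 _ (hloopB.mem x hx) with h1 | ⟨q, hq, h1⟩ <;> simp only at h1 <;> rw [h1]
      · exact Reaches.refl _
      · exact (hs.reaches_sink_iff (Or.inr (Or.inr ⟨q, hq, rfl⟩))).2 (hs.rest_notMem_cut hX hq)
    have e1 := ih (after := after) (hs.inv_back hX hk hk') hs.nonneg' (by rw [hdl]; simp) hinvB hloopB (fun d hd => by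
        rw [hcB, Pi.sub_apply, Pi.sub_apply, hag d (component_remaining_subset hd)]) hH1
    refine nonzero_cons_congr _ ?_
    rw [nonzero_append, nonzero_eq_nil hzero, e1, List.nil_append]

/-! ### The top-level call and the comparison of the two algorithms -/

theorem callInv_whole : N.CallInv N.whole [] ((List.finRange m).map fun i => (i, i)) := by
  refine ⟨fun _ _ => Set.mem_univ _, fun _ _ => Set.mem_univ _, fun x _ y _ => reaches_univ N x y,
    fun _ _ => Set.mem_univ _, by simp, fun a _ => Or.inr (Or.inl ⟨(a, a), by simp, rfl⟩),
    List.Pairwise.nil, by simp, by simp, fun p hp => ?_, ?_⟩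
  · obtain ⟨a, -, rfl⟩ := List.mem_map.1 (List.mem_of_mem_tail hp)
    rfl
  · rw [List.pairwise_map]
    exact List.pairwise_lt_finRange m

theorem exists_abstractRecursiveFlow {c f₀ : D → ℝ} (h : N.IsInitialSaturation c f₀) :
    ∃ tr, N.AbstractRecursiveFlow c f₀ tr := by
  obtain ⟨tr, htr⟩ := callInv_whole.exists_helperRun h.loopInv.nonneg h.loopInv.noClockwise
  exact ⟨tr, h, htr⟩

theorem AbstractRecursiveFlow.nonzero_eq {c f₀ cEnd : D → ℝ} {trA trR : List (Augmentation D m)}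
    (hR : N.AbstractRecursiveFlow c f₀ trR) (hA : N.AbstractFlow c f₀ trA cEnd) :
    nonzero trR = nonzero trA := by
  have hA' := hA.2
  rw [doubleLoop_eq_block] at hA'
  exact hR.2.nonzero_eq callInv_whole hA.1.loopInv.nonneg (done := []) (after := [])
    (by rw [doubleLoop_eq_block]; simp) hA.1.loopInv hA' (fun _ _ => rfl)
    fun _ _ _ _ => Set.mem_univ _

theorem total_eq_total_nonzero (f₀ : D → ℝ) (tr : List (Augmentation D m)) :
    total f₀ tr = total f₀ (nonzero tr) := by
  unfold total nonzero
  congr 1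
  induction tr with
  | nil => rfl
  | cons a tr ih =>
    by_cases h : a.flow = 0
    · simpa [h] using ih
    · simpa [h] using ih


end BoundaryNetwork

end PlanarFlowTheory

theorem mainTheorem6 {V D : Type*} [Fintype V] [Fintype D] {m : ℕ}
    (N : BoundaryNetwork V D m) (c : D → ℝ) (hc : ∀ d, 0 ≤ c d) :
    (∃ f₀, N.IsInitialSaturation c f₀) ∧
    ∀ f₀, N.IsInitialSaturation c f₀ →
      (∃ tr cEnd, N.AbstractFlow c f₀ tr cEnd) ∧
      (∃ tr, N.AbstractRecursiveFlow c f₀ tr) ∧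
      ∀ trA cEnd trR, N.AbstractFlow c f₀ trA cEnd → N.AbstractRecursiveFlow c f₀ trR →
        BoundaryNetwork.nonzero trR = BoundaryNetwork.nonzero trA ∧
        (∀ d, BoundaryNetwork.total f₀ trR d = c d - cEnd d) ∧
        N.IsMaxFlow Set.univ N.sources N.sinks c (BoundaryNetwork.total f₀ trR) := by
  refine ⟨BoundaryNetwork.exists_initialSaturation hc, fun f₀ h₀ => ⟨?_,
    BoundaryNetwork.exists_abstractRecursiveFlow h₀, fun trA cEnd trR hA hR => ?_⟩⟩
  · obtain ⟨tr, cEnd, h⟩ := BoundaryNetwork.exists_loopRun (N := N)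
      (BoundaryNetwork.doubleLoop m) h₀.loopInv.nonneg
    exact ⟨tr, cEnd, h₀, h⟩
  · have heq := hR.nonzero_eq hA
    have htot : BoundaryNetwork.total f₀ trR = BoundaryNetwork.total f₀ trA := by
      rw [BoundaryNetwork.total_eq_total_nonzero, heq, ← BoundaryNetwork.total_eq_total_nonzero]
    obtain ⟨h1, h2⟩ := hA.isMaxFlow
    rw [htot]
    exact ⟨heq, fun d => by rw [h1]; rfl, h2⟩
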